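/- Let $X$ be a normal projective (irreducible) complex variety with function field $\mathbb C(X)$, and let $\Lambda$ be a free, finitely generated group of Cartier divisors on $X$; we write $D_\lambda$ for $\lambda\in\Lambda$ regarded as a divisor. Put $\widehat S^\lambda=\mathcal O_X(D_\lambda)$, regarded as a subsheaf of the constant sheaf $\mathbb C(X)$, let $\widehat{\mathcal S}_\Lambda=\bigoplus_{\lambda\in\Lambda}\widehat S^\lambda$ be the Cox sheaf, with the multiplication of rational functions, let $\mathcal S_\Lambda=\Gamma(X,\widehat{\mathcal S}_\Lambda)$ be the Cox ring and let $\pi:\widehat Y=\operatorname{Spec}_X\widehat{\mathcal S}_\Lambda\to X$ be the characteristic space. Fix an affine covering $(U_i)_{i\in I}$ of $X$ and local equations $f_i^\lambda\in\mathbb C(X)^*$ of $D_\lambda$ on $U_i$ which depend multiplicatively on $\lambda$; put $g_{ij}^\lambda=f_j^\lambda/f_i^\lambda\in\mathcal O_X^*(U_i\cap U_j)$ and $\psi_{ij}(\lambda)=d\log g_{ij}^\lambda\in\Omega_X(U_i\cap U_j)$. The cocycle $(\psi_{ij}(\lambda))$ represents $c_1(\lambda)\in H^1(X,\Omega_X)$.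 Put $\Lambda_X=\Lambda\otimes_{\mathbb Z}\mathcal O_X$, let $\widetilde\psi_{ij}:\Lambda_X\to\Omega_X$ be the $\mathcal O_X$-linear extension of $\psi_{ij}$ over $U_i\cap U_j$, and let $\mathcal R_\Lambda$ be the sheaf of $\mathcal O_X$-modules whose sections over $U$ are the families of $(\omega_i,m_i)\in(\Omega_X\oplus\Lambda_X)(U\cap U_i)$ with $m_j=m_i$ and $\omega_j=\omega_i+\widetilde\psi_{ij}(m_i)$ on $U\cap U_i\cap U_j$. This gives the generalized Euler sequence $0\to\Omega_X\to\mathcal R_\Lambda\to\Lambda_X\to0$. Assume that $c_1:\Lambda\to H^1(X,\Omega_X)$ is injective, that $\Lambda$ contains an ample divisor, and that $\mathcal S_\Lambda$ is a finitely generated $\mathbb C$-algebra. Then there is a commutative diagram of $\Lambda$-graded sheaves of $\mathcal O_X$-modules, with maps preserving the degree, $$\begin{array}{ccccccccc} 0&\to&\pi_*\pi^*\Omega_X&\to&\pi_*\Omega_{\widehat Y}&\to&\pi_*\Omega_{\widehat Y/X}&\to&0\\ &&\downarrow&&\downarrow{\scriptstyle\widehat\varphi}&&\downarrow&&\\ 0&\to&\Omega_X\otimes_{\mathcal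 O_X}\widehat{\mathcal S}_\Lambda&\to&\mathcal R_\Lambda\otimes_{\mathcal O_X}\widehat{\mathcal S}_\Lambda&\to&\Lambda_X\otimes_{\mathcal O_X}\widehat{\mathcal S}_\Lambda&\to&0 \end{array}$$ whose rows are exact and whose vertical arrows are isomorphisms. The upper row is the direct image of the relative cotangent sequence of $\pi$, and the lower row is the generalized Euler sequence tensored with $\widehat{\mathcal S}_\Lambda$. The map $\widehat\varphi$ is the $\widehat{\mathcal S}_\Lambda$-linear map induced by the derivation $s\mapsto ds$ of $\widehat{\mathcal S}_\Lambda$: for a section $h$ of $\widehat S^\lambda$ over an affine open $V\subseteq U_i$, with local expression $s_i=hf_i^\lambda\in\mathcal O_X(V)$, and for $t\in\widehat{\mathcal S}_\Lambda(V)$, $$\widehat\varphi(t\,dh)=(ds_i,\;D_\lambda\otimes s_i)\otimes (f_i^\lambda)^{-1}t ,$$ where $(f_i^\lambda)^{-1}$ is the generator of $\widehat S^\lambda$ over $V$ and $(ds_i,D_\lambda\otimes s_i)\in(\Omega_X\oplus\Lambda_X)(V)$ is regarded as a section of $\mathcal R_\Lambda$ through its $i$-th component. In the gradings, the part of degree $\lambda$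 of a tensor product $\mathcal F\otimes\widehat{\mathcal S}_\Lambda$ is generated by the $m\otimes s$ with $s\in\widehat S^\lambda$, that of $\pi_*\pi^*\Omega_X$ by the $t\,\pi^*\omega$ with $t\in\widehat S^\lambda$, and those of $\pi_*\Omega_{\widehat Y}$ and $\pi_*\Omega_{\widehat Y/X}$ by the $t\,ds$ with $t\in\widehat S^{\mu}$, $s\in\widehat S^{\nu}$, $\mu+\nu=\lambda$. -/

import Mathlib

open CategoryTheory AlgebraicGeometry TopologicalSpace Opposite
open scoped TensorProduct

namespace CoxEuler
noncomputable section

/-! ### Sheaves of modules: sheafification -/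

section Sheafify

variable {X : Scheme.{0}}

/-- The sheaf of `𝒪_X`-modules associated with a presheaf of `𝒪_X`-modules. -/
def sheafify (P : X.PresheafOfModules) : X.Modules :=
  (PresheafOfModules.sheafification (𝟙 X.ringCatSheaf.obj)).obj P

/-- Functoriality of the associated sheaf. -/
def sheafifyMap {P Q : X.PresheafOfModules} (φ : P ⟶ Q) : sheafify P ⟶ sheafify Q :=
  (PresheafOfModules.sheafification (𝟙 X.ringCatSheaf.obj)).map φ

/-- The section of the associated sheaf defined by a section of the presheaf. -/
def toSheafify (P : X.PresheafOfModules) (U : X.Opens) : P.obj (op U) →+ Γ(sheafify P, U) :=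
  (((PresheafOfModules.sheafificationAdjunction (𝟙 X.ringCatSheaf.obj)).unit.app P).app
    (op U)).hom.toAddMonoidHom

/-- Morphisms from a presheaf of modules to a sheaf factor through the associated sheaf. -/
def sheafifyDesc {P : X.PresheafOfModules} {M : X.Modules} (φ : P ⟶ M.val) : sheafify P ⟶ M :=
  ((PresheafOfModules.sheafificationAdjunction (𝟙 X.ringCatSheaf.obj)).homEquiv P M).symm φ

lemma toSheafify_smul (P : X.PresheafOfModules) (U : X.Opens) (a : Γ(X, U)) (m : P.obj (op U)) :
    toSheafify P U ((show X.ringCatSheaf.obj.obj (op U) from a) • m) = a • toSheafify P U m :=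
  (((PresheafOfModules.sheafificationAdjunction (𝟙 X.ringCatSheaf.obj)).unit.app P).app
    (op U)).hom.map_smul a m

lemma sheafifyDesc_app {P : X.PresheafOfModules} {M : X.Modules} (φ : P ⟶ M.val) (U : X.Opens) (m : P.obj (op U)) :
   (sheafifyDesc φ).app U (toSheafify P U m) = φ.app (op U) m := by
  have := ((PresheafOfModules.sheafificationAdjunction (𝟙 X.ringCatSheaf.obj)).homEquiv P M).apply_symm_apply φ
  exact congr($(this).app (op U) m)

lemma toSheafify_map (P : X.PresheafOfModules) {U V : X.Opens} (i : V ⟶ U) (m : P.obj (op U)) :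
    (sheafify P).presheaf.map i.op (toSheafify P U m) = toSheafify P V (P.map i.op m) :=
  (PresheafOfModules.naturality_apply ((PresheafOfModules.sheafificationAdjunction (𝟙 X.ringCatSheaf.obj)).unit.app P) i.op m).symm

lemma sheafifyMap_app {P Q : X.PresheafOfModules} (φ : P ⟶ Q) (U : X.Opens) (m : P.obj (op U)) :
    (sheafifyMap φ).app U (toSheafify P U m) = toSheafify Q U (φ.app (op U) m) := by
  have := (PresheafOfModules.sheafificationAdjunction (𝟙 X.ringCatSheaf.obj)).unit.naturality φ
  exact congr($(this.symm).app (op U) m)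
end Sheafify

/-! ### Kähler differentials -/

section Differentials

variable {X Y S : Scheme.{0}}

/-- The image of the presheaf `f⁻¹ 𝒪_S` in `𝒪_X(U)`: the subring generated by the restrictions of
the pullbacks of functions on open subsets of `S`. -/
def pulledBackFunctions (f : X ⟶ S) (U : X.Opens) : Subring Γ(X, U) :=
  Subring.closure {b | ∃ (V : S.Opens) (e : U ≤ f ⁻¹ᵁ V) (a : Γ(S, V)), f.appLE V U e a = b}

/-- The presheaf `U ↦ pulledBackFunctions f U` of rings on `X`. -/
def pulledBackPresheaf (f : X ⟶ S) : X.Opensᵒᵖ ⥤ CommRingCat where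
  obj U := .of (pulledBackFunctions f U.unop)
  map {U V} i := CommRingCat.ofHom ((X.presheaf.map i).hom.restrict _ _ (by
    suffices pulledBackFunctions f U.unop ≤ (pulledBackFunctions f V.unop).comap (X.presheaf.map i).hom from
      fun x hx => this hx
    refine Subring.closure_le.2 ?_
    rintro _ ⟨W, e, a, rfl⟩
    refine Subring.subset_closure ⟨W, i.unop.le.trans e, a, ?_⟩
    rw [← Scheme.Hom.appLE_map f e i]; rfl))
  map_id U := by
    refine CommRingCat.hom_ext (RingHom.ext fun x => Subtype.ext ?_)
    exact congr($(X.presheaf.map_id U) x.1)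
  map_comp i j := by
    refine CommRingCat.hom_ext (RingHom.ext fun x => Subtype.ext ?_)
    exact congr($(X.presheaf.map_comp i j) x.1)

/-- The inclusion into the structure sheaf. -/
def pulledBackIncl (f : X ⟶ S) : pulledBackPresheaf f ⟶ X.presheaf where
  app U := CommRingCat.ofHom (pulledBackFunctions f U.unop).subtype
  naturality _ _ _ := rfl

/-- The presheaf of modules of Kähler differentials of `𝒪_X(U)` over the image of
`f⁻¹ 𝒪_S`. -/
def preDifferentials (f : X ⟶ S) : X.PresheafOfModules :=
  PresheafOfModules.DifferentialsConstruction.relativeDifferentials' (pulledBackIncl f)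

/-- The sheaf `Ω_{X/S}` of relative Kähler differentials of `f : X ⟶ S`. -/
def differentials (f : X ⟶ S) : X.Modules := sheafify (preDifferentials f)

/-- The universal derivation `d : 𝒪_X ⟶ Ω_{X/S}`. -/
def d (f : X ⟶ S) (U : X.Opens) : Γ(X, U) →+ Γ(differentials f, U) :=
  (toSheafify (preDifferentials f) U).comp
    (PresheafOfModules.DifferentialsConstruction.derivation' (pulledBackIncl f)).d

lemma d_mul (f : X ⟶ S) (U : X.Opens) (a b : Γ(X, U)) :
    d f U (a * b) = a • d f U b + b • d f U a := by
  have := (PresheafOfModules.DifferentialsConstruction.derivation' (pulledBackIncl f)).d_mul (X := op U) a b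
  refine (congrArg (toSheafify (preDifferentials f) U) this).trans ?_
  refine (map_add (toSheafify (preDifferentials f) U) _ _).trans ?_
  exact congrArg₂ (· + ·) (toSheafify_smul _ _ _ _) (toSheafify_smul _ _ _ _)

lemma d_map (f : X ⟶ S) {U V : X.Opens} (i : V ⟶ U) (a : Γ(X, U)) :
    d f V (X.presheaf.map i.op a) = (differentials f).presheaf.map i.op (d f U a) := by
  have := (PresheafOfModules.DifferentialsConstruction.derivation' (pulledBackIncl f)).d_map i.op a
  exact (congrArg _ this).trans (toSheafify_map _ _ _).symm

lemma d_appLE (f : X ⟶ S) (U : X.Opens) {V : S.Opens} (e : U ≤ f ⁻¹ᵁ V) (a : Γ(S, V)) :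
    d f U (f.appLE V U e a) = 0 := by
  have := PresheafOfModules.Derivation'.d_app (PresheafOfModules.DifferentialsConstruction.derivation' (pulledBackIncl f)) (X := op U) ⟨_, Subring.subset_closure ⟨V, e, a, rfl⟩⟩
  exact (congrArg (toSheafify (preDifferentials f) U) this).trans (map_zero (toSheafify (preDifferentials f) U))

/-- The morphism of sheaves of modules corresponding to a derivation which is trivial on the functions
pulled back from `S`. -/
def differentialsDesc (f : X ⟶ S) (M : X.Modules) (D : ∀ U : X.Opens, Γ(X, U) →+ Γ(M, U))
    (hmul : ∀ U a b, D U (a * b) = a • D U b + b • D U a)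
    (hmap : ∀ (U V : X.Opens) (i : V ⟶ U) a, D V (X.presheaf.map i.op a) = M.presheaf.map i.op (D U a))
    (hzero : ∀ (U : X.Opens) (V : S.Opens) (e : U ≤ f ⁻¹ᵁ V) (a : Γ(S, V)), D U (f.appLE V U e a) = 0) :
    differentials f ⟶ M :=
  sheafifyDesc ((PresheafOfModules.DifferentialsConstruction.isUniversal' (pulledBackIncl f)).desc
    (M' := M.val)
    { d := fun {U} => D U.unop
      d_mul := fun {U} a b => hmul U.unop a b
      d_map := fun {U V} i a => hmap U.unop V.unop i.unop a
      d_app := fun {U} a => by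
        change D U.unop a.1 = 0
        have key : pulledBackFunctions f U.unop ≤
          { carrier := {b | D U.unop b = 0}
            mul_mem' := fun {a b} ha hb => by
              simp only [Set.mem_ofPred_eq] at *
              rw [hmul, ha, hb, smul_zero, smul_zero, add_zero]
            one_mem' := by
              have := hmul U.unop 1 1
              simpa using this
            add_mem' := fun {a b} ha hb => by
              simp only [Set.mem_ofPred_eq] at *
              rw [map_add, ha, hb, add_zero]
            zero_mem' := map_zero _
            neg_mem' := fun {a} ha => by
              simp only [Set.mem_ofPred_eq] at *
              rw [map_neg, ha, neg_zero] : Subring Γ(X, U.unop) } := by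
          refine Subring.closure_le.2 ?_
          rintro _ ⟨V, e, a, rfl⟩
          exact hzero _ _ _ _
        exact key a.2 })

lemma differentialsDesc_d (f : X ⟶ S) (M : X.Modules) (D hmul hmap hzero) (U : X.Opens) (a : Γ(X, U)) :
    (differentialsDesc f M D hmul hmap hzero).app U (d f U a) = D U a := by
  refine (sheafifyDesc_app _ _ _).trans ?_
  exact PresheafOfModules.Derivation.congr_d ((PresheafOfModules.DifferentialsConstruction.isUniversal' (pulledBackIncl f)).fac _) _

/-- The map `Ω_{X/S} ⟶ g_* Ω_{Y/S}`, `da ↦ d(g^♯ a)`. -/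
def differentialsPush (g : Y ⟶ X) (f : X ⟶ S) :
    differentials f ⟶ (Scheme.Modules.pushforward g).obj (differentials (g ≫ f)) :=
  differentialsDesc f _ (fun U => (d (g ≫ f) (g ⁻¹ᵁ U)).comp (g.app U).hom.toAddMonoidHom)
    (fun U a b => by
      refine (congrArg (d (g ≫ f) (g ⁻¹ᵁ U)) (map_mul (g.app U).hom a b)).trans ?_
      exact d_mul _ _ _ _)
    (fun U V i a => by
      refine (congrArg (d (g ≫ f) (g ⁻¹ᵁ V)) congr($(g.naturality i.op) a)).trans ?_
      exact d_map (g ≫ f) ((Opens.map g.base).map i) _)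
    (fun U V e a => by
      have : g.app U (f.appLE V U e a) = (g ≫ f).appLE V (g ⁻¹ᵁ U) (g.preimage_mono e) a := by
        rw [← CommRingCat.comp_apply, Scheme.Hom.app_eq_appLE, Scheme.Hom.appLE_comp_appLE]
      exact (congrArg (d (g ≫ f) (g ⁻¹ᵁ U)) this).trans (d_appLE _ _ _ _))

/-- The map `g^* Ω_{X/S} ⟶ Ω_{Y/S}` of the relative cotangent sequence of `g : Y ⟶ X`. -/
def cotangentFst (g : Y ⟶ X) (f : X ⟶ S) :
    (Scheme.Modules.pullback g).obj (differentials f) ⟶ differentials (g ≫ f) :=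
  ((Scheme.Modules.pullbackPushforwardAdjunction g).homEquiv _ _).symm (differentialsPush g f)

/-- The map `Ω_{Y/S} ⟶ Ω_{Y/X}`, `da ↦ da`, of the relative cotangent sequence of `g : Y ⟶ X`. -/
def cotangentSnd (g : Y ⟶ X) (f : X ⟶ S) : differentials (g ≫ f) ⟶ differentials g :=
  differentialsDesc _ _ (d g) (d_mul g) (fun _ _ i => d_map g i)
    (fun U V e a => by
      have : (g ≫ f).appLE V U e a = g.appLE (f ⁻¹ᵁ V) U e (f.app V a) :=
        congr($(Scheme.Hom.comp_appLE g f V U e) a)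
      exact (congrArg (d g U) this).trans (d_appLE g U _ _))

end Differentials

/-! ### Cartier divisors -/
section Divisors

section
variable (X : Scheme.{0}) [IsIntegral X]

/-- The subgroup `𝒪_{X,x}ˣ` of the multiplicative group of the field of rational functions. -/
def stalkUnits (x : X) : Subgroup X.functionFieldˣ :=
  (Units.map (algebraMap (X.presheaf.stalk x) X.functionField).toMonoidHom).range

/-- The stalk at `x` of the sheaf `𝒦ˣ / 𝒪ˣ`, written additively. -/
abbrev LocalDivisor (x : X) : Type := Additive (X.functionFieldˣ ⧸ stalkUnits X x)

end

variable {X : Scheme.{0}} [IsIntegral X]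

/-- The germ at `x` of the principal divisor of a nonzero rational function. -/
def principalAt (x : X) (f : X.functionFieldˣ) : LocalDivisor X x :=
  Additive.ofMul (QuotientGroup.mk f)

lemma principalAt_mul (x : X) (f g : X.functionFieldˣ) :
    principalAt x (f * g) = principalAt x f + principalAt x g := rfl

lemma principalAt_one (x : X) : principalAt x 1 = 0 := rfl

lemma principalAt_inv (x : X) (f : X.functionFieldˣ) :
    principalAt x f⁻¹ = - principalAt x f := rfl

lemma principalAt_surjective (x : X) : Function.Surjective (principalAt x) :=
  QuotientGroup.mk_surjective

lemma principalAt_eq_iff (x : X) (f g : X.functionFieldˣ) :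
    principalAt x f = principalAt x g ↔ f⁻¹ * g ∈ stalkUnits X x := QuotientGroup.eq

variable (X) in
/-- The group of Cartier divisors on `X`, i.e. of global sections of `𝒦ˣ / 𝒪ˣ`: families of germs
which are locally given by a single rational function. -/
def CartierDivisor : AddSubgroup (∀ x : X, LocalDivisor X x) where
  carrier := {D | ∀ x : X, ∃ U : X.Opens, x ∈ U ∧
    ∃ f : X.functionFieldˣ, ∀ y ∈ U, D y = principalAt y f}
  zero_mem' x := ⟨⊤, trivial, 1, fun _ _ => rfl⟩
  add_mem' {D E} hD hE x := by
    obtain ⟨U, hU, f, hf⟩ := hD x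
    obtain ⟨V, hV, g, hg⟩ := hE x
    refine ⟨U ⊓ V, ⟨hU, hV⟩, f * g, fun y hy => ?_⟩
    rw [principalAt_mul, ← hf y hy.1, ← hg y hy.2]; rfl
  neg_mem' {D} hD x := by
    obtain ⟨U, hU, f, hf⟩ := hD x
    refine ⟨U, hU, f⁻¹, fun y hy => ?_⟩
    rw [principalAt_inv, ← hf y hy]; rfl

/-- The rational functions which are regular at `x`. -/
def localRing (x : X) : Subring X.functionField :=
  (algebraMap (X.presheaf.stalk x) X.functionField).range

lemma stalkUnits_iff {x : X} {f : X.functionFieldˣ} :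
    f ∈ stalkUnits X x ↔ (f : X.functionField) ∈ localRing x ∧
      ((f⁻¹ : X.functionFieldˣ) : X.functionField) ∈ localRing x := by
  constructor
  · rintro ⟨u, rfl⟩
    exact ⟨⟨u, rfl⟩, ⟨(u⁻¹ : (X.presheaf.stalk x)ˣ), by simp⟩⟩
  · rintro ⟨⟨a, ha⟩, ⟨b, hb⟩⟩
    have hinj := IsFractionRing.injective (X.presheaf.stalk x) X.functionField
    have hab : a * b = 1 := hinj (by rw [map_mul, ha, hb, map_one]; simp)
    exact ⟨⟨a, b, hab, by rw [mul_comm, hab]⟩, Units.ext ha⟩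

/-- A rational function `h` is a section of `𝒪_X(D)` at `x`: `div h + D ≥ 0` at `x`, i.e. `h f` is
regular at `x` for a local equation `f` of `D` at `x`. -/
def IsRegularAt (D : CartierDivisor X) (x : X) (h : X.functionField) : Prop :=
  ∀ f : X.functionFieldˣ, D.1 x = principalAt x f → h * f ∈ localRing x

lemma isRegularAt_iff {D : CartierDivisor X} {x : X} {h : X.functionField}
    {f : X.functionFieldˣ} (hf : D.1 x = principalAt x f) :
    IsRegularAt D x h ↔ h * f ∈ localRing x := by
  refine ⟨fun H => H f hf, fun H g hg => ?_⟩
  have hu : f⁻¹ * g ∈ stalkUnits X x := (principalAt_eq_iff x f g).1 (hf.symm.trans hg)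
  have := (localRing x).mul_mem H (stalkUnits_iff.1 hu).1
  have e : h * f * ((f⁻¹ * g : X.functionFieldˣ) : X.functionField) = h * g := by
    rw [Units.val_mul, mul_assoc, ← mul_assoc (f : X.functionField), Units.mul_inv, one_mul]
  rwa [e] at this

lemma IsRegularAt.zero (D : CartierDivisor X) (x : X) : IsRegularAt D x 0 := fun f _ => by
  rw [zero_mul]; exact (localRing x).zero_mem

lemma IsRegularAt.add {D : CartierDivisor X} {x : X} {h k : X.functionField}
    (hh : IsRegularAt D x h) (hk : IsRegularAt D x k) : IsRegularAt D x (h + k) := fun f hf => by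
  rw [add_mul]; exact (localRing x).add_mem (hh f hf) (hk f hf)

lemma IsRegularAt.neg {D : CartierDivisor X} {x : X} {h : X.functionField}
    (hh : IsRegularAt D x h) : IsRegularAt D x (-h) := fun f hf => by
  rw [neg_mul]; exact (localRing x).neg_mem (hh f hf)

lemma IsRegularAt.mul {D E : CartierDivisor X} {x : X} {h k : X.functionField}
    (hh : IsRegularAt D x h) (hk : IsRegularAt E x k) : IsRegularAt (D + E) x (h * k) := by
  obtain ⟨f, hf⟩ := principalAt_surjective x (D.1 x)
  obtain ⟨g, hg⟩ := principalAt_surjective x (E.1 x)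
  have : (D + E).1 x = principalAt x (f * g) := by rw [principalAt_mul, hf, hg]; rfl
  rw [isRegularAt_iff this]
  have := (localRing x).mul_mem (hh f hf.symm) (hk g hg.symm)
  rwa [mul_mul_mul_comm] at this

lemma isRegularAt_zero_iff {x : X} {h : X.functionField} :
    IsRegularAt (0 : CartierDivisor X) x h ↔ h ∈ localRing x := by
  rw [isRegularAt_iff (f := 1) (principalAt_one x).symm, Units.val_one, mul_one]

/-- The value of a function on `U` as a rational function (it does not depend on `x`). -/
def toRational (U : X.Opens) (x : U) : Γ(X, U) →+* X.functionField :=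
  (algebraMap (X.presheaf.stalk x.1) X.functionField).comp (X.presheaf.germ U x.1 x.2).hom

lemma toRational_eq (U : X.Opens) (x y : U) (a : Γ(X, U)) :
    toRational U x a = toRational U y a := by
  have : Nonempty U := ⟨x⟩
  exact (Scheme.algebraMap_germ_eq_germToFunctionField X x.2 a).trans
    (Scheme.algebraMap_germ_eq_germToFunctionField X y.2 a).symm

lemma toRational_mem (U : X.Opens) (x : U) (a : Γ(X, U)) : toRational U x a ∈ localRing x.1 :=
  ⟨_, rfl⟩

lemma toRational_map {U V : X.Opens} (i : V ⟶ U) (x : V) (a : Γ(X, U)) :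
    toRational V x (X.presheaf.map i.op a) = toRational U ⟨x.1, i.le x.2⟩ a :=
  congrArg _ (X.presheaf.germ_res_apply i x.1 x.2 a)

lemma toRational_injective (U : X.Opens) (x : U) : Function.Injective (toRational U x) := by
  have : Nonempty U := ⟨x⟩
  intro a b h
  exact germ_injective_of_isIntegral X x.1 x.2 (IsFractionRing.injective _ X.functionField h)

lemma eq_of_toRational {U : X.Opens} {a b : Γ(X, U)}
    (h : ∀ x : U, toRational U x a = toRational U x b) : a = b := by
  refine TopCat.Presheaf.section_ext X.sheaf U a b fun x hx => ?_
  exact IsFractionRing.injective (X.presheaf.stalk x) X.functionField (h ⟨x, hx⟩)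

/-- A rational function which is regular at all points of `U` is a function on `U`. -/
lemma exists_section (U : X.Opens) (h : X.functionField) (hh : ∀ x : U, h ∈ localRing x.1) :
    ∃ a : Γ(X, U), ∀ x : U, toRational U x a = h := by
  have key : ∀ x : U, ∃ (V : X.Opens) (_ : x.1 ∈ V) (_ : V ≤ U) (a : Γ(X, V)),
      ∀ y : V, toRational V y a = h := by
    intro x
    obtain ⟨s, hs⟩ := hh x
    obtain ⟨V, hxV, a, ha⟩ := X.presheaf.exists_germ_eq s
    refine ⟨V ⊓ U, ⟨hxV, x.2⟩, inf_le_right, X.presheaf.map (homOfLE inf_le_left).op a, ?_⟩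
    intro y
    rw [toRational_map, toRational_eq V _ ⟨x.1, hxV⟩, ← hs, ← ha]
    rfl
  choose V hxV hVU a ha using key
  obtain ⟨s, hs, -⟩ := X.sheaf.existsUnique_gluing' V U (fun x => homOfLE (hVU x))
    (fun x hx => Opens.mem_iSup.2 ⟨⟨x, hx⟩, hxV ⟨x, hx⟩⟩) a (by
      intro x y
      refine eq_of_toRational fun z => ?_
      refine (toRational_map (Opens.infLELeft (V x) (V y)) z (a x)).trans ?_
      refine Eq.trans ?_ (toRational_map (Opens.infLERight (V x) (V y)) z (a y)).symm
      rw [ha, ha])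
  refine ⟨s, fun x => ?_⟩
  have := hs x
  rw [← ha x ⟨x.1, hxV x⟩, ← this]
  exact (toRational_map (homOfLE (hVU x)) ⟨x.1, hxV x⟩ s).symm

end Divisors

/-! ### The Cox sheaf -/

section CoxSheaf

variable {X : Scheme.{0}} [IsIntegral X] (Λ : AddSubgroup (CartierDivisor X))

/-- Formal sums `∑ h_λ χ^λ` of rational functions such that each `h_λ` is a section of `𝒪_X(D_λ)` at
`x`; the product is that of the group algebra `K(X)[Λ]`. -/
def coxStalk (x : X) : Subring (AddMonoidAlgebra X.functionField Λ) where
  carrier := {F | ∀ l : Λ, IsRegularAt l.1 x (F.coeff l)}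
  zero_mem' l := .zero _ _
  add_mem' {F G} hF hG l := (hF l).add (hG l)
  neg_mem' {F} hF l := (hF l).neg
  one_mem' l := by
    classical
    rw [AddMonoidAlgebra.one_def, AddMonoidAlgebra.coeff_single, Finsupp.single_apply]
    split_ifs with h
    · subst h; exact isRegularAt_zero_iff.2 (localRing x).one_mem
    · exact .zero _ _
  mul_mem' {F G} hF hG l := by
    classical
    rw [AddMonoidAlgebra.coeff_mul, Finsupp.sum, ]
    refine Finset.sum_induction _ (IsRegularAt l.1 x) (fun _ _ => .add) (.zero _ _) fun m _ => ?_
    rw [Finsupp.sum]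
    refine Finset.sum_induction _ (IsRegularAt l.1 x) (fun _ _ => .add) (.zero _ _) fun n _ => ?_
    split_ifs with h
    · subst h; exact (hF m).mul (hG n)
    · exact .zero _ _

/-- Sections over `U` of the Cox sheaf `⨁ 𝒪_X(D_λ)`: elements of `K(X)[Λ]`, regarded as constant
functions on `U` (so that there is only one of them if `U` is empty), whose coefficients are sections
of `𝒪_X(D_λ)` at all points of `U`. -/
def coxSections (U : X.Opens) : Subring (U → AddMonoidAlgebra X.functionField Λ) where
  carrier := {F | (∃ F₀, ∀ x, F x = F₀) ∧ ∀ x : U, F x ∈ coxStalk Λ x.1}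
  zero_mem' := ⟨⟨0, fun _ => rfl⟩, fun x => (coxStalk Λ x.1).zero_mem⟩
  one_mem' := ⟨⟨1, fun _ => rfl⟩, fun x => (coxStalk Λ x.1).one_mem⟩
  add_mem' := by
    rintro F G ⟨⟨F₀, hF₀⟩, hF⟩ ⟨⟨G₀, hG₀⟩, hG⟩
    exact ⟨⟨F₀ + G₀, fun x => by rw [Pi.add_apply, hF₀, hG₀]⟩,
      fun x => (coxStalk Λ x.1).add_mem (hF x) (hG x)⟩
  mul_mem' := by
    rintro F G ⟨⟨F₀, hF₀⟩, hF⟩ ⟨⟨G₀, hG₀⟩, hG⟩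
    exact ⟨⟨F₀ * G₀, fun x => by rw [Pi.mul_apply, hF₀, hG₀]⟩,
      fun x => (coxStalk Λ x.1).mul_mem (hF x) (hG x)⟩
  neg_mem' := by
    rintro F ⟨⟨F₀, hF₀⟩, hF⟩
    exact ⟨⟨-F₀, fun x => by rw [Pi.neg_apply, hF₀]⟩, fun x => (coxStalk Λ x.1).neg_mem (hF x)⟩

/-- The ring of sections of the Cox sheaf over `U`. -/
def CoxRing (U : X.Opens) : Type := coxSections Λ U

instance (U : X.Opens) : CommRing (CoxRing Λ U) := inferInstanceAs (CommRing (coxSections Λ U))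

/-- Restriction of sections of the Cox sheaf. -/
def coxRestrict {U V : X.Opens} (e : V ≤ U) : CoxRing Λ U →+* CoxRing Λ V where
  toFun F := ⟨fun x => F.1 ⟨x.1, e x.2⟩,
    F.2.1.imp fun _ h x => h _, fun x => F.2.2 ⟨x.1, e x.2⟩⟩
  map_zero' := rfl
  map_one' := rfl
  map_add' _ _ := rfl
  map_mul' _ _ := rfl

lemma single_zero_mem_coxStalk {x : X} {h : X.functionField} (hh : h ∈ localRing x) :
    AddMonoidAlgebra.single (0 : Λ) h ∈ coxStalk Λ x := by
  classical
  intro l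
  rw [AddMonoidAlgebra.coeff_single, Finsupp.single_apply]
  split_ifs with e
  · subst e; exact isRegularAt_zero_iff.2 hh
  · exact .zero _ _

/-- The inclusion of `𝒪_X(U)` into the Cox sheaf as the part of degree zero. -/
def coxAlgebraMap (U : X.Opens) : Γ(X, U) →+* CoxRing Λ U :=
  RingHom.codRestrict (RingHom.pi fun x : U =>
    (AddMonoidAlgebra.singleZeroRingHom (M := Λ)).comp (toRational U x)) (coxSections Λ U) (by
      intro a
      refine ⟨?_, fun x => single_zero_mem_coxStalk Λ (toRational_mem U x a)⟩
      by_cases hU : Nonempty U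
      · obtain ⟨y⟩ := hU
        exact ⟨.single 0 (toRational U y a), fun x =>
          congrArg (AddMonoidAlgebra.single (0 : Λ)) (toRational_eq U x y a)⟩
      · exact ⟨0, fun x => (hU ⟨x⟩).elim⟩)

instance (U : X.Opens) : Algebra Γ(X, U) (CoxRing Λ U) := (coxAlgebraMap Λ U).toAlgebra

lemma coxRestrict_algebraMap {U V : X.Opens} (i : V ⟶ U) (a : Γ(X, U)) :
    coxRestrict Λ i.le (coxAlgebraMap Λ U a) = coxAlgebraMap Λ V (X.presheaf.map i.op a) := by
  refine Subtype.ext (funext fun x => ?_)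
  exact congrArg (AddMonoidAlgebra.single (0 : Λ)) (toRational_map i x a).symm

/-- The Cox sheaf `𝒮̂_Λ`. -/
def coxPresheaf : X.Opensᵒᵖ ⥤ CommRingCat.{0} where
  obj U := .of (CoxRing Λ U.unop)
  map i := CommRingCat.ofHom (coxRestrict Λ i.unop.le)

/-- The `𝒪_X`-algebra structure of the Cox sheaf. -/
def coxStructure : X.presheaf ⟶ coxPresheaf Λ where
  app U := CommRingCat.ofHom (coxAlgebraMap Λ U.unop)
  naturality U V i := by
    refine CommRingCat.hom_ext (RingHom.ext fun a => ?_)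
    exact (coxRestrict_algebraMap Λ i.unop a).symm

lemma IsRegularAt.mul_localRing {D : CartierDivisor X} {x : X} {h k : X.functionField}
    (hh : h ∈ localRing x) (hk : IsRegularAt D x k) : IsRegularAt D x (h * k) := by
  have := (isRegularAt_zero_iff.2 hh).mul hk
  rwa [zero_add] at this

lemma exists_pow_isRegularAt_local (D : CartierDivisor X) {U : X.Opens} (r : Γ(X, U))
    (h : X.functionField)
    (hh : ∀ y ∈ X.basicOpen r, IsRegularAt D y h) (x : U) :
    ∃ V : X.Opens, x.1 ∈ V ∧ ∃ n : ℕ, ∀ m, n ≤ m → ∀ y : U, y.1 ∈ V →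
      IsRegularAt D y.1 (toRational U y r ^ m * h) := by
  obtain ⟨W, hxW, f, hf⟩ := D.2 x.1
  obtain ⟨_, ⟨V, hV, rfl⟩, hxV, hVU⟩ := X.isBasis_affineOpens.exists_subset_of_mem_open
    (show x.1 ∈ U ⊓ W from ⟨x.2, hxW⟩) (U ⊓ W).isOpen
  have hVU' : V ≤ U := fun y hy => (hVU hy).1
  have hVW : V ≤ W := fun y hy => (hVU hy).2
  refine ⟨V, hxV, ?_⟩
  set rV : Γ(X, V) := X.presheaf.map (homOfLE hVU').op r with hrV
  have hb : X.basicOpen rV ≤ X.basicOpen r := by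
    rw [hrV, Scheme.basicOpen_res]; exact inf_le_right
  suffices ∃ n : ℕ, ∀ y : V, toRational V y rV ^ n * (h * f) ∈ localRing y.1 by
    obtain ⟨n, hn⟩ := this
    refine ⟨n, fun m hm y hy => ?_⟩
    rw [isRegularAt_iff (hf y.1 (hVW hy))]
    have h1 := hn ⟨y.1, hy⟩
    rw [hrV, toRational_map] at h1
    obtain ⟨k, rfl⟩ := Nat.exists_eq_add_of_le hm
    have h2 := (localRing y.1).mul_mem ((localRing y.1).pow_mem (toRational_mem U y r) k) h1
    convert h2 using 1
    ring
  by_cases hne : Nonempty (X.basicOpen rV)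
  · obtain ⟨⟨z, hz⟩⟩ := hne
    obtain ⟨a, ha⟩ := exists_section (X.basicOpen rV) (h * f) (fun y =>
      (isRegularAt_iff (hf y.1 (hVW (X.basicOpen_le rV y.2)))).1 (hh y.1 (hb y.2)))
    have := hV.isLocalization_basicOpen rV
    obtain ⟨⟨b, ⟨_, n, rfl⟩⟩, e⟩ := IsLocalization.surj (Submonoid.powers rV) a
    refine ⟨n, fun y => ?_⟩
    have e' : toRational _ ⟨z, hz⟩ (a * algebraMap Γ(X, V) _ (rV ^ n)) =
        toRational _ ⟨z, hz⟩ (algebraMap Γ(X, V) _ b) := congrArg (toRational (X.basicOpen rV) ⟨z, hz⟩) e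
    rw [map_mul, ha] at e'
    have e1 : ∀ c : Γ(X, V), toRational (X.basicOpen rV) ⟨z, hz⟩ (algebraMap Γ(X, V) _ c) =
        toRational V y c := fun c =>
      (toRational_map (homOfLE (X.basicOpen_le rV)) ⟨z, hz⟩ c).trans (toRational_eq V _ y c)
    rw [e1, e1, map_pow] at e'
    rw [mul_comm, e']
    exact toRational_mem V y b
  · refine ⟨1, fun y => ?_⟩
    have : rV = 0 := by
      rw [← basicOpen_eq_bot_iff]
      refine le_bot_iff.1 fun z hz => (hne ⟨⟨z, hz⟩⟩).elim
    rw [this, map_zero, pow_one, zero_mul]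
    exact (localRing y.1).zero_mem

lemma exists_pow_isRegularAt (D : CartierDivisor X) {U : X.Opens} (hU : IsAffineOpen U)
    (r : Γ(X, U)) (h : X.functionField) (hh : ∀ y ∈ X.basicOpen r, IsRegularAt D y h) :
    ∃ n : ℕ, ∀ m, n ≤ m → ∀ y : U, IsRegularAt D y.1 (toRational U y r ^ m * h) := by
  choose V hxV n hn using exists_pow_isRegularAt_local D r h hh
  obtain ⟨t, ht⟩ := hU.isCompact.elim_finite_subcover (fun x : U => (V x : Set X))
    (fun x => (V x).isOpen) (fun x hx => Set.mem_iUnion.2 ⟨⟨x, hx⟩, hxV ⟨x, hx⟩⟩)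
  refine ⟨t.sup n, fun m hm y => ?_⟩
  obtain ⟨x, hx⟩ := Set.mem_iUnion.1 (ht y.2)
  obtain ⟨hxt, hy⟩ := Set.mem_iUnion.1 hx
  exact hn x m ((Finset.le_sup hxt).trans hm) y hy

lemma coxAlgebraMap_val (U : X.Opens) (a : Γ(X, U)) (y : U) :
    (coxAlgebraMap Λ U a).1 y = AddMonoidAlgebra.single (0 : Λ) (toRational U y a) := rfl

lemma exists_pow_mul_extends {U : X.Opens} (hU : IsAffineOpen U) (r : Γ(X, U))
    (F : CoxRing Λ (X.basicOpen r)) :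
    ∃ (N : ℕ) (G : CoxRing Λ U),
      F * coxRestrict Λ (X.basicOpen_le r) (coxAlgebraMap Λ U (r ^ N)) =
        coxRestrict Λ (X.basicOpen_le r) G := by
  obtain ⟨⟨F₀, hF₀⟩, hF⟩ := F.2
  have hreg : ∀ l : Λ, ∀ y ∈ X.basicOpen r, IsRegularAt l.1 y (F₀.coeff l) := fun l y hy => by
    rw [← hF₀ ⟨y, hy⟩]; exact hF ⟨y, hy⟩ l
  choose n hn using fun l : Λ => exists_pow_isRegularAt l.1 hU r _ (hreg l)
  let N := F₀.coeff.support.sup n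
  have hG : ∀ y : U, F₀ * AddMonoidAlgebra.single (0 : Λ) (toRational U y (r ^ N)) ∈
      coxStalk Λ y.1 := by
    intro y l
    rw [AddMonoidAlgebra.coeff_mul_single_zero, map_pow, mul_comm]
    by_cases hl : l ∈ F₀.coeff.support
    · exact hn l N (Finset.le_sup hl) y
    · rw [Finsupp.notMem_support_iff.1 hl, mul_zero]; exact .zero _ _
  refine ⟨N, ⟨fun y => F₀ * AddMonoidAlgebra.single (0 : Λ) (toRational U y (r ^ N)), ?_, hG⟩, ?_⟩
  · by_cases hne : Nonempty U
    · obtain ⟨z⟩ := hne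
      exact ⟨F₀ * AddMonoidAlgebra.single (0 : Λ) (toRational U z (r ^ N)), fun y =>
        congrArg (fun t => F₀ * AddMonoidAlgebra.single (0 : Λ) t) (toRational_eq U y z _)⟩
    · exact ⟨0, fun y => (hne ⟨y⟩).elim⟩
  · refine Subtype.ext (funext fun y => ?_)
    change F.1 y * AddMonoidAlgebra.single (0 : Λ) (toRational U ⟨y.1, X.basicOpen_le r y.2⟩ (r ^ N))
      = F₀ * AddMonoidAlgebra.single (0 : Λ) (toRational U ⟨y.1, X.basicOpen_le r y.2⟩ (r ^ N))
    rw [hF₀]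

lemma exists_pow_mul_eq {U : X.Opens} (r : Γ(X, U)) (F G : CoxRing Λ U)
    (h : coxRestrict Λ (X.basicOpen_le r) F = coxRestrict Λ (X.basicOpen_le r) G) :
    ∃ N : ℕ, coxAlgebraMap Λ U r ^ N * F = coxAlgebraMap Λ U r ^ N * G := by
  obtain ⟨⟨F₀, hF₀⟩, hF⟩ := F.2
  obtain ⟨⟨G₀, hG₀⟩, hG⟩ := G.2
  by_cases hne : Nonempty (X.basicOpen r)
  · obtain ⟨z⟩ := hne
    have h1 : F.1 ⟨z.1, X.basicOpen_le r z.2⟩ = G.1 ⟨z.1, X.basicOpen_le r z.2⟩ :=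
      congrFun (congrArg Subtype.val h) z
    rw [hF₀, hG₀] at h1
    have : F = G := Subtype.ext (funext fun y => by rw [hF₀, hG₀, h1])
    exact ⟨0, by rw [this]⟩
  · have h0 : r = 0 := by
      rw [← basicOpen_eq_bot_iff]
      exact le_bot_iff.1 fun z hz => (hne ⟨⟨z, hz⟩⟩).elim
    refine ⟨1, ?_⟩
    rw [h0, map_zero, pow_one, zero_mul, zero_mul]

lemma isUnit_coxRestrict {U : X.Opens} (r : Γ(X, U)) :
    IsUnit (coxRestrict Λ (X.basicOpen_le r) (coxAlgebraMap Λ U r)) := by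
  have := coxRestrict_algebraMap Λ (homOfLE (X.basicOpen_le r)) r
  rw [this]
  exact (X.toRingedSpace.isUnit_res_basicOpen r).map (coxAlgebraMap Λ (X.basicOpen r))

lemma isLocalization_coxRing {U : X.Opens} (hU : IsAffineOpen U) (r : Γ(X, U)) :
    letI := (coxRestrict Λ (X.basicOpen_le r)).toAlgebra
    IsLocalization.Away (coxAlgebraMap Λ U r) (CoxRing Λ (X.basicOpen r)) := by
  let := (coxRestrict Λ (X.basicOpen_le r)).toAlgebra
  have hmap : ∀ a, algebraMap (CoxRing Λ U) (CoxRing Λ (X.basicOpen r)) a =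
    coxRestrict Λ (X.basicOpen_le r) a := fun a => rfl
  refine ⟨?_, ?_, ?_⟩
  · rintro ⟨_, n, rfl⟩
    rw [hmap, map_pow]
    exact (isUnit_coxRestrict Λ r).pow n
  · intro F
    obtain ⟨N, G, h⟩ := exists_pow_mul_extends Λ hU r F
    refine ⟨⟨G, ⟨_, N, rfl⟩⟩, ?_⟩
    rw [map_pow] at h
    exact h
  · intro F G hFG
    obtain ⟨N, h⟩ := exists_pow_mul_eq Λ r F G hFG
    exact ⟨⟨_, N, rfl⟩, h⟩

lemma coequifibered_coxStructure :
    ((Scheme.AffineZariskiSite.toOpensFunctor X).op.whiskerLeft (coxStructure Λ)).Coequifibered :=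
  Scheme.AffineZariskiSite.coequifibered_iff_forall_isLocalizationAway.mpr fun U r =>
    isLocalization_coxRing Λ U.2 r

/-- The gluing data given by the affine schemes `Spec 𝒮̂_Λ(U)`, for `U` open affine in `X`. -/
def charSpaceGlueData := Scheme.AffineZariskiSite.relativeGluingData (coequifibered_coxStructure Λ)

instance : ((charSpaceGlueData Λ).functor ⋙ Scheme.forget).IsLocallyDirected :=
  Scheme.Cover.RelativeGluingData.instIsLocallyDirectedI₀CompFunctorForgetOfIsThin ..

/-- The characteristic space `Ŷ = Spec_X 𝒮̂_Λ`, the relative spectrum of the Cox sheaf. -/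
def charSpace : Scheme.{0} := (charSpaceGlueData Λ).glued

/-- The projection `π : Ŷ ⟶ X`. -/
def charProj : charSpace Λ ⟶ X := (charSpaceGlueData Λ).toBase

/-- The open immersion `Spec 𝒮̂_Λ(U) ⟶ Ŷ`. -/
def charChart (U : X.affineOpens) : Spec (.of (CoxRing Λ U.1)) ⟶ charSpace Λ :=
  (charSpaceGlueData Λ).cover.f U

instance (U : X.affineOpens) : IsOpenImmersion (charChart Λ U) :=
  (charSpaceGlueData Λ).cover.map_prop U

lemma charProj_preimage (U : X.affineOpens) :
    charProj Λ ⁻¹ᵁ U.1 = charChart Λ U ''ᵁ ⊤ := by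
  rw [Scheme.Hom.image_top_eq_opensRange]
  simpa using! (charSpaceGlueData Λ).toBase_preimage_eq_opensRange_ι U

/-- The function on `π⁻¹ U` defined by a section of the Cox sheaf over the affine open set `U`. -/
def coxFunction (U : X.affineOpens) : CoxRing Λ U.1 →+* Γ(charSpace Λ, charProj Λ ⁻¹ᵁ U.1) :=
  ((Scheme.ΓSpecIso (.of (CoxRing Λ U.1))).inv ≫ ((charChart Λ U).appIso ⊤).inv ≫
    (charSpace Λ).presheaf.map (eqToHom (charProj_preimage Λ U)).op).hom

/-- The Cox sheaf as a (pre)sheaf of `𝒪_X`-modules. -/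
def coxModule : X.PresheafOfModules :=
  letI (U : X.Opensᵒᵖ) : Module (X.ringCatSheaf.obj.obj U) ((coxPresheaf Λ ⋙ forget₂ CommRingCat RingCat ⋙ forget₂ RingCat Ab).obj U) :=
    inferInstanceAs (Module Γ(X, U.unop) (CoxRing Λ U.unop))
  PresheafOfModules.ofPresheaf (coxPresheaf Λ ⋙ forget₂ CommRingCat RingCat ⋙ forget₂ RingCat Ab) (by
    intro U V f r m
    change coxRestrict Λ f.unop.le (coxAlgebraMap Λ U.unop r * (show CoxRing Λ U.unop from m)) = coxAlgebraMap Λ V.unop (X.presheaf.map f r) * coxRestrict Λ f.unop.le (show CoxRing Λ U.unop from m)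
    rw [map_mul]
    congr 1
    exact coxRestrict_algebraMap Λ f.unop r)

end CoxSheaf

/-! ### The generalized Euler sequence -/

section Euler

variable {X S : Scheme.{0}} [IsIntegral X] (p : X ⟶ S) (Λ : AddSubgroup (CartierDivisor X))

/-- An affine covering `(U_i)` of `X` and, for each `i`, local equations `f_i^λ` over `U_i` of the
divisors `D_λ` in `Λ`, which depend multiplicatively on `λ`. -/
structure LocalEquations where
  Idx : Type
  opens : Idx → X.Opens
  isAffineOpen : ∀ i, IsAffineOpen (opens i)
  covers : ∀ x : X, ∃ i, x ∈ opens i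
  eqn : Idx → Multiplicative Λ →* X.functionFieldˣ
  eqn_spec : ∀ (i : Idx) (l : Λ), ∀ x ∈ opens i, l.1.1 x = principalAt x (eqn i (.ofAdd l))

variable {Λ} (T : LocalEquations Λ)

lemma transition_mem (i j : T.Idx) (l : Multiplicative Λ) {x : X} (hx : x ∈ T.opens i ⊓ T.opens j) :
    ((T.eqn j l / T.eqn i l : X.functionFieldˣ) : X.functionField) ∈ localRing x := by
  have h : principalAt x (T.eqn i l) = principalAt x (T.eqn j l) :=
    (T.eqn_spec i l.toAdd x hx.1).symm.trans (T.eqn_spec j l.toAdd x hx.2)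
  have := (stalkUnits_iff.1 ((principalAt_eq_iff x _ _).1 h)).1
  rwa [div_eq_inv_mul]

/-- `g_ij^λ = f_j^λ / f_i^λ` on `V ⊆ U_i ∩ U_j`. -/
def transition (i j : T.Idx) (V : X.Opens) (h : V ≤ T.opens i ⊓ T.opens j) :
    Multiplicative Λ →* Γ(X, V)ˣ :=
  have H (l : Multiplicative Λ) := exists_section V
    ((T.eqn j l / T.eqn i l : X.functionFieldˣ) : X.functionField)
    (fun x => transition_mem T i j l (h x.2))
  MonoidHom.toHomUnits
    { toFun l := (H l).choose
      map_one' := eq_of_toRational fun x => by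
        rw [(H 1).choose_spec, map_one, map_one, map_one, div_one, Units.val_one]
      map_mul' l m := eq_of_toRational fun x => by
        refine ((H (l * m)).choose_spec x).trans (Eq.trans ?_ (map_mul (toRational V x) _ _).symm)
        rw [(H l).choose_spec, (H m).choose_spec, map_mul, map_mul, mul_div_mul_comm,
          Units.val_mul] }

lemma toRational_transition (i j : T.Idx) (V : X.Opens) (h : V ≤ T.opens i ⊓ T.opens j)
    (l : Multiplicative Λ) (x : V) :
    toRational V x (transition T i j V h l) =
      ((T.eqn j l / T.eqn i l : X.functionFieldˣ) : X.functionField) :=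
  (exists_section V ((T.eqn j l / T.eqn i l : X.functionFieldˣ) : X.functionField)
    (fun x => transition_mem T i j l (h x.2))).choose_spec x

lemma transition_map (i j : T.Idx) {U V : X.Opens} (h : U ≤ T.opens i ⊓ T.opens j) (e : V ⟶ U)
    (l : Multiplicative Λ) :
    Units.map (X.presheaf.map e.op).hom.toMonoidHom (transition T i j U h l) =
      transition T i j V (e.le.trans h) l := by
  refine Units.ext (eq_of_toRational fun x => ?_)
  refine (toRational_map e x _).trans ?_
  rw [toRational_transition, toRational_transition]

lemma transition_mul (i j k : T.Idx) (V : X.Opens) (hij : V ≤ T.opens i ⊓ T.opens j)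
    (hjk : V ≤ T.opens j ⊓ T.opens k) (hik : V ≤ T.opens i ⊓ T.opens k) (l : Multiplicative Λ) :
    transition T i j V hij l * transition T j k V hjk l = transition T i k V hik l := by
  refine Units.ext (eq_of_toRational fun x => ?_)
  rw [Units.val_mul, map_mul, toRational_transition, toRational_transition, toRational_transition,
    ← Units.val_mul, mul_comm, div_mul_div_cancel]

/-- `d log u = du / u`. -/
def dlog (V : X.Opens) (u : Γ(X, V)ˣ) : Γ(differentials p, V) :=
  ((u⁻¹ : Γ(X, V)ˣ) : Γ(X, V)) • d p V (u : Γ(X, V))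

lemma dlog_mul (V : X.Opens) (u v : Γ(X, V)ˣ) : dlog p V (u * v) = dlog p V u + dlog p V v := by
  unfold dlog
  rw [Units.val_mul, d_mul, smul_add, smul_smul, smul_smul, mul_inv, Units.val_mul, add_comm]
  congr 2
  · rw [mul_assoc, Units.inv_mul, mul_one]
  · rw [mul_comm, ← mul_assoc, Units.mul_inv, one_mul]

lemma dlog_map {U V : X.Opens} (e : V ⟶ U) (u : Γ(X, U)ˣ) :
    (differentials p).presheaf.map e.op (dlog p U u) =
      dlog p V (Units.map (X.presheaf.map e.op).hom.toMonoidHom u) := by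
  unfold dlog
  rw [Scheme.Modules.map_smul, ← d_map]
  rfl

/-- `ψ_ij : Λ → Ω_X(V)`, `λ ↦ d log g_ij^λ`. -/
def chern (i j : T.Idx) (V : X.Opens) (h : V ≤ T.opens i ⊓ T.opens j) :
    Λ →+ Γ(differentials p, V) :=
  AddMonoidHom.mk' (fun l => dlog p V (transition T i j V h (.ofAdd l))) (fun l m => by
    rw [ofAdd_add, map_mul, dlog_mul])

lemma chern_map (i j : T.Idx) {U V : X.Opens} (h : U ≤ T.opens i ⊓ T.opens j) (e : V ⟶ U) (l : Λ) :
    (differentials p).presheaf.map e.op (chern p T i j U h l) =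
      chern p T i j V (e.le.trans h) l := by
  refine (dlog_map p e _).trans ?_
  rw [transition_map]
  rfl

lemma chern_add (i j k : T.Idx) (V : X.Opens) (hij : V ≤ T.opens i ⊓ T.opens j)
    (hjk : V ≤ T.opens j ⊓ T.opens k) (hik : V ≤ T.opens i ⊓ T.opens k) (l : Λ) :
    chern p T i j V hij l + chern p T j k V hjk l = chern p T i k V hik l := by
  refine (dlog_mul p V _ _).symm.trans ?_
  rw [transition_mul T i j k V hij hjk hik]
  rfl

/-- The `𝒪_X(V)`-linear extension of `ψ_ij`. -/
def chernLin (i j : T.Idx) (V : X.Opens) (h : V ≤ T.opens i ⊓ T.opens j) :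
    Γ(X, V) ⊗[ℤ] Λ →ₗ[Γ(X, V)] Γ(differentials p, V) :=
  (chern p T i j V h).toIntLinearMap.liftBaseChange Γ(X, V)

variable (Λ) in
/-- Restriction of sections of `𝒪_X ⊗ Λ`. -/
def latticeRestrict {U V : X.Opens} (e : V ⟶ U) : Γ(X, U) ⊗[ℤ] Λ →+ Γ(X, V) ⊗[ℤ] Λ :=
  (LinearMap.rTensor Λ (X.presheaf.map e.op).hom.toAddMonoidHom.toIntLinearMap).toAddMonoidHom

@[simp] lemma latticeRestrict_tmul {U V : X.Opens} (e : V ⟶ U) (a : Γ(X, U)) (l : Λ) :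
    latticeRestrict Λ e (a ⊗ₜ[ℤ] l) = (X.presheaf.map e.op a : Γ(X, V)) ⊗ₜ[ℤ] l := rfl

lemma latticeRestrict_smul {U V : X.Opens} (e : V ⟶ U) (a : Γ(X, U)) (m : Γ(X, U) ⊗[ℤ] Λ) :
    latticeRestrict Λ e (a • m) = (X.presheaf.map e.op a : Γ(X, V)) • latticeRestrict Λ e m := by
  induction m with
  | zero => simp
  | add m n hm hn => rw [smul_add, map_add, hm, hn, map_add, smul_add]
  | tmul b l =>
    rw [TensorProduct.smul_tmul', latticeRestrict_tmul, latticeRestrict_tmul,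
      TensorProduct.smul_tmul', smul_eq_mul, smul_eq_mul, map_mul]

lemma latticeRestrict_id (U : X.Opens) (m : Γ(X, U) ⊗[ℤ] Λ) :
    latticeRestrict Λ (𝟙 U) m = m := by
  induction m with
  | zero => simp
  | add m n hm hn => rw [map_add, hm, hn]
  | tmul b l =>
    rw [latticeRestrict_tmul]
    exact congrArg (· ⊗ₜ[ℤ] l) congr($(X.presheaf.map_id (op U)) b)

lemma latticeRestrict_comp {U V W : X.Opens} (e : V ⟶ U) (e' : W ⟶ V) (m : Γ(X, U) ⊗[ℤ] Λ) :
    latticeRestrict Λ (e' ≫ e) m = latticeRestrict Λ e' (latticeRestrict Λ e m) := by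
  induction m with
  | zero => simp
  | add m n hm hn => rw [map_add, hm, hn, map_add, map_add]
  | tmul b l =>
    rw [latticeRestrict_tmul, latticeRestrict_tmul, latticeRestrict_tmul]
    exact congrArg (· ⊗ₜ[ℤ] l) congr($(X.presheaf.map_comp e.op e'.op) b)

lemma chernLin_map (i j : T.Idx) {U V : X.Opens} (h : U ≤ T.opens i ⊓ T.opens j) (e : V ⟶ U)
    (m : Γ(X, U) ⊗[ℤ] Λ) :
    (differentials p).presheaf.map e.op (chernLin p T i j U h m) =
      chernLin p T i j V (e.le.trans h) (latticeRestrict Λ e m) := by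
  induction m with
  | zero => simp
  | add m n hm hn => rw [map_add, map_add, hm, hn, map_add, map_add]
  | tmul b l =>
    rw [latticeRestrict_tmul, chernLin, chernLin, LinearMap.liftBaseChange_tmul,
      LinearMap.liftBaseChange_tmul, Scheme.Modules.map_smul]
    exact congrArg _ (chern_map p T i j h e l)

lemma chernLin_add (i j k : T.Idx) (V : X.Opens) (hij : V ≤ T.opens i ⊓ T.opens j)
    (hjk : V ≤ T.opens j ⊓ T.opens k) (hik : V ≤ T.opens i ⊓ T.opens k) (m : Γ(X, V) ⊗[ℤ] Λ) :
    chernLin p T i j V hij m + chernLin p T j k V hjk m = chernLin p T i k V hik m := by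
  induction m with
  | zero => simp
  | add m n hm hn => rw [map_add, map_add, map_add, ← hm, ← hn, add_add_add_comm]
  | tmul b l =>
    rw [chernLin, chernLin, chernLin, LinearMap.liftBaseChange_tmul,
      LinearMap.liftBaseChange_tmul, LinearMap.liftBaseChange_tmul, ← smul_add]
    exact congrArg _ (chern_add p T i j k V hij hjk hik l)

variable (Λ) in
/-- The presheaf of abelian groups underlying `Λ ⊗ 𝒪_X`. -/
def latticeAb : X.Opensᵒᵖ ⥤ Ab where
  obj U := .of (Γ(X, U.unop) ⊗[ℤ] Λ)
  map e := AddCommGrpCat.ofHom (latticeRestrict Λ e.unop)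
  map_id U := by ext m; exact latticeRestrict_id _ m
  map_comp e e' := by ext m; exact latticeRestrict_comp _ _ m

instance (U : X.Opensᵒᵖ) : Module (X.ringCatSheaf.obj.obj U) ((latticeAb Λ).obj U) :=
  inferInstanceAs (Module Γ(X, U.unop) (Γ(X, U.unop) ⊗[ℤ] Λ))

variable (Λ) in
/-- The presheaf of modules `U ↦ 𝒪_X(U) ⊗ Λ`. -/
def preLattice : X.PresheafOfModules :=
  PresheafOfModules.ofPresheaf (latticeAb Λ) fun _ _ e a m => latticeRestrict_smul e.unop a m

variable (Λ) in
/-- `Λ_X = Λ ⊗ 𝒪_X`. -/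
def latticeSheaf : X.Modules := sheafify (preLattice Λ)

/-- `Ω_X(U ∩ W)` as a module over `𝒪_X(U)`. -/
def FormsOn (W U : X.Opens) : Type := Γ(differentials p, U ⊓ W)

instance (W U : X.Opens) : AddCommGroup (FormsOn p W U) :=
  inferInstanceAs (AddCommGroup Γ(differentials p, U ⊓ W))

instance (W U : X.Opens) : Module Γ(X, U) (FormsOn p W U) :=
  letI : Module Γ(X, U ⊓ W) (FormsOn p W U) :=
    inferInstanceAs (Module Γ(X, U ⊓ W) Γ(differentials p, U ⊓ W))
  Module.compHom (FormsOn p W U) (X.presheaf.map (homOfLE (inf_le_left : U ⊓ W ≤ U)).op).hom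

lemma FormsOn.smul_def (W U : X.Opens) (a : Γ(X, U)) (w : FormsOn p W U) :
    a • w = (show FormsOn p W U from
      X.presheaf.map (homOfLE (inf_le_left : U ⊓ W ≤ U)).op a • (show Γ(differentials p, U ⊓ W) from w)) := rfl

/-- Restriction of a form on `U ∩ W` to an open subset. -/
def FormsOn.res {W U : X.Opens} (V : X.Opens) (e : V ≤ U ⊓ W) :
    FormsOn p W U →+ Γ(differentials p, V) :=
  ((differentials p).presheaf.map (homOfLE e).op).hom

lemma FormsOn.res_smul {W U : X.Opens} (V : X.Opens) (e : V ≤ U ⊓ W) (a : Γ(X, U))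
    (w : FormsOn p W U) :
    FormsOn.res p V e (a • w) =
      (X.presheaf.map (homOfLE (e.trans inf_le_left)).op a : Γ(X, V)) • FormsOn.res p V e w := by
  refine (Scheme.Modules.map_smul (differentials p) (homOfLE e) _ _).trans ?_
  refine congrArg (· • FormsOn.res p V e w) ?_
  exact congr($((X.presheaf.map_comp (homOfLE (inf_le_left : U ⊓ W ≤ U)).op (homOfLE e).op).symm) a)

lemma presheaf_map_map (M : X.Modules) {U V W : X.Opens} (h : V ≤ U) (h' : W ≤ V) (m : Γ(M, U)) :
    M.presheaf.map (homOfLE h').op (M.presheaf.map (homOfLE h).op m) =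
      M.presheaf.map (homOfLE (h'.trans h)).op m :=
  congr($((M.presheaf.map_comp (homOfLE h).op (homOfLE h').op).symm) m)

/-- Sections over `U` of the extension `ℛ_Λ` of `Λ_X` by `Ω_X` with class `c₁`: a section `m` of
`𝒪_X ⊗ Λ` over `U` with forms `ω_i` over `U ∩ U_i` such that `ω_j = ω_i + ψ_ij(m)` on
`U ∩ U_i ∩ U_j`. -/
def eulerSections (U : X.Opens) :
    Submodule Γ(X, U) ((Γ(X, U) ⊗[ℤ] Λ) × ∀ i : T.Idx, FormsOn p (T.opens i) U) where
  carrier := {s | ∀ i j : T.Idx,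
    FormsOn.res p (U ⊓ (T.opens i ⊓ T.opens j)) (inf_le_inf_left U inf_le_right) (s.2 j) =
      FormsOn.res p (U ⊓ (T.opens i ⊓ T.opens j)) (inf_le_inf_left U inf_le_left) (s.2 i) +
        chernLin p T i j (U ⊓ (T.opens i ⊓ T.opens j)) inf_le_right
          (latticeRestrict Λ (homOfLE inf_le_left) s.1)}
  zero_mem' i j := by
    simp only [Prod.snd_zero, Prod.fst_zero, Pi.zero_apply, map_zero, add_zero]
  add_mem' {s t} hs ht i j := by
    simp only [Prod.snd_add, Prod.fst_add, Pi.add_apply, map_add]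
    rw [hs i j, ht i j, add_add_add_comm]
  smul_mem' a s hs i j := by
    simp only [Prod.smul_snd, Prod.smul_fst, Pi.smul_apply]
    rw [FormsOn.res_smul, FormsOn.res_smul, hs i j, smul_add, latticeRestrict_smul, map_smul]

lemma FormsOn.map_res {W U : X.Opens} {V V' : X.Opens} (e : V ≤ U ⊓ W) (h : V' ≤ V)
    (w : FormsOn p W U) :
    (differentials p).presheaf.map (homOfLE h).op (FormsOn.res p V e w) =
      FormsOn.res p V' (h.trans e) w :=
  presheaf_map_map (differentials p) e h w

lemma FormsOn.res_res {W W' U U' : X.Opens} {V : X.Opens} (e : U' ⊓ W' ≤ U ⊓ W) (h : V ≤ U' ⊓ W')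
    (w : FormsOn p W U) :
    FormsOn.res (U := U') (W := W') p V h (FormsOn.res p (U' ⊓ W') e w) =
      FormsOn.res p V (h.trans e) w :=
  presheaf_map_map (differentials p) e h w

lemma eulerRestrict_mem {U V : X.Opens} (e : V ⟶ U)
    (s : (Γ(X, U) ⊗[ℤ] Λ) × ∀ i : T.Idx, FormsOn p (T.opens i) U) (hs : s ∈ eulerSections p T U) :
    ((latticeRestrict Λ e s.1, fun i => FormsOn.res p (V ⊓ T.opens i)
      (inf_le_inf_right _ e.le) (s.2 i)) :
      (Γ(X, V) ⊗[ℤ] Λ) × ∀ i : T.Idx, FormsOn p (T.opens i) V) ∈ eulerSections p T V := by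
  intro i j
  refine (FormsOn.res_res p _ _ _).trans (Eq.trans ?_
    (congrArg₂ (· + ·) (FormsOn.res_res p _ _ _).symm rfl))
  have key := congrArg ((differentials p).presheaf.map
    (homOfLE (inf_le_inf_right (T.opens i ⊓ T.opens j) e.le)).op) (hs i j)
  rw [map_add, chernLin_map, ← latticeRestrict_comp, FormsOn.map_res, FormsOn.map_res] at key
  refine key.trans (congrArg₂ (· + ·) rfl ?_)
  rw [← latticeRestrict_comp]
  rfl

/-- Restriction of sections of `ℛ_Λ`. -/
def eulerRestrict {U V : X.Opens} (e : V ⟶ U) : eulerSections p T U →+ eulerSections p T V where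
  toFun s := ⟨_, eulerRestrict_mem p T e s.1 s.2⟩
  map_zero' := Subtype.ext (Prod.ext (map_zero (latticeRestrict Λ e))
    (funext fun i => map_zero (FormsOn.res p _ _)))
  map_add' s t := Subtype.ext (Prod.ext (map_add (latticeRestrict Λ e) _ _)
    (funext fun i => map_add (FormsOn.res p _ _) _ _))

lemma presheaf_map_id (M : X.Modules) {U : X.Opens} (h : U ≤ U) (m : Γ(M, U)) :
    M.presheaf.map (homOfLE h).op m = m :=
  congr($(M.presheaf.map_id (op U)) m)

/-- The presheaf of abelian groups underlying `ℛ_Λ`. -/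
def eulerAb : X.Opensᵒᵖ ⥤ Ab where
  obj U := .of (eulerSections p T U.unop)
  map e := AddCommGrpCat.ofHom (eulerRestrict p T e.unop)
  map_id U := by
    refine AddCommGrpCat.hom_ext (AddMonoidHom.ext fun s => ?_)
    refine Subtype.ext (Prod.ext (latticeRestrict_id _ _) (funext fun i => ?_))
    exact presheaf_map_id (differentials p) _ (s.1.2 i)
  map_comp e e' := by
    refine AddCommGrpCat.hom_ext (AddMonoidHom.ext fun s => ?_)
    refine Subtype.ext (Prod.ext (latticeRestrict_comp _ _ _) (funext fun i => ?_))
    exact (presheaf_map_map (differentials p) (inf_le_inf_right _ e.unop.le)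
      (inf_le_inf_right _ e'.unop.le) (s.1.2 i)).symm

instance (U : X.Opensᵒᵖ) : Module (X.ringCatSheaf.obj.obj U) ((eulerAb p T).obj U) :=
  inferInstanceAs (Module Γ(X, U.unop) (eulerSections p T U.unop))

lemma eulerRestrict_smul {U V : X.Opens} (e : V ⟶ U) (a : Γ(X, U)) (s : eulerSections p T U) :
    eulerRestrict p T e (a • s) = (X.presheaf.map e.op a : Γ(X, V)) • eulerRestrict p T e s := by
  refine Subtype.ext (Prod.ext (latticeRestrict_smul e a _) (funext fun i => ?_))
  refine (FormsOn.res_smul p (V ⊓ T.opens i) (inf_le_inf_right _ e.le) a _).trans ?_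
  refine congrArg (· • FormsOn.res p (V ⊓ T.opens i) (inf_le_inf_right _ e.le) (s.1.2 i)) ?_
  exact congr($(X.presheaf.map_comp e.op (homOfLE (inf_le_left : V ⊓ T.opens i ≤ V)).op) a)

/-- The presheaf of modules of sections of `ℛ_Λ`. -/
def preEuler : X.PresheafOfModules :=
  PresheafOfModules.ofPresheaf (eulerAb p T) fun _ _ e a s => eulerRestrict_smul p T e.unop a s

/-- The middle term `ℛ_Λ` of the generalized Euler sequence. -/
def eulerSheaf : X.Modules := sheafify (preEuler p T)

/-- `Ω_X ⟶ ℛ_Λ`, `ω ↦ (ω, 0)`, at the level of presheaves. -/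
def preEulerFst : (differentials p).val ⟶ preEuler p T :=
  PresheafOfModules.homMk
    { app U := AddCommGrpCat.ofHom (Y := (preEuler p T).presheaf.obj U) (show Γ(differentials p, U.unop) →+ eulerSections p T U.unop from
        { toFun w := ⟨(0, fun i => (differentials p).presheaf.map (homOfLE (inf_le_left : U.unop ⊓ T.opens i ≤ U.unop)).op w), fun i j => by
            simp only [map_zero, add_zero]
            exact (presheaf_map_map _ _ _ _).trans (presheaf_map_map _ _ _ _).symm⟩
          map_zero' := Subtype.ext (Prod.ext rfl (funext fun i => map_zero ((differentials p).presheaf.map _).hom))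
          map_add' a b := Subtype.ext (Prod.ext (add_zero _).symm (funext fun i => map_add ((differentials p).presheaf.map _).hom _ _)) })
      naturality U V e := by
        ext w
        refine Subtype.ext (Prod.ext (map_zero _).symm (funext fun i => ?_))
        exact (presheaf_map_map (differentials p) e.unop.le inf_le_left w).trans
          (presheaf_map_map (differentials p) inf_le_left (inf_le_inf_right _ e.unop.le) w).symm }
    (fun U a w => Subtype.ext (Prod.ext (smul_zero _).symm (funext fun i =>
      Scheme.Modules.map_smul (differentials p) _ _ _)))

/-- `ℛ_Λ ⟶ Λ_X`, `(ω, m) ↦ m`, at the level of presheaves. -/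
def preEulerSnd : preEuler p T ⟶ preLattice Λ :=
  PresheafOfModules.homMk
    { app U := AddCommGrpCat.ofHom (X := (preEuler p T).presheaf.obj U) (Y := (preLattice Λ).presheaf.obj U) (show eulerSections p T U.unop →+ Γ(X, U.unop) ⊗[ℤ] Λ from
        (AddMonoidHom.fst _ _).comp (eulerSections p T U.unop).toAddSubgroup.subtype)
      naturality _ _ _ := rfl }
    (fun _ _ _ => rfl)

/-- The map `Ω_X ⟶ ℛ_Λ` of the generalized Euler sequence. -/
def eulerFst : differentials p ⟶ eulerSheaf p T :=
  ⟨preEulerFst p T ≫ (PresheafOfModules.sheafificationAdjunction (𝟙 X.ringCatSheaf.obj)).unit.app (preEuler p T)⟩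

/-- The map `ℛ_Λ ⟶ Λ_X` of the generalized Euler sequence. -/
def eulerSnd : eulerSheaf p T ⟶ latticeSheaf Λ := sheafifyMap (preEulerSnd p T)

end Euler

/-! ### Tensor product with the Cox sheaf -/

section Tensor

variable {X : Scheme.{0}} [IsIntegral X] (Λ : AddSubgroup (CartierDivisor X))

/-- The presheaf `U ↦ M(U) ⊗ 𝒮̂_Λ(U)`. -/
def preTensorCox (M : X.Modules) : X.PresheafOfModules :=
  PresheafOfModules.Monoidal.tensorObj (R := X.presheaf) M.val (coxModule Λ)

/-- The sheaf of `𝒪_X`-modules `M ⊗ 𝒮̂_Λ`. -/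
def tensorCox (M : X.Modules) : X.Modules := sheafify (preTensorCox Λ M)

/-- `φ ⊗ id : M ⊗ 𝒮̂_Λ ⟶ N ⊗ 𝒮̂_Λ`. -/
def tensorCoxMap {M N : X.Modules} (φ : M ⟶ N) : tensorCox Λ M ⟶ tensorCox Λ N :=
  sheafifyMap (PresheafOfModules.Monoidal.tensorHom (R := X.presheaf) φ.val (𝟙 (coxModule Λ)))

/-- The section `m ⊗ s` of `M ⊗ 𝒮̂_Λ`. -/
def tmulCox (M : X.Modules) (U : X.Opens) (m : Γ(M, U)) (s : CoxRing Λ U) : Γ(tensorCox Λ M, U) :=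
  toSheafify (preTensorCox Λ M) U
    (show (preTensorCox Λ M).obj (op U) from
      TensorProduct.tmul Γ(X, U) (M := Γ(M, U)) (N := CoxRing Λ U) m s)

lemma tensorCoxMap_tmul {M N : X.Modules} (φ : M ⟶ N) (U : X.Opens) (m : Γ(M, U))
    (s : CoxRing Λ U) :
    (tensorCoxMap Λ φ).app U (tmulCox Λ M U m s) = tmulCox Λ N U (φ.app U m) s :=
  sheafifyMap_app _ U _

lemma tmulCox_smul (M : X.Modules) (U : X.Opens) (a : Γ(X, U)) (m : Γ(M, U)) (s : CoxRing Λ U) :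
    tmulCox Λ M U (a • m) s = tmulCox Λ M U m (a • s) :=
  congrArg (toSheafify (preTensorCox Λ M) U)
    (TensorProduct.smul_tmul (R := Γ(X, U)) (M := Γ(M, U)) (N := CoxRing Λ U) a m s)

/-- The group `𝒪_X(D_λ)(U)` of homogeneous sections of degree `λ` of the Cox sheaf. -/
def coxDegree (l : Λ) (U : X.Opens) : AddSubgroup (CoxRing Λ U) where
  carrier := {F | ∀ x : U, ∀ m : Λ, m ≠ l → (F.1 x).coeff m = 0}
  zero_mem' _ _ _ := rfl
  add_mem' {F G} hF hG x m hm := by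
    change (F.1 x + G.1 x).coeff m = 0
    rw [AddMonoidAlgebra.coeff_add, Finsupp.add_apply, hF x m hm, hG x m hm, add_zero]
  neg_mem' {F} hF x m hm := by
    change (-F.1 x).coeff m = 0
    rw [AddMonoidAlgebra.coeff_neg, Finsupp.neg_apply, hF x m hm, neg_zero]

/-- A section `h` of `𝒪_X(D_λ)` over `U`, regarded as a section of the Cox sheaf. -/
def coxMonomial (l : Λ) (U : X.Opens) (h : X.functionField)
    (hh : ∀ x : U, IsRegularAt l.1 x.1 h) : CoxRing Λ U :=
  ⟨fun _ => AddMonoidAlgebra.single l h, ⟨_, fun _ => rfl⟩, fun x m => by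
    classical
    rw [AddMonoidAlgebra.coeff_single, Finsupp.single_apply]
    split_ifs with e
    · subst e; exact hh x
    · exact .zero _ _⟩

lemma coxMonomial_mem (l : Λ) (U : X.Opens) (h : X.functionField)
    (hh : ∀ x : U, IsRegularAt l.1 x.1 h) : coxMonomial Λ l U h hh ∈ coxDegree Λ l U := by
  classical
  intro x m hm
  change (AddMonoidAlgebra.single l h).coeff m = 0
  rw [AddMonoidAlgebra.coeff_single, Finsupp.single_apply, if_neg hm.symm]

variable {Λ} (T : LocalEquations Λ) {S : Scheme.{0}} (p : X ⟶ S)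

lemma generator_regular (i : T.Idx) (l : Λ) {x : X} (hx : x ∈ T.opens i) :
    IsRegularAt l.1 x (((T.eqn i (.ofAdd l))⁻¹ : X.functionFieldˣ) : X.functionField) := by
  rw [isRegularAt_iff (T.eqn_spec i l x hx), Units.inv_mul]
  exact (localRing x).one_mem

/-- The generator `(f_i^λ)⁻¹` of `𝒪_X(D_λ)` over an open subset of `U_i`. -/
def generator (i : T.Idx) (l : Λ) (V : X.Opens) (hV : V ≤ T.opens i) : CoxRing Λ V :=
  coxMonomial Λ l V (((T.eqn i (.ofAdd l))⁻¹ : X.functionFieldˣ) : X.functionField)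
    fun x => generator_regular T i l (hV x.2)

/-- For `V ⊆ U_i`, the section of `ℛ_Λ` over `V` whose component over `V = V ∩ U_i` is the pair
`(ω, m)`; over `V ∩ U_j` it is given by `(ω + ψ_ij(m), m)`. -/
def frameSection (i : T.Idx) (V : X.Opens) (hV : V ≤ T.opens i) (w : Γ(differentials p, V))
    (m : Γ(X, V) ⊗[ℤ] Λ) : eulerSections p T V :=
  ⟨(m, fun j => show Γ(differentials p, V ⊓ T.opens j) from
      (differentials p).presheaf.map (homOfLE (inf_le_left : V ⊓ T.opens j ≤ V)).op w +
        chernLin p T i j (V ⊓ T.opens j) (inf_le_inf_right _ hV)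
          (latticeRestrict Λ (homOfLE inf_le_left) m)), fun j k => by
    have key (j' : T.Idx) (h : V ⊓ (T.opens j ⊓ T.opens k) ≤ V ⊓ T.opens j') :
        (differentials p).presheaf.map (homOfLE h).op
          ((differentials p).presheaf.map (homOfLE (inf_le_left : V ⊓ T.opens j' ≤ V)).op w +
          chernLin p T i j' (V ⊓ T.opens j') (inf_le_inf_right _ hV)
            (latticeRestrict Λ (homOfLE inf_le_left) m)) =
        (differentials p).presheaf.map (homOfLE (inf_le_left :
            V ⊓ (T.opens j ⊓ T.opens k) ≤ V)).op w +
          chernLin p T i j' (V ⊓ (T.opens j ⊓ T.opens k)) (h.trans (inf_le_inf_right _ hV))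
            (latticeRestrict Λ (homOfLE inf_le_left) m) := by
      rw [map_add, presheaf_map_map, chernLin_map, ← latticeRestrict_comp]
      rfl
    refine (key k (inf_le_inf_left V inf_le_right)).trans ?_
    refine Eq.trans ?_ (congrArg₂ (· + ·) (key j (inf_le_inf_left V inf_le_left)).symm rfl)
    rw [add_assoc]
    refine congrArg₂ (· + ·) rfl ?_
    exact (chernLin_add p T i j k _ _ _ _ _).symm⟩

/-- The local expression `(ds_i, s_i ⊗ D_λ)` of the differential `ds`, as a section of `ℛ_Λ` over
an open subset of `U_i`. -/
def eulerDifferential (i : T.Idx) (l : Λ) (V : X.Opens) (hV : V ≤ T.opens i) (s : Γ(X, V)) :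
    Γ(eulerSheaf p T, V) :=
  toSheafify (preEuler p T) V (frameSection T p i V hV (d p V s) (s ⊗ₜ[ℤ] l))

end Tensor

/-! ### Gradings -/

section Gradings

variable {X : Scheme.{0}}

/-- Sections over `U` of the subsheaf of abelian groups of `M` generated by given sections. -/
def sheafSpan (M : X.Modules) (G : ∀ V : X.Opens, Set Γ(M, V)) (U : X.Opens) :
    AddSubgroup Γ(M, U) :=
  ⨅ x : U, (AddSubgroup.closure {g | ∃ (V : X.Opens) (hx : x.1 ∈ V), ∃ m ∈ G V,
    (M.presheaf.germ V x.1 hx).hom m = g}).comap (M.presheaf.germ U x.1 x.2).hom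

/-- A family of generating sets of sections of `M`, indexed by `Λ`, defines a `Λ`-grading of `M`
if `M` is the direct sum of the subsheaves generated by the members of the family. -/
def IsGrading {Λ : Type} (M : X.Modules) (G : Λ → ∀ V : X.Opens, Set Γ(M, V)) : Prop :=
  open Classical in ∀ U : X.Opens, DirectSum.IsInternal fun l : Λ => sheafSpan M (G l) U

/-- A morphism preserves the degree. -/
def IsGraded {Λ : Type} {M N : X.Modules} (φ : M ⟶ N) (G : Λ → ∀ V : X.Opens, Set Γ(M, V))
    (H : Λ → ∀ V : X.Opens, Set Γ(N, V)) : Prop :=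
  ∀ (l : Λ) (U : X.Opens), ∀ m ∈ sheafSpan M (G l) U, φ.app U m ∈ sheafSpan N (H l) U

variable [IsIntegral X] (Λ : AddSubgroup (CartierDivisor X))

/-- The sections `m ⊗ s` of `M ⊗ 𝒮̂_Λ` with `s` of degree `λ`. -/
def tensorDegree (M : X.Modules) (l : Λ) (V : X.Opens) : Set Γ(tensorCox Λ M, V) :=
  {w | ∃ m : Γ(M, V), ∃ s ∈ coxDegree Λ l V, tmulCox Λ M V m s = w}

/-- The sections `t · π^*m` of `π_* π^* M`, over affine open sets, with `t` of degree `λ`. -/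
def pullbackDegree (M : X.Modules) (l : Λ) (V : X.Opens) :
    Set Γ((Scheme.Modules.pushforward (charProj Λ)).obj
      ((Scheme.Modules.pullback (charProj Λ)).obj M), V) :=
  {w | ∃ (hV : IsAffineOpen V) (m : Γ(M, V)), ∃ t ∈ coxDegree Λ l V,
    coxFunction Λ ⟨V, hV⟩ t • (show Γ((Scheme.Modules.pullback (charProj Λ)).obj M,
      charProj Λ ⁻¹ᵁ V) from
        ((Scheme.Modules.pullbackPushforwardAdjunction (charProj Λ)).unit.app M).app V m) = w}

/-- The sections `t · ds` of `π_* Ω_{Ŷ/S}`, over affine open sets, with `t` and `s` homogeneous of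
total degree `λ`. -/
def differentialDegree {S : Scheme.{0}} (q : charSpace Λ ⟶ S) (l : Λ) (V : X.Opens) :
    Set Γ((Scheme.Modules.pushforward (charProj Λ)).obj (differentials q), V) :=
  {w | ∃ (hV : IsAffineOpen V) (a b : Λ), a + b = l ∧ ∃ t ∈ coxDegree Λ a V,
    ∃ s ∈ coxDegree Λ b V, coxFunction Λ ⟨V, hV⟩ t •
      d q (charProj Λ ⁻¹ᵁ V) (coxFunction Λ ⟨V, hV⟩ s) = w}

end Gradings

/-! ### The assumptions and the two sequences -/

section Main

variable {X : Scheme.{0}} [IsIntegral X]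

/-- A Cartier divisor `D` on a quasi-compact scheme is ample if every point lies in an affine open
set which is the non-vanishing locus of a section of `𝒪_X(nD)` for some `n ≥ 1`. -/
def IsAmple (D : CartierDivisor X) : Prop :=
  ∀ x : X, ∃ n : ℕ, 1 ≤ n ∧ ∃ h : X.functionFieldˣ, (∀ y : X, IsRegularAt (n • D) y h) ∧
    ∃ U : X.Opens, x ∈ U ∧ IsAffineOpen U ∧ ∀ y : X, y ∈ U ↔ (n • D).1 y + principalAt y h = 0

/-- The Cox ring `𝒮_Λ`, the ring of global sections of the Cox sheaf, is a finitely generated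
`ℂ`-algebra. -/
def CoxRingFinitelyGenerated (p : X ⟶ Spec (.of ℂ)) (Λ : AddSubgroup (CartierDivisor X)) : Prop :=
  ((coxAlgebraMap Λ ⊤).comp
    ((Scheme.ΓSpecIso (.of ℂ)).inv ≫ p.appTop).hom).FiniteType

variable {S : Scheme.{0}} (p : X ⟶ S) {Λ : AddSubgroup (CartierDivisor X)} (T : LocalEquations Λ)

/-- The map `c₁ : Λ → H¹(X, Ω_X)` is injective: if the cocycle `(d log g_ij^λ)` of the affine
covering is a coboundary, then `λ = 0`. -/
def ChernInjective : Prop :=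
  ∀ l : Λ, (∃ η : ∀ i : T.Idx, Γ(differentials p, T.opens i), ∀ i j : T.Idx,
    chern p T i j (T.opens i ⊓ T.opens j) le_rfl l =
      (differentials p).presheaf.map (homOfLE inf_le_right).op (η j) -
        (differentials p).presheaf.map (homOfLE inf_le_left).op (η i)) → l = 0

/-- `π_* π^* Ω_X ⟶ π_* Ω_Ŷ`. -/
def cotangentRowFst (Λ : AddSubgroup (CartierDivisor X)) :
    (Scheme.Modules.pushforward (charProj Λ)).obj
      ((Scheme.Modules.pullback (charProj Λ)).obj (differentials p)) ⟶
    (Scheme.Modules.pushforward (charProj Λ)).obj (differentials (charProj Λ ≫ p)) :=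
  (Scheme.Modules.pushforward (charProj Λ)).map (cotangentFst (charProj Λ) p)

/-- `π_* Ω_Ŷ ⟶ π_* Ω_{Ŷ/X}`. -/
def cotangentRowSnd (Λ : AddSubgroup (CartierDivisor X)) :
    (Scheme.Modules.pushforward (charProj Λ)).obj (differentials (charProj Λ ≫ p)) ⟶
    (Scheme.Modules.pushforward (charProj Λ)).obj (differentials (charProj Λ)) :=
  (Scheme.Modules.pushforward (charProj Λ)).map (cotangentSnd (charProj Λ) p)

/-- `Ω_X ⊗ 𝒮̂_Λ ⟶ ℛ_Λ ⊗ 𝒮̂_Λ`. -/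
def eulerRowFst : tensorCox Λ (differentials p) ⟶ tensorCox Λ (eulerSheaf p T) :=
  tensorCoxMap Λ (eulerFst p T)

/-- `ℛ_Λ ⊗ 𝒮̂_Λ ⟶ Λ_X ⊗ 𝒮̂_Λ`. -/
def eulerRowSnd : tensorCox Λ (eulerSheaf p T) ⟶ tensorCox Λ (latticeSheaf Λ) :=
  tensorCoxMap Λ (eulerSnd p T)

/-- `φ` is the homomorphism `π_* Ω_Ŷ ⟶ ℛ_Λ ⊗ 𝒮̂_Λ` determined by the derivation `s ↦ ds` of the Cox
sheaf: for a section `h` of `𝒪_X(D_λ)` with local expression `s = h f_i^λ`, the form `t · dh` is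
sent to `(ds, s ⊗ D_λ) ⊗ (f_i^λ)⁻¹ t`. -/
def IsInducedByDerivation
    (φ : (Scheme.Modules.pushforward (charProj Λ)).obj (differentials (charProj Λ ≫ p)) ⟶
      tensorCox Λ (eulerSheaf p T)) : Prop :=
  ∀ (i : T.Idx) (l : Λ) (V : X.Opens) (hV : IsAffineOpen V) (hVi : V ≤ T.opens i)
    (h : X.functionField) (hh : ∀ x : V, IsRegularAt l.1 x.1 h) (s : Γ(X, V))
    (_ : ∀ x : V, toRational V x s =
      h * (T.eqn i (Multiplicative.ofAdd l) : X.functionField)) (t : CoxRing Λ V),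
    φ.app V (show Γ(differentials (charProj Λ ≫ p), charProj Λ ⁻¹ᵁ V) from
        coxFunction Λ ⟨V, hV⟩ t •
          d (charProj Λ ≫ p) (charProj Λ ⁻¹ᵁ V)
            (coxFunction Λ ⟨V, hV⟩ (coxMonomial Λ l V h hh))) =
      tmulCox Λ (eulerSheaf p T) V (eulerDifferential T p i l V hVi s)
        (generator T i l V hVi * t)

end Main

section Existence

variable {X : Scheme.{0}} [IsIntegral X] (Λ : AddSubgroup (CartierDivisor X))

lemma principalAt_hom_apply (x : X) (f : Multiplicative Λ →* X.functionFieldˣ) :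
    ∃ g : Λ →+ LocalDivisor X x, ∀ l, g l = principalAt x (f (.ofAdd l)) :=
  ⟨AddMonoidHom.mk' (fun l => principalAt x (f (.ofAdd l))) fun l m => by
    rw [ofAdd_add, map_mul, principalAt_mul], fun _ => rfl⟩

/-- Local equations of the divisors in `Λ` exist if `Λ` is free and finitely generated. -/
lemma nonempty_localEquations [Module.Free ℤ Λ] [Module.Finite ℤ Λ] :
    Nonempty (LocalEquations Λ) := by
  classical
  let b := Module.Free.chooseBasis ℤ Λ
  have key (x : X) : ∃ V : X.Opens, IsAffineOpen V ∧ x ∈ V ∧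
      ∃ f : Module.Free.ChooseBasisIndex ℤ Λ → X.functionFieldˣ,
        ∀ k, ∀ y ∈ V, (b k).1.1 y = principalAt y (f k) := by
    choose U hU f hf using fun k => (b k).1.2 x
    obtain ⟨_, ⟨V, hV, rfl⟩, hxV, hVU⟩ := X.isBasis_affineOpens.exists_subset_of_mem_open
      (show x ∈ ((Finset.univ.inf U : X.Opens) : Set X) by
        rw [Opens.coe_finset_inf]; simpa using hU) (Finset.univ.inf U : X.Opens).isOpen
    exact ⟨V, hV, hxV, f, fun k y hy =>
      hf k y ((Finset.inf_le (Finset.mem_univ k) : _ ≤ U k) (hVU hy))⟩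
  choose V hV hxV f hf using key
  refine ⟨⟨X, V, hV, fun x => ⟨x, hxV x⟩, fun x =>
    AddMonoidHom.toMultiplicativeLeft ((b.constr ℤ fun k => Additive.ofMul (f x k)).toAddMonoidHom),
    fun x l y hy => ?_⟩⟩
  obtain ⟨g, hg⟩ := principalAt_hom_apply Λ y
    (AddMonoidHom.toMultiplicativeLeft
      ((b.constr ℤ fun k => Additive.ofMul (f x k)).toAddMonoidHom))
  rw [← hg]
  let E : AddSubgroup Λ :=
    { carrier := {l | l.1.1 y = g l}
      zero_mem' := (map_zero g).symm
      add_mem' := fun {l m} hl hm => by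
        change l.1.1 y + m.1.1 y = g (l + m)
        rw [map_add]
        exact congrArg₂ (· + ·) hl hm
      neg_mem' := fun {l} hl => by
        change -l.1.1 y = g (-l)
        rw [map_neg]
        exact congrArg Neg.neg hl }
  have hE : Submodule.span ℤ (Set.range b) ≤ AddSubgroup.toIntSubmodule E := by
    refine Submodule.span_le.2 ?_
    rintro _ ⟨k, rfl⟩
    change (b k).1.1 y = g (b k)
    rw [hg, hf x k y hy]
    congr 1
    change f x k = Additive.toMul (b.constr ℤ (fun k => Additive.ofMul (f x k)) (b k))
    rw [b.constr_basis]
    rfl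
  exact hE (b.span_eq ▸ Submodule.mem_top)

end Existence

end

end CoxEuler

open CoxEuler

/-! Let V be an affine open subset of U_i, put B = 𝒪_X(V) and e_λ = (f_i^λ)⁻¹. The e_λ form a
B-basis of A = 𝒮̂_Λ(V) and satisfy e_{λ+μ} = e_λ e_μ, so A is the Laurent algebra B[Λ] and π⁻¹V =
Spec A. There d(c e_λ) = e_λ (dc + c · e_λ⁻¹ de_λ), and the logarithmic forms e_λ⁻¹ de_λ are
additive in λ. Hence Ω_A = A ⊗_B (Ω_B ⊕ B ⊗ Λ), where e_λ⁻¹ d(c e_λ) corresponds to (dc, c ⊗ λ);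
relative to B only the summand A ⊗ Λ remains, and the pullback of Ω_X gives A ⊗_B Ω_B. Replacing i
by j multiplies the local expression c by g_ij^λ, which adds ψ_ij to the form component. This is
exactly the gluing rule of ℛ_Λ, so the local isomorphisms do not depend on i and glue.

The algebra is `exists_laurentDifferentials_equiv`: a Leibniz rule in which degrees add yields a
derivation of A, and the universal property makes it an isomorphism once an inverse is given on
generators. The middle and right arrows are both instances of
`exists_pushforward_differentials_iso`, applied to a `LogDerivation` with values in ℛ_Λ or in Λ_X.
Independence of i rests on `eulerDifferential_change` and `LogDerivation.tmulCox_change`.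

All sheaves involved are sheafifications, so their sections over affine open sets have to be
computed. This is the purpose of `IsGermLocalization`: a module that gives the correct germs after
localization is the module of sections over an affine open set, by the classical argument for
quasi-coherent sheaves (`IsGermLocalization.bijective`). It applies to Ω, to Λ_X, to ℛ_Λ and to
tensor products with the Cox sheaf, since all of these are locally direct sums of Ω and 𝒪_X.

The inverse image π^*Ω_X is available only through its adjunction. That it is locally generated by
pulled-back sections follows from a retraction (`exists_res_mem_pullbackSpan`). That A ⊗ Ω_B injects
into it is seen after mapping further to Ω_Ŷ and ℛ_Λ ⊗ 𝒮̂_Λ, where the composite is the injective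
first map of the lower row (`isGermLocalization_pullTensor`).

Over small affine open sets the lower row is a direct sum, indexed by Λ, of copies of a split exact
sequence; hence it is exact, and the upper row is exact because it is isomorphic to it. The same
direct sum decomposition grades the lower row, and the gradings of the upper row are transported
along the vertical isomorphisms. -/

open CategoryTheory AlgebraicGeometry TopologicalSpace Opposite
open scoped TensorProduct

namespace CoxEuler
noncomputable section

/-! ### Sections of sheaves of modules -/

section Restriction

variable {X : Scheme.{0}}

/-- Restriction of functions. -/
def resO {U V : X.Opens} (h : V ≤ U) : Γ(X, U) →+* Γ(X, V) := (X.presheaf.map (homOfLE h).op).hom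

/-- Restriction of sections of a presheaf of modules. -/
def resP (P : X.PresheafOfModules) {U V : X.Opens} (h : V ≤ U) :
    P.obj (op U) →+ P.obj (op V) := (P.presheaf.map (homOfLE h).op).hom

/-- Restriction of sections of a sheaf of modules. -/
def res (M : X.Modules) {U V : X.Opens} (h : V ≤ U) : Γ(M, U) →+ Γ(M, V) :=
  (M.presheaf.map (homOfLE h).op).hom

instance (P : X.PresheafOfModules) (U : X.Opens) : Module Γ(X, U) (P.obj (op U)) :=
  inferInstanceAs (Module (X.ringCatSheaf.obj.obj (op U)) (P.obj (op U)))

lemma resO_resO {U V W : X.Opens} (h : V ≤ U) (h' : W ≤ V) (a : Γ(X, U)) :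
    resO h' (resO h a) = resO (h'.trans h) a :=
  congr($((X.presheaf.map_comp (homOfLE h).op (homOfLE h').op).symm) a)

lemma resO_self {U : X.Opens} (h : U ≤ U) (a : Γ(X, U)) : resO h a = a :=
  congr($(X.presheaf.map_id (op U)) a)

lemma resP_resP (P : X.PresheafOfModules) {U V W : X.Opens} (h : V ≤ U) (h' : W ≤ V)
    (m : P.obj (op U)) : resP P h' (resP P h m) = resP P (h'.trans h) m :=
  congr($((P.presheaf.map_comp (homOfLE h).op (homOfLE h').op).symm) m)

lemma resP_self (P : X.PresheafOfModules) {U : X.Opens} (h : U ≤ U)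
    (m : P.obj (op U)) : resP P h m = m :=
  congr($(P.presheaf.map_id (op U)) m)

lemma resP_smul (P : X.PresheafOfModules) {U V : X.Opens} (h : V ≤ U) (a : Γ(X, U))
    (m : P.obj (op U)) : resP P h (a • m) = resO h a • resP P h m :=
  P.map_smul (homOfLE h).op a m

lemma res_res (M : X.Modules) {U V W : X.Opens} (h : V ≤ U) (h' : W ≤ V) (m : Γ(M, U)) :
    res M h' (res M h m) = res M (h'.trans h) m := resP_resP M.val h h' m

lemma res_self (M : X.Modules) {U : X.Opens} (h : U ≤ U) (m : Γ(M, U)) : res M h m = m :=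
  resP_self M.val h m

lemma res_smul (M : X.Modules) {U V : X.Opens} (h : V ≤ U) (a : Γ(X, U)) (m : Γ(M, U)) :
    res M h (a • m) = resO h a • res M h m := resP_smul M.val h a m

lemma res_app {M N : X.Modules} (φ : M ⟶ N) {U V : X.Opens} (h : V ≤ U) (m : Γ(M, U)) :
    res N h (φ.app U m) = φ.app V (res M h m) :=
  congr($((φ.mapPresheaf.naturality (homOfLE h).op).symm) m)

lemma res_toSheafify (P : X.PresheafOfModules) {U V : X.Opens} (h : V ≤ U) (m : P.obj (op U)) :
    res (sheafify P) h (toSheafify P U m) = toSheafify P V (resP P h m) :=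
  toSheafify_map P (homOfLE h) m

lemma toSheafify_smul' (P : X.PresheafOfModules) (U : X.Opens) (a : Γ(X, U)) (m : P.obj (op U)) :
    toSheafify P U (a • m) = a • toSheafify P U m := toSheafify_smul P U a m

lemma eq_of_res_eq (M : X.Modules) {U : X.Opens} {s t : Γ(M, U)}
    (h : ∀ x ∈ U, ∃ (V : X.Opens) (e : V ≤ U), x ∈ V ∧ res M e s = res M e t) : s = t := by
  choose V e hx hV using h
  refine TopCat.Sheaf.eq_of_locally_eq' ⟨M.presheaf, M.isSheaf⟩ (fun x : U => V x.1 x.2) U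
    (fun x => homOfLE (e x.1 x.2)) (fun x hxU => Opens.mem_iSup.2 ⟨⟨x, hxU⟩, hx x hxU⟩) s t
    fun x => hV x.1 x.2

lemma eq_zero_of_res_eq_zero (M : X.Modules) {U : X.Opens} {s : Γ(M, U)}
    (h : ∀ x ∈ U, ∃ (V : X.Opens) (e : V ≤ U), x ∈ V ∧ res M e s = 0) : s = 0 :=
  eq_of_res_eq M fun x hx => by simpa using h x hx

lemma exists_glue (M : X.Modules) {ι : Type} {U : X.Opens} (V : ι → X.Opens) (e : ∀ i, V i ≤ U)
    (hV : ∀ x ∈ U, ∃ i, x ∈ V i) (s : ∀ i, Γ(M, V i))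
    (hs : ∀ i j, res M (inf_le_left : V i ⊓ V j ≤ V i) (s i) = res M inf_le_right (s j)) :
    ∃ t : Γ(M, U), ∀ i, res M (e i) t = s i := by
  obtain ⟨t, ht, -⟩ := TopCat.Sheaf.existsUnique_gluing' ⟨M.presheaf, M.isSheaf⟩ V U
    (fun i => homOfLE (e i)) (fun x hx => Opens.mem_iSup.2 (hV x hx)) s (fun i j => hs i j)
  exact ⟨t, ht⟩

/-- The unit of sheafification is locally surjective on underlying presheaves of groups, so its
image sieve is covering; the next lemma is the corresponding local injectivity. -/
lemma exists_res_eq_toSheafify (P : X.PresheafOfModules) {U : X.Opens} (s : Γ(sheafify P, U))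
    {x : X} (hx : x ∈ U) : ∃ (V : X.Opens) (e : V ≤ U) (m : P.obj (op V)), x ∈ V ∧
      res (sheafify P) e s = toSheafify P V m := by
  have h := CategoryTheory.Presheaf.imageSieve_mem (Opens.grothendieckTopology X)
    (CategoryTheory.toSheafify (Opens.grothendieckTopology X) P.presheaf) (U := op U) s
  obtain ⟨V, f, ⟨m, hm⟩, hxV⟩ := h x hx
  exact ⟨V, f.le, m, hxV, hm.symm⟩

lemma exists_res_eq_zero_of_toSheafify (P : X.PresheafOfModules) {U : X.Opens} {m : P.obj (op U)}
    (hm : toSheafify P U m = 0) {x : X} (hx : x ∈ U) :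
    ∃ (V : X.Opens) (e : V ≤ U), x ∈ V ∧ resP P e m = 0 := by
  have h := CategoryTheory.Presheaf.equalizerSieve_mem (Opens.grothendieckTopology X)
    (CategoryTheory.toSheafify (Opens.grothendieckTopology X) P.presheaf) (X := op U)
    (show P.presheaf.obj (op U) from m) 0 (hm.trans (map_zero (toSheafify P U)).symm)
  obtain ⟨V, f, hf, hxV⟩ := h x hx
  exact ⟨V, f.le, hxV, (hf : P.presheaf.map f.op _ = P.presheaf.map f.op 0).trans (map_zero _)⟩

end Restriction

/-! ### Sections over affine open sets -/

section Localization

variable {X : Scheme.{0}}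

/-- Otherwise some prime contains I and avoids the powers of g; as a point of U it lies in D(g),
while every element of I vanishes there. -/
lemma exists_pow_mem_of_forall_mem_basicOpen {U : X.Opens} (hU : IsAffineOpen U)
    (I : Ideal Γ(X, U)) (g : Γ(X, U))
    (h : ∀ x ∈ X.basicOpen g, ∃ f ∈ I, x ∈ X.basicOpen f) : ∃ n : ℕ, g ^ n ∈ I := by
  by_contra! hn
  obtain ⟨P, hP, hIP, hgP⟩ := Ideal.exists_le_prime_disjoint I (Submonoid.powers g)
    (Set.disjoint_left.2 fun a ha ⟨n, hna⟩ => hn n (by rw [show g ^ n = a from hna]; exact ha))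
  have key : ∀ f : Γ(X, U), hU.fromSpec ⟨P, hP⟩ ∈ X.basicOpen f ↔ f ∉ P := fun f => by
    have : (⟨P, hP⟩ : PrimeSpectrum Γ(X, U)) ∈ hU.fromSpec ⁻¹ᵁ X.basicOpen f ↔ f ∉ P := by
      rw [hU.fromSpec_preimage_basicOpen]; rfl
    exact this
  obtain ⟨f, hf, hxf⟩ := h _ ((key g).2 fun hg => Set.disjoint_left.1 hgP hg ⟨1, pow_one g⟩)
  exact (key f).1 hxf (hIP hf)

lemma eq_top_of_forall_mem_basicOpen {U : X.Opens} (hU : IsAffineOpen U) (I : Ideal Γ(X, U))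
    (h : ∀ x ∈ U, ∃ f ∈ I, x ∈ X.basicOpen f) : I = ⊤ := by
  obtain ⟨n, hn⟩ := exists_pow_mem_of_forall_mem_basicOpen hU I 1
    fun x hx => h x (X.basicOpen_le _ hx)
  rwa [one_pow, ← Ideal.eq_top_iff_one] at hn

/-- The annihilator of a has no common zero on U, hence is the unit ideal. -/
lemma eq_zero_of_forall_smul_eq_zero {U : X.Opens} (hU : IsAffineOpen U) {A : Type*}
    [AddCommGroup A] [Module Γ(X, U) A] (a : A)
    (h : ∀ x ∈ U, ∃ f : Γ(X, U), x ∈ X.basicOpen f ∧ f • a = 0) : a = 0 := by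
  have := eq_top_of_forall_mem_basicOpen hU (LinearMap.ker (LinearMap.toSpanSingleton Γ(X, U) A a))
    fun x hx => let ⟨f, h1, h2⟩ := h x hx; ⟨f, by simpa using h2, h1⟩
  simpa using (Ideal.eq_top_iff_one _).1 this

lemma isUnit_resO_basicOpen {U : X.Opens} (f : Γ(X, U)) : IsUnit (resO (X.basicOpen_le f) f) :=
  X.toRingedSpace.isUnit_res_basicOpen f

lemma exists_basicOpen_le_of_mem {U W : X.Opens} (hU : IsAffineOpen U) (h : W ≤ U) {x : X}
    (hx : x ∈ W) : ∃ f : Γ(X, U), x ∈ X.basicOpen f ∧ X.basicOpen f ≤ W := by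
  obtain ⟨f, hf, hxf⟩ := hU.exists_basicOpen_le ⟨x, hx⟩ (h hx)
  exact ⟨f, hxf, hf⟩

/-- Every germ of a function at a point of an affine open set `U` is a quotient of functions
on `U`. -/
lemma exists_mul_resO_eq {U W : X.Opens} (hU : IsAffineOpen U) (h : W ≤ U) {x : X} (hx : x ∈ W)
    (c : Γ(X, W)) : ∃ (r a : Γ(X, U)) (V : X.Opens) (e : V ≤ W), x ∈ V ∧ x ∈ X.basicOpen r ∧
      resO e (resO h r * c) = resO (e.trans h) a := by
  obtain ⟨f, hxf, hfW⟩ := exists_basicOpen_le_of_mem hU h hx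
  have := hU.isLocalization_basicOpen f
  obtain ⟨⟨a, ⟨_, n, rfl⟩⟩, e⟩ := IsLocalization.surj (Submonoid.powers f) (resO hfW c)
  have e' : resO hfW c * resO (X.basicOpen_le f) (f ^ n) = resO (X.basicOpen_le f) a := e
  -- The extra factor f makes the exponent positive, so that D(f^(n+1)) = D(f) also when n = 0.
  refine ⟨f ^ (n + 1), f * a, X.basicOpen f, hfW, hxf, ?_, ?_⟩
  · rw [Scheme.basicOpen_pow _ _ (Nat.succ_pos n)]
    exact hxf
  · rw [map_mul, resO_resO, map_mul, ← e', pow_succ, map_mul]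
    ring

/-- A semilinear map `j` from an `R ≅ 𝒪_X(U)`-module to the sections over `U` of a presheaf of
modules which induces isomorphisms from the localizations to the stalks. -/
structure IsGermLocalization (P : X.PresheafOfModules) {U : X.Opens} {R A : Type*} [CommRing R]
    [AddCommGroup A] [Module R A] (ρ : R ≃+* Γ(X, U)) (j : A →+ P.obj (op U)) : Prop where
  map_smul : ∀ r a, j (r • a) = ρ r • j a
  exists_smul_eq_zero : ∀ (W : X.Opens) (h : W ≤ U) (x : X), x ∈ W → ∀ a : A,
    resP P h (j a) = 0 → ∃ r : R, x ∈ X.basicOpen (ρ r) ∧ r • a = 0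
  exists_smul_eq : ∀ (W : X.Opens) (h : W ≤ U) (x : X), x ∈ W → ∀ m : P.obj (op W),
    ∃ (r : R) (a : A) (V : X.Opens) (e : V ≤ W), x ∈ V ∧ x ∈ X.basicOpen (ρ r) ∧
      resP P e (resO h (ρ r) • m) = resP P (e.trans h) (j a)

namespace IsGermLocalization

variable {P : X.PresheafOfModules} {U : X.Opens} {R A : Type*} [CommRing R]
    [AddCommGroup A] [Module R A] {ρ : R ≃+* Γ(X, U)} {j : A →+ P.obj (op U)}

/-- Sheafification does not change germs: sections of the associated sheaf come locally from P, and
sections of P that die in it die locally in P. -/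
lemma toSheafify (H : IsGermLocalization P ρ j) :
    IsGermLocalization (sheafify P).val ρ ((toSheafify P U).comp j) where
  map_smul r a := by
    refine (congrArg (CoxEuler.toSheafify P U) (H.map_smul r a)).trans ?_
    exact toSheafify_smul' P U (ρ r) (j a)
  exists_smul_eq_zero W h x hx a ha := by
    obtain ⟨V, e, hxV, h0⟩ := exists_res_eq_zero_of_toSheafify P
      ((res_toSheafify P h (j a)).symm.trans ha) hx
    rw [resP_resP] at h0
    exact H.exists_smul_eq_zero V (e.trans h) x hxV a h0
  exists_smul_eq W h x hx m := by
    obtain ⟨V, e, m', hxV, hm'⟩ := exists_res_eq_toSheafify P (show Γ(sheafify P, W) from m) hx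
    obtain ⟨r, a, V', e', hxV', hxr, hr⟩ := H.exists_smul_eq V (e.trans h) x hxV m'
    refine ⟨r, a, V', e'.trans e, hxV', hxr, ?_⟩
    refine ((res_smul (sheafify P) (e'.trans e) _ (show Γ(sheafify P, W) from m)).trans ?_)
    refine Eq.trans ?_ (res_toSheafify P ((e'.trans e).trans h) (j a)).symm
    rw [← hr, resO_resO, ← res_res (sheafify P) e e', hm', res_toSheafify, resP_smul, resO_resO,
      toSheafify_smul']

/-- The annihilator of a meets the complement of each point of D(g), so it contains a power of g.
The open set is given by an equation `hgV` so that intersections such as D(h) ∩ D(h') can be used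
directly. -/
lemma exists_pow_smul_eq_zero (H : IsGermLocalization P ρ j) (hU : IsAffineOpen U) (g : R)
    (a : A) {V : X.Opens} (hV : V ≤ U) (hgV : V = X.basicOpen (ρ g)) (ha : resP P hV (j a) = 0) :
    ∃ n : ℕ, g ^ n • a = 0 := by
  obtain ⟨n, hn⟩ := exists_pow_mem_of_forall_mem_basicOpen hU
    (Ideal.comap ρ.symm.toRingHom (LinearMap.ker (LinearMap.toSpanSingleton R A a)))
    (ρ g) (fun x hx => by
      obtain ⟨r, hxr, hr⟩ := H.exists_smul_eq_zero _ hV x (hgV ▸ hx) a ha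
      refine ⟨ρ r, Ideal.mem_comap.2 (LinearMap.mem_ker.2 ?_), hxr⟩
      exact (congrArg (· • a) (ρ.symm_apply_apply r)).trans hr)
  refine ⟨n, ?_⟩
  have : ρ.symm (ρ g ^ n) • a = 0 := hn
  rwa [← map_pow, ρ.symm_apply_apply] at this

lemma injective (H : IsGermLocalization P ρ j) (hU : IsAffineOpen U) : Function.Injective j := by
  rw [injective_iff_map_eq_zero]
  intro a ha
  obtain ⟨n, hn⟩ := H.exists_pow_smul_eq_zero hU 1 a le_rfl
    (by rw [map_one, Scheme.basicOpen_of_isUnit _ isUnit_one]) (by rw [ha, map_zero])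
  rwa [one_pow, one_smul] at hn

/-- Numerator and denominator of a germ are multiplied by a function f whose nonvanishing locus lies
where the fraction is valid. The new denominator is then nonzero exactly on the set on which the
equality holds. -/
lemma exists_smul_eq_on_basicOpen (H : IsGermLocalization P ρ j) (hU : IsAffineOpen U)
    (s : P.obj (op U)) {x : X} (hx : x ∈ U) :
    ∃ (h : R) (a : A) (V : X.Opens) (hV : V ≤ U), V = X.basicOpen (ρ h) ∧ x ∈ V ∧
      resP P hV (ρ h • s) = resP P hV (j a) := by
  obtain ⟨r, a, V, e, hxV, hxr, hr⟩ := H.exists_smul_eq U le_rfl x hx s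
  obtain ⟨f, hxf, hfV⟩ := exists_basicOpen_le_of_mem hU
    (show V ⊓ X.basicOpen (ρ r) ≤ U from inf_le_left.trans e) ⟨hxV, hxr⟩
  refine ⟨ρ.symm f * r, ρ.symm f • a, X.basicOpen f, X.basicOpen_le f, ?_, hxf, ?_⟩
  · rw [map_mul, RingEquiv.apply_symm_apply, Scheme.basicOpen_mul]
    exact (inf_eq_left.2 (hfV.trans inf_le_right)).symm
  · have := congrArg (resP P (hfV.trans inf_le_left)) hr
    rw [resP_resP, resP_resP, resO_self] at this
    rw [H.map_smul, map_mul, mul_smul, resP_smul _ _ _ (j a), resP_smul]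
    exact congrArg (resO (X.basicOpen_le f) (ρ (ρ.symm f)) • ·) this

/-- Gluing of the fractions b_l / f_l by a partition of unity. With one exponent N large enough for
all pairs, the f_k^(N+1) still generate the unit ideal; if ∑ c_k f_k^(N+1) = 1, then a = ∑ c_k f_k^N
b_k works. -/
lemma exists_of_span_eq_top {ι : Type*} [Fintype ι] (f : ι → R) (b : ι → A)
    (hsp : Ideal.span (Set.range f) = ⊤)
    (hcross : ∀ k l, ∃ n : ℕ, (f k * f l) ^ n • (f l • b k - f k • b l) = 0) :
    ∃ (a : A) (N : ℕ), ∀ l, f l ^ (N + 1) • a = f l ^ N • b l := by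
  choose n hn using hcross
  let N := Finset.univ.sup fun k => Finset.univ.sup (n k)
  have hN : ∀ k l, (f k * f l) ^ N • (f l • b k - f k • b l) = 0 := fun k l => by
    have h1 : n k l ≤ N := (Finset.le_sup (f := n k) (Finset.mem_univ l)).trans
      (Finset.le_sup (f := fun k => Finset.univ.sup (n k)) (Finset.mem_univ k))
    obtain ⟨c, hc⟩ := Nat.exists_eq_add_of_le h1
    rw [hc, pow_add, mul_comm, mul_smul, hn, smul_zero]
  have hcross' : ∀ k l, f l ^ (N + 1) • f k ^ N • b k = f k ^ (N + 1) • f l ^ N • b l := by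
    intro k l
    have := hN k l
    rw [smul_sub, sub_eq_zero, smul_smul, smul_smul] at this
    rw [smul_smul, smul_smul]
    convert this using 2 <;> ring
  have hpow : (1 : R) ∈ Ideal.span (Set.range fun k => f k ^ (N + 1)) := by
    have := Ideal.span_pow_eq_top _ hsp (N + 1)
    rw [← Set.range_comp] at this
    rw [← Ideal.eq_top_iff_one]
    exact this
  obtain ⟨c, hc⟩ := (Submodule.mem_span_range_iff_exists_fun R).1 hpow
  refine ⟨∑ k, c k • f k ^ N • b k, N, fun l => ?_⟩
  rw [Finset.smul_sum]
  have : ∀ k, f l ^ (N + 1) • c k • f k ^ N • b k = (c k • f k ^ (N + 1)) • f l ^ N • b l := by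
    intro k
    rw [smul_comm, hcross', smul_assoc]
  rw [Finset.sum_congr rfl fun k _ => this k, ← Finset.sum_smul, hc, one_smul]

lemma exists_finite_cover (hU : IsAffineOpen U) (h : {x // x ∈ U} → R)
    (hxh : ∀ x : U, x.1 ∈ X.basicOpen (ρ (h x))) :
    ∃ t : Finset {x // x ∈ U}, Ideal.span (Set.range fun k : t => h k.1) = ⊤ ∧
      ∀ x ∈ U, ∃ k ∈ t, x ∈ X.basicOpen (ρ (h k)) := by
  obtain ⟨t, ht⟩ := hU.isCompact.elim_finite_subcover (fun x : U => (X.basicOpen (ρ (h x)) : Set X))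
    (fun x => (X.basicOpen _).isOpen) (fun x hx => Set.mem_iUnion.2 ⟨⟨x, hx⟩, hxh ⟨x, hx⟩⟩)
  have hcov : ∀ x ∈ U, ∃ k ∈ t, x ∈ X.basicOpen (ρ (h k)) := fun x hx => by
    obtain ⟨k, hk⟩ := Set.mem_iUnion.1 (ht hx)
    obtain ⟨hkt, hxk⟩ := Set.mem_iUnion.1 hk
    exact ⟨k, hkt, hxk⟩
  refine ⟨t, ?_, hcov⟩
  have h1 := eq_top_of_forall_mem_basicOpen hU
    (Ideal.comap ρ.symm.toRingHom (Ideal.span (Set.range fun k : t => h k.1))) fun x hx => by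
      obtain ⟨k, hkt, hk⟩ := hcov x hx
      refine ⟨ρ (h k), Ideal.mem_comap.2 ?_, hk⟩
      exact Ideal.subset_span ⟨⟨k, hkt⟩, (ρ.symm_apply_apply (h k)).symm⟩
  rw [Ideal.eq_top_iff_one] at h1 ⊢
  exact (map_one ρ.symm).symm ▸ Ideal.mem_comap.1 h1

/-- The argument for quasi-coherent sheaves: a section is a fraction on each member of a finite
cover by basic open sets, two such fractions agree on overlaps up to a power of the denominators,
and the fractions glue to an element of A. The sheaf property of F is used to compare the result
with the given section. -/
lemma surjective {F : X.Modules} {j : A →+ F.val.obj (op U)} (H : IsGermLocalization F.val ρ j)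
    (hU : IsAffineOpen U) : Function.Surjective j := by
  intro s
  choose h a V hV hVD hxV hs using fun x : {x // x ∈ U} => H.exists_smul_eq_on_basicOpen hU s x.2
  obtain ⟨t, hsp, hcov⟩ := exists_finite_cover (ρ := ρ) hU h fun x => hVD x ▸ hxV x
  have hcross : ∀ k l : {x // x ∈ U}, ∃ n : ℕ,
      (h k * h l) ^ n • (h l • a k - h k • a l) = 0 := by
    intro k l
    refine H.exists_pow_smul_eq_zero hU _ _ (V := V k ⊓ V l) (inf_le_left.trans (hV k)) ?_ ?_
    · rw [hVD, hVD, map_mul, Scheme.basicOpen_mul]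
    have ek := congrArg (resP F.val (inf_le_left : V k ⊓ V l ≤ V k)) (hs k)
    have el := congrArg (resP F.val (inf_le_right : V k ⊓ V l ≤ V l)) (hs l)
    rw [resP_resP, resP_resP] at ek el
    rw [map_sub, H.map_smul, H.map_smul, map_sub, resP_smul, resP_smul, ← ek, ← el,
      resP_smul, resP_smul, smul_smul, smul_smul, mul_comm]
    exact sub_self _
  obtain ⟨b, N, hb⟩ := exists_of_span_eq_top (fun k : t => h k.1) (fun k : t => a k.1) hsp
    fun k l => hcross k.1 l.1
  refine ⟨b, eq_of_res_eq F fun x hx => ?_⟩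
  obtain ⟨l, hlt, hl⟩ := hcov x hx
  refine ⟨V l, hV l, hVD l ▸ hl, ?_⟩
  have hbl : h l ^ (N + 1) • b = h l ^ N • a l := hb ⟨l, hlt⟩
  have e1 := congrArg (resP F.val (hV l)) (congrArg j hbl)
  rw [H.map_smul, H.map_smul, map_pow, map_pow, resP_smul, resP_smul, ← hs, resP_smul, smul_smul,
    ← map_mul, ← pow_succ] at e1
  -- On V_l = D(h_l) the denominator is invertible and can be cancelled.
  have hu : IsUnit (resO (hV l) (ρ (h l) ^ (N + 1))) := by
    rw [map_pow]
    refine IsUnit.pow _ ?_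
    have := (isUnit_resO_basicOpen (ρ (h l))).map (resO (hVD l).le)
    rwa [resO_resO] at this
  exact hu.smul_left_cancel.1 e1

lemma bijective {F : X.Modules} {j : A →+ F.val.obj (op U)} (H : IsGermLocalization F.val ρ j)
    (hU : IsAffineOpen U) : Function.Bijective j := ⟨H.injective hU, H.surjective hU⟩

end IsGermLocalization

/-- The stalks of `P` at the points of `U` are localizations of the module `P(U)`. -/
abbrev IsGermLocalizing (P : X.PresheafOfModules) (U : X.Opens) : Prop :=
  IsGermLocalization P (RingEquiv.refl Γ(X, U)) (AddMonoidHom.id (P.obj (op U)))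

namespace IsGermLocalizing

variable {P : X.PresheafOfModules} {U : X.Opens}

lemma toSheafify_bijective (H : IsGermLocalizing P U) (hU : IsAffineOpen U) :
    Function.Bijective (toSheafify P U) := IsGermLocalization.toSheafify H |>.bijective hU

end IsGermLocalizing

/-- If `j` is bijective and a germwise localization, then so is the identity. -/
lemma IsGermLocalization.isGermLocalizing {P : X.PresheafOfModules} {U : X.Opens} {R A : Type*}
    [CommRing R] [AddCommGroup A] [Module R A] {ρ : R ≃+* Γ(X, U)} {j : A →+ P.obj (op U)}
    (H : IsGermLocalization P ρ j) (hj : Function.Surjective j) : IsGermLocalizing P U where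
  map_smul _ _ := rfl
  exists_smul_eq_zero W h x hx a ha := by
    obtain ⟨a, rfl⟩ := hj a
    obtain ⟨r, hr, hra⟩ := H.exists_smul_eq_zero W h x hx a ha
    exact ⟨ρ r, hr, (H.map_smul r a).symm.trans (by rw [hra, map_zero])⟩
  exists_smul_eq W h x hx m := by
    obtain ⟨r, a, V, e, h1, h2, h3⟩ := H.exists_smul_eq W h x hx m
    exact ⟨ρ r, j a, V, e, h1, h2, h3⟩

lemma IsGermLocalizing.sheafify {P : X.PresheafOfModules} {U : X.Opens}
    (H : IsGermLocalizing P U) (hU : IsAffineOpen U) : IsGermLocalizing (sheafify P).val U :=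
  (IsGermLocalization.toSheafify H).isGermLocalizing (H.toSheafify_bijective hU).2

end Localization

/-! ### Morphisms of sheaves of modules and bases of open sets -/

section Basis

variable {X : Scheme.{0}} {M N K : X.Modules}

/-- A morphism given by compatible linear maps between the groups of sections. -/
def homOfSections (f : ∀ U : X.Opens, Γ(M, U) →+ Γ(N, U))
    (hsmul : ∀ U (a : Γ(X, U)) (m : Γ(M, U)), f U (a • m) = a • f U m)
    (hres : ∀ (U V : X.Opens) (h : V ≤ U) (m : Γ(M, U)), f V (res M h m) = res N h (f U m)) :
    M ⟶ N :=
  ⟨PresheafOfModules.homMk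
    { app U := AddCommGrpCat.ofHom (X := M.presheaf.obj U) (Y := N.presheaf.obj U) (f U.unop)
      naturality U V e := by
        ext m
        exact hres U.unop V.unop e.unop.le m }
    (fun U a m => hsmul U.unop a m)⟩

lemma exists_mem_basis {𝔅 : Set X.Opens} (h𝔅 : Opens.IsBasis 𝔅) {U : X.Opens} {x : X}
    (hx : x ∈ U) : ∃ V ∈ 𝔅, V ≤ U ∧ x ∈ V := by
  obtain ⟨V, hV, hxV, hVU⟩ := Opens.isBasis_iff_nbhd.1 h𝔅 hx
  exact ⟨V, hV, hVU, hxV⟩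

lemma hom_ext_of_basis {𝔅 : Set X.Opens} (h𝔅 : Opens.IsBasis 𝔅) {φ ψ : M ⟶ N}
    (h : ∀ V ∈ 𝔅, ∀ m, φ.app V m = ψ.app V m) : φ = ψ := by
  refine Scheme.Modules.hom_ext _ _ fun U => ?_
  ext m
  refine eq_of_res_eq N fun x hx => ?_
  obtain ⟨V, hV, hVU, hxV⟩ := exists_mem_basis h𝔅 hx
  exact ⟨V, hVU, hxV, by rw [res_app, res_app, h V hV]⟩

/-- A map into a sheaf of abelian groups is determined by its values on a basis and extends from
there; linearity of the extension is a local question. -/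
lemma exists_hom_of_basis {𝔅 : Set X.Opens} (h𝔅 : Opens.IsBasis 𝔅)
    (f : ∀ V ∈ 𝔅, Γ(M, V) →+ Γ(N, V))
    (hsmul : ∀ V hV (a : Γ(X, V)) (m : Γ(M, V)), f V hV (a • m) = a • f V hV m)
    (hres : ∀ V hV W hW (h : W ≤ V) (m : Γ(M, V)), f W hW (res M h m) = res N h (f V hV m)) :
    ∃ φ : M ⟶ N, ∀ V hV m, φ.app V m = f V hV m := by
  let B : 𝔅 → Opens X := Subtype.val
  have hB : Opens.IsBasis (Set.range B) := by rwa [Subtype.range_val]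
  let F' : TopCat.Sheaf Ab X := ⟨N.presheaf, N.isSheaf⟩
  let α : (inducedFunctor B).op ⋙ M.presheaf ⟶ (inducedFunctor B).op ⋙ F'.1 :=
    { app V := AddCommGrpCat.ofHom (X := M.presheaf.obj (op V.unop.1))
        (Y := N.presheaf.obj (op V.unop.1)) (f V.unop.1 V.unop.2)
      naturality V W e := by
        ext m
        exact hres V.unop.1 V.unop.2 W.unop.1 W.unop.2 (leOfHom ((inducedFunctor B).map e.unop)) m }
  let β : M.presheaf ⟶ N.presheaf := TopCat.Sheaf.restrictHomEquivHom M.presheaf F' hB α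
  have hβ : ∀ V hV m, β.app (op V) m = f V hV m := fun V hV m =>
    congr($(TopCat.Sheaf.extend_hom_app M.presheaf F' hB α ⟨V, hV⟩) m)
  have hβres : ∀ (U V : X.Opens) (h : V ≤ U) (m : Γ(M, U)),
      β.app (op V) (res M h m) = res N h (β.app (op U) m) := fun U V h m =>
    congr($(β.naturality (homOfLE h).op) m)
  refine ⟨homOfSections (fun U => (β.app (op U)).hom) (fun U a m => ?_) hβres, hβ⟩
  refine eq_of_res_eq N fun x hx => ?_
  obtain ⟨V, hV, hVU, hxV⟩ := exists_mem_basis h𝔅 hx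
  refine ⟨V, hVU, hxV, ?_⟩
  refine (hβres U V hVU (a • m)).symm.trans ?_
  rw [res_smul, res_smul, hβ V hV, hsmul, ← hβ V hV]
  exact congrArg _ (hβres U V hVU m)

/-- The inverses of bijective linear maps compatible with restriction are again linear and
compatible with restriction, so both directions extend from the basis. -/
lemma exists_iso_of_basis {𝔅 : Set X.Opens} (h𝔅 : Opens.IsBasis 𝔅)
    (f : ∀ V ∈ 𝔅, Γ(M, V) ≃+ Γ(N, V))
    (hsmul : ∀ V hV (a : Γ(X, V)) (m : Γ(M, V)), f V hV (a • m) = a • f V hV m)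
    (hres : ∀ V hV W hW (h : W ≤ V) (m : Γ(M, V)), f W hW (res M h m) = res N h (f V hV m)) :
    ∃ φ : M ≅ N, (∀ V hV m, φ.hom.app V m = f V hV m) ∧
      ∀ V hV n, φ.inv.app V n = (f V hV).symm n := by
  obtain ⟨φ, hφ⟩ := exists_hom_of_basis h𝔅 (fun V hV => (f V hV).toAddMonoidHom) hsmul hres
  obtain ⟨ψ, hψ⟩ := exists_hom_of_basis h𝔅 (M := N) (N := M)
    (fun V hV => (f V hV).symm.toAddMonoidHom)
    (fun V hV a n => (f V hV).injective (by
      have := hsmul V hV a ((f V hV).symm n)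
      rw [AddEquiv.apply_symm_apply] at this
      exact ((f V hV).apply_symm_apply _).trans this.symm))
    (fun V hV W hW h n => (f W hW).injective (by
      have := hres V hV W hW h ((f V hV).symm n)
      rw [AddEquiv.apply_symm_apply] at this
      exact ((f W hW).apply_symm_apply _).trans this.symm))
  refine ⟨⟨φ, ψ, hom_ext_of_basis h𝔅 fun V hV m => ?_, hom_ext_of_basis h𝔅 fun V hV m => ?_⟩, hφ, hψ⟩
  · change ψ.app V (φ.app V m) = m
    rw [hψ V hV, hφ V hV]
    exact (f V hV).symm_apply_apply m
  · change φ.app V (ψ.app V m) = m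
    rw [hφ V hV, hψ V hV]
    exact (f V hV).apply_symm_apply m

lemma app_injective_of_basis {𝔅 : Set X.Opens} (h𝔅 : Opens.IsBasis 𝔅) {φ : M ⟶ N}
    (h : ∀ V ∈ 𝔅, Function.Injective (φ.app V)) (U : X.Opens) : Function.Injective (φ.app U) := by
  intro m n hmn
  refine eq_of_res_eq M fun x hx => ?_
  obtain ⟨V, hV, hVU, hxV⟩ := exists_mem_basis h𝔅 hx
  exact ⟨V, hVU, hxV, h V hV (by rw [← res_app, ← res_app, hmn])⟩

lemma mono_of_app_injective {φ : M ⟶ N} (h : ∀ U, Function.Injective (φ.app U)) : Mono φ where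
  right_cancellation g g' e := by
    refine Scheme.Modules.hom_ext _ _ fun U => ?_
    ext z
    exact h U (congr(($e).app U z))

lemma epi_of_basis {𝔅 : Set X.Opens} (h𝔅 : Opens.IsBasis 𝔅) {φ : M ⟶ N}
    (h : ∀ V ∈ 𝔅, Function.Surjective (φ.app V)) : Epi φ where
  left_cancellation g g' e := hom_ext_of_basis h𝔅 fun V hV n => by
    obtain ⟨m, rfl⟩ := h V hV n
    exact congr(($e).app V m)

/-- The universal property of the kernel. Preimages under f over members of the basis are unique by
injectivity, so they agree on overlaps and glue; uniqueness also makes the resulting maps additive,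
linear and natural. -/
lemma exists_lift_of_basis {𝔅 : Set X.Opens} (h𝔅 : Opens.IsBasis 𝔅) {f : M ⟶ N} {g : N ⟶ K}
    (hf : ∀ V ∈ 𝔅, Function.Injective (f.app V))
    (hfg : ∀ V ∈ 𝔅, ∀ n, g.app V n = 0 → ∃ m, f.app V m = n) {Z : X.Modules} (k : Z ⟶ N)
    (hk : k ≫ g = 0) : ∃ l : Z ⟶ M, l ≫ f = k := by
  have hf' := app_injective_of_basis h𝔅 hf
  have key : ∀ (U : X.Opens) (z : Γ(Z, U)), ∃ m : Γ(M, U), f.app U m = k.app U z := by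
    intro U z
    have hkg : ∀ V (z' : Γ(Z, V)), g.app V (k.app V z') = 0 := fun V z' => congr(($hk).app V z')
    choose m hm using fun V : {V // V ∈ 𝔅 ∧ V ≤ U} =>
      hfg V.1 V.2.1 _ (hkg V.1 (res Z V.2.2 z))
    obtain ⟨t, ht⟩ := exists_glue M (fun V : {V // V ∈ 𝔅 ∧ V ≤ U} => V.1) (fun V => V.2.2)
      (fun x hx => let ⟨V, hV, hVU, hxV⟩ := exists_mem_basis h𝔅 hx; ⟨⟨V, hV, hVU⟩, hxV⟩) m
      (fun V W => hf' _ (by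
        rw [← res_app, ← res_app, hm, hm, res_app, res_app, res_res, res_res]))
    refine ⟨t, eq_of_res_eq N fun x hx => ?_⟩
    obtain ⟨V, hV, hVU, hxV⟩ := exists_mem_basis h𝔅 hx
    exact ⟨V, hVU, hxV, by
      rw [res_app, ht ⟨V, hV, hVU⟩, res_app]
      exact hm ⟨V, hV, hVU⟩⟩
  choose l hl using key
  refine ⟨homOfSections (fun U => AddMonoidHom.mk' (l U) fun a b => hf' U ?_)
    (fun U a m => hf' U ?_) (fun U V h m => hf' V ?_), ?_⟩
  · rw [map_add, hl, hl, hl, map_add]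
  · refine (hl U _).trans ?_
    rw [Scheme.Modules.Hom.app_smul, Scheme.Modules.Hom.app_smul]
    exact congrArg _ (hl U m).symm
  · refine (hl V _).trans ?_
    rw [← res_app, ← res_app]
    exact congrArg _ (hl U m).symm
  · refine Scheme.Modules.hom_ext _ _ fun U => ?_
    ext z
    exact hl U z

lemma shortExact_of_basis {𝔅 : Set X.Opens} (h𝔅 : Opens.IsBasis 𝔅) {f : M ⟶ N} {g : N ⟶ K}
    (w : f ≫ g = 0) (hf : ∀ V ∈ 𝔅, Function.Injective (f.app V))
    (hfg : ∀ V ∈ 𝔅, ∀ n, g.app V n = 0 → ∃ m, f.app V m = n)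
    (hg : ∀ V ∈ 𝔅, Function.Surjective (g.app V)) : (ShortComplex.mk f g w).ShortExact where
  exact := by
    rw [ShortComplex.exact_iff_exact_up_to_refinements]
    intro A x hx
    obtain ⟨l, hl⟩ := exists_lift_of_basis h𝔅 hf hfg x hx
    -- The lift exists on A itself, so no refinement by an epimorphism is needed.
    exact ⟨A, 𝟙 A, inferInstance, l, by rw [hl, Category.id_comp]⟩
  mono_f := mono_of_app_injective (app_injective_of_basis h𝔅 hf)
  epi_g := epi_of_basis h𝔅 hg

end Basis

/-! ### Differentials over affine open sets -/

section AffineDifferentials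

variable {X S : Scheme.{0}} (f : X ⟶ S)

/-- The differential `d b` in the presheaf of Kähler differentials. -/
def preD (U : X.Opens) : Γ(X, U) →+ (preDifferentials f).obj (op U) :=
  (PresheafOfModules.DifferentialsConstruction.derivation' (pulledBackIncl f)).d

lemma preD_mul (U : X.Opens) (a b : Γ(X, U)) :
    preD f U (a * b) = a • preD f U b + b • preD f U a :=
  (PresheafOfModules.DifferentialsConstruction.derivation' (pulledBackIncl f)).d_mul (X := op U) a b

lemma resP_preD {U V : X.Opens} (h : V ≤ U) (a : Γ(X, U)) :
    resP (preDifferentials f) h (preD f U a) = preD f V (resO h a) :=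
  ((PresheafOfModules.DifferentialsConstruction.derivation' (pulledBackIncl f)).d_map
    (homOfLE h).op a).symm

lemma preD_appLE (U : X.Opens) {V : S.Opens} (e : U ≤ f ⁻¹ᵁ V) (a : Γ(S, V)) :
    preD f U (f.appLE V U e a) = 0 :=
  PresheafOfModules.Derivation'.d_app
    (PresheafOfModules.DifferentialsConstruction.derivation' (pulledBackIncl f)) (X := op U)
    ⟨_, Subring.subset_closure ⟨V, e, a, rfl⟩⟩

lemma preD_span (U : X.Opens) : Submodule.span Γ(X, U) (Set.range (preD f U)) = ⊤ :=
  letI := ((pulledBackIncl f).app (op U)).hom.toAlgebra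
  KaehlerDifferential.span_range_derivation ((pulledBackPresheaf f).obj (op U)) Γ(X, U)

/-- An additive map `D` satisfying the Leibniz rule and vanishing on a subring factors through the
Kähler differentials. -/
lemma exists_kaehler_lift {C B N : Type*} [CommRing C] [CommRing B] [Algebra C B]
    [AddCommGroup N] [Module B N] (D : B →+ N) (hD : ∀ a b, D (a * b) = a • D b + b • D a)
    (hC : ∀ c : C, D (algebraMap C B c) = 0) :
    ∃ L : Ω[B⁄C] →ₗ[B] N, ∀ b, L (KaehlerDifferential.D C B b) = D b := by
  let : Module C N := Module.compHom N (algebraMap C B)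
  have : IsScalarTower C B N := IsScalarTower.of_algebraMap_smul fun _ _ => rfl
  let L : B →ₗ[C] N :=
    { toFun := D
      map_add' := map_add D
      map_smul' := fun c b => by
        rw [Algebra.smul_def, hD, hC, smul_zero, add_zero]
        rfl }
  let δ : Derivation C B N := Derivation.mk' L hD
  exact ⟨δ.liftKaehlerDifferential, fun b => δ.liftKaehlerDifferential_comp_D b⟩

lemma exists_pre_lift (U : X.Opens) {N : Type*} [AddCommGroup N] [Module Γ(X, U) N]
    (D : Γ(X, U) →+ N) (hD : ∀ a b, D (a * b) = a • D b + b • D a)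
    (hC : ∀ b ∈ pulledBackFunctions f U, D b = 0) :
    ∃ L : (preDifferentials f).obj (op U) →ₗ[Γ(X, U)] N, ∀ b, L (preD f U b) = D b := by
  let : Algebra (pulledBackFunctions f U) Γ(X, U) :=
    ((pulledBackIncl f).app (op U)).hom.toAlgebra
  exact exists_kaehler_lift (C := pulledBackFunctions f U) D hD fun c => hC c.1 c.2

section Relative

variable {f} {U : X.Opens} {W₀ : S.Opens} (e : U ≤ f ⁻¹ᵁ W₀)

/-- The Kähler differentials of `𝒪_X(U)` over `𝒪_S(W₀)`. -/
abbrev RelKaehler : Type :=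
  @KaehlerDifferential Γ(S, W₀) Γ(X, U) _ _ (f.appLE W₀ U e).hom.toAlgebra

/-- The universal derivation. -/
def relD : Γ(X, U) →+ RelKaehler e :=
  letI := (f.appLE W₀ U e).hom.toAlgebra
  (KaehlerDifferential.D Γ(S, W₀) Γ(X, U)).toLinearMap.toAddMonoidHom

lemma relD_mul (a b : Γ(X, U)) : relD e (a * b) = a • relD e b + b • relD e a :=
  letI := (f.appLE W₀ U e).hom.toAlgebra
  (KaehlerDifferential.D Γ(S, W₀) Γ(X, U)).leibniz a b

lemma relD_appLE (c : Γ(S, W₀)) : relD e (f.appLE W₀ U e c) = 0 :=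
  letI := (f.appLE W₀ U e).hom.toAlgebra
  (KaehlerDifferential.D Γ(S, W₀) Γ(X, U)).map_algebraMap c

lemma relD_span : Submodule.span Γ(X, U) (Set.range (relD e)) = ⊤ :=
  letI := (f.appLE W₀ U e).hom.toAlgebra
  KaehlerDifferential.span_range_derivation Γ(S, W₀) Γ(X, U)

lemma exists_rel_lift {N : Type*} [AddCommGroup N] [Module Γ(X, U) N]
    (D : Γ(X, U) →+ N) (hD : ∀ a b, D (a * b) = a • D b + b • D a)
    (hC : ∀ c, D (f.appLE W₀ U e c) = 0) :
    ∃ L : RelKaehler e →ₗ[Γ(X, U)] N, ∀ b, L (relD e b) = D b :=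
  letI := (f.appLE W₀ U e).hom.toAlgebra
  exists_kaehler_lift (C := Γ(S, W₀)) D hD hC

/-- Kähler differentials commute with localization, and 𝒪_X(D(r)) is the localization of 𝒪_X(U) at
r. The conclusion is spelled out in additive maps so that the algebra structures stay local to the
proof. -/
lemma exists_relRes (hU : IsAffineOpen U) (r : Γ(X, U)) :
    ∃ L : RelKaehler e →+ RelKaehler ((X.basicOpen_le r).trans e),
      (∀ a m, L (a • m) = resO (X.basicOpen_le r) a • L m) ∧
      (∀ a, L (relD e a) = relD _ (resO (X.basicOpen_le r) a)) ∧
      (∀ m, L m = 0 → ∃ n : ℕ, r ^ n • m = 0) ∧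
      ∀ m', ∃ (n : ℕ) (m : RelKaehler e), resO (X.basicOpen_le r) (r ^ n) • m' = L m := by
  let _ := (f.appLE W₀ U e).hom.toAlgebra
  let _ := (f.appLE W₀ (X.basicOpen r) ((X.basicOpen_le r).trans e)).hom.toAlgebra
  let : Algebra Γ(X, U) Γ(X, X.basicOpen r) := (resO (X.basicOpen_le r)).toAlgebra
  have hst : IsScalarTower Γ(S, W₀) Γ(X, U) Γ(X, X.basicOpen r) :=
    IsScalarTower.of_algebraMap_eq' (congrArg CommRingCat.Hom.hom
      (f.appLE_map e (homOfLE (X.basicOpen_le r)).op).symm)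
  have hloc : IsLocalization (Submonoid.powers r) Γ(X, X.basicOpen r) :=
    hU.isLocalization_basicOpen r
  let L := KaehlerDifferential.map Γ(S, W₀) Γ(S, W₀) Γ(X, U) Γ(X, X.basicOpen r)
  have hL : IsLocalizedModule (Submonoid.powers r) L := inferInstance
  refine ⟨L.toAddMonoidHom, fun a m => ?_, fun a => ?_, fun m hm => ?_, fun m' => ?_⟩
  · exact (L.map_smul a m).trans (algebraMap_smul _ _ _).symm
  · exact KaehlerDifferential.map_D _ _ _ _ a
  · obtain ⟨⟨_, n, rfl⟩, hn⟩ := (IsLocalizedModule.eq_zero_iff (Submonoid.powers r) L).1 hm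
    exact ⟨n, hn⟩
  · obtain ⟨⟨m, ⟨_, n, rfl⟩⟩, hm⟩ := IsLocalizedModule.surj (Submonoid.powers r) L m'
    exact ⟨n, m, (algebraMap_smul Γ(X, X.basicOpen r) (r ^ n) m').trans hm⟩

/-- A derivation over `𝒪_S(W₀)` vanishes on all functions pulled back from `S`. -/
lemma relD_eq_zero (hU : IsAffineOpen U) (hW₀ : IsAffineOpen W₀) {b : Γ(X, U)}
    (hb : b ∈ pulledBackFunctions f U) : relD e b = 0 := by
  induction hb using Subring.closure_induction with
  | mem b hb =>
    obtain ⟨V, e', a, rfl⟩ := hb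
    refine eq_zero_of_forall_smul_eq_zero hU _ fun x hx => ?_
    -- Near the image of x the function a on V is a fraction c / r of functions on the affine set
    -- W₀, whose differentials vanish by construction.
    obtain ⟨r, c, V', e'', hxV', hxr, hrc⟩ := exists_mul_resO_eq hW₀
      (inf_le_left : W₀ ⊓ V ≤ W₀) ⟨e hx, e' hx⟩ (resO inf_le_right a)
    obtain ⟨g, hxg, hgV'⟩ := exists_basicOpen_le_of_mem hU
      (show U ⊓ f ⁻¹ᵁ V' ≤ U from inf_le_left) ⟨hx, hxV'⟩
    have hgV : X.basicOpen g ≤ f ⁻¹ᵁ V' := hgV'.trans inf_le_right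
    have key : resO (X.basicOpen_le g) (f.appLE W₀ U e r * f.appLE V U e' a) =
        resO (X.basicOpen_le g) (f.appLE W₀ U e c) := by
      have h1 := congrArg (f.appLE V' (X.basicOpen g) hgV) hrc
      have hmap : ∀ {W : S.Opens} (hW : V' ≤ W) (i : U ≤ f ⁻¹ᵁ W) (z : Γ(S, W)),
          f.appLE V' (X.basicOpen g) hgV (resO hW z) = resO (X.basicOpen_le g) (f.appLE W U i z) :=
        fun hW i z => by
          have h2 := f.map_appLE hgV (homOfLE hW).op
          have h3 := f.appLE_map i (homOfLE (X.basicOpen_le g)).op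
          exact (congr($h2 z)).trans (congr($h3 z)).symm
      rw [map_mul, map_mul, resO_resO, resO_resO, hmap _ e, hmap _ e', hmap _ e] at h1
      rw [map_mul]
      exact h1
    have := hU.isLocalization_basicOpen g
    obtain ⟨⟨_, n, rfl⟩, hn⟩ := (IsLocalization.eq_iff_exists (Submonoid.powers g)
      Γ(X, X.basicOpen g)).1 key
    have hn' : g ^ n * (f.appLE W₀ U e r * f.appLE V U e' a) = g ^ n * f.appLE W₀ U e c := hn
    -- Write b for the pullback of a. Differentiating g^n · r b = g^n · c, with r and c constant,
    -- and multiplying by g^(n+2) makes the terms in d(g^n) cancel, because g^n r b = g^n c. What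
    -- remains is g^(2n+2) r db = 0, and g^(2n+2) r does not vanish at x.
    refine ⟨(g ^ (n + 1)) ^ 2 * f.appLE W₀ U e r, ?_, ?_⟩
    · rw [Scheme.basicOpen_mul, Scheme.basicOpen_pow _ _ two_pos,
        Scheme.basicOpen_pow _ _ (Nat.succ_pos n)]
      refine ⟨hxg, ?_⟩
      have : X.basicOpen (f.appLE W₀ U e r) = U ⊓ f ⁻¹ᵁ S.basicOpen r := by
        rw [Scheme.basicOpen_appLE]
      rw [this]
      exact ⟨hx, hxr⟩
    · have h1 := congrArg (relD e) hn'
      rw [relD_mul, relD_mul, relD_mul, relD_appLE, relD_appLE, smul_zero, smul_zero, add_zero,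
        zero_add] at h1
      have h2 := congrArg (fun z => g ^ (n + 2) • z) h1
      simp only [smul_add, smul_smul] at h2
      have h3 : (g ^ (n + 2) * (f.appLE W₀ U e r * f.appLE V U e' a)) • relD e (g ^ n) =
          (g ^ (n + 2) * f.appLE W₀ U e c) • relD e (g ^ n) := by
        rw [pow_add, mul_right_comm, hn', mul_right_comm]
      rw [h3] at h2
      have h4 := add_right_cancel (h2.trans (zero_add _).symm)
      rw [← h4]
      congr 1
      ring
  | zero => exact map_zero _
  | one =>
    have := relD_appLE e 1
    rwa [map_one] at this
  | add a b _ _ ha hb => rw [map_add, ha, hb, add_zero]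
  | neg a _ ha => rw [map_neg, ha, neg_zero]
  | mul a b _ _ ha hb => rw [relD_mul, ha, hb, smul_zero, smul_zero, add_zero]

end Relative

end AffineDifferentials

/-! ### Sections of the sheaf of differentials over affine open sets -/

section AffineDifferentials

lemma addMonoidHom_eq_of_span {R R' A B : Type*} [CommRing R] [CommRing R'] [AddCommGroup A]
    [Module R A] [AddCommGroup B] [Module R' B] (σ : R →+* R') {s : Set A}
    (hs : Submodule.span R s = ⊤) {F G : A →+ B} (hF : ∀ r a, F (r • a) = σ r • F a)
    (hG : ∀ r a, G (r • a) = σ r • G a) (h : ∀ a ∈ s, F a = G a) (a : A) : F a = G a := by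
  have ha : a ∈ Submodule.span R s := hs ▸ Submodule.mem_top
  induction ha using Submodule.span_induction with
  | mem a ha => exact h a ha
  | zero => rw [map_zero, map_zero]
  | add a b _ _ ha hb => rw [map_add, map_add, ha, hb]
  | smul r a _ ha => rw [hF, hG, ha]

lemma exists_linearMap_comp_eq {R A B N : Type*} [CommRing R] [AddCommGroup A] [Module R A]
    [AddCommGroup B] [Module R B] [AddCommGroup N] [Module R N] (t : A →+ B)
    (ht : ∀ (r : R) a, t (r • a) = r • t a) (hb : Function.Bijective t) (L : A →ₗ[R] N) :
    ∃ L' : B →ₗ[R] N, ∀ a, L' (t a) = L a := by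
  let E : A ≃ₗ[R] B := LinearEquiv.ofBijective ⟨⟨t, map_add t⟩, ht⟩ hb
  exact ⟨L ∘ₗ E.symm.toLinearMap, fun a => congrArg L (E.symm_apply_apply a)⟩

variable {X S : Scheme.{0}} (f : X ⟶ S) {U : X.Opens} {W₀ : S.Opens} (e : U ≤ f ⁻¹ᵁ W₀)

lemma mem_basicOpen_pow_succ {U : X.Opens} {r : Γ(X, U)} {x : X} (hx : x ∈ X.basicOpen r) (n : ℕ) :
    x ∈ X.basicOpen (r ^ (n + 1)) := by
  rw [Scheme.basicOpen_pow _ _ (Nat.succ_pos n)]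
  exact hx

/-- The presheaf divides out the differentials of all functions pulled back from S, not only of
those from W₀, so there is a comparison map; it is onto because both sides are generated by
differentials of functions. -/
lemma exists_relToPre : ∃ j : RelKaehler e →ₗ[Γ(X, U)] (preDifferentials f).obj (op U),
    (∀ b, j (relD e b) = preD f U b) ∧ Function.Surjective j := by
  obtain ⟨j, hj⟩ := exists_rel_lift e (N := (preDifferentials f).obj (op U)) (preD f U)
    (preD_mul f U) (preD_appLE f U e)
  refine ⟨j, hj, LinearMap.range_eq_top.1 (top_le_iff.1 ?_)⟩
  rw [← preD_span, Submodule.span_le]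
  rintro _ ⟨b, rfl⟩
  exact ⟨_, hj b⟩

/-- Differentials over 𝒪_S(W₀) localize well (`exists_relRes`), and on an affine open set over W₀
they embed in the presheaf, since by `relD_eq_zero` their universal derivation already kills every
pulled-back function. -/
lemma isGermLocalization_preDifferentials (hU : IsAffineOpen U) (hW₀ : IsAffineOpen W₀)
    (j : RelKaehler e →ₗ[Γ(X, U)] (preDifferentials f).obj (op U))
    (hj : ∀ b, j (relD e b) = preD f U b) :
    IsGermLocalization (preDifferentials f) (RingEquiv.refl Γ(X, U)) j.toAddMonoidHom := by
  have hjr (r : Γ(X, U)) (L : RelKaehler e →+ RelKaehler ((X.basicOpen_le r).trans e))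
      (hL1 : ∀ a m, L (a • m) = resO (X.basicOpen_le r) a • L m)
      (hL2 : ∀ a, L (relD e a) = relD _ (resO (X.basicOpen_le r) a))
      (j' : RelKaehler ((X.basicOpen_le r).trans e) →ₗ[Γ(X, X.basicOpen r)]
        (preDifferentials f).obj (op (X.basicOpen r))) (hj' : ∀ b, j' (relD _ b) = preD f _ b)
      (m : RelKaehler e) : resP (preDifferentials f) (X.basicOpen_le r) (j m) = j' (L m) := by
    refine addMonoidHom_eq_of_span (resO (X.basicOpen_le r)) (relD_span e)
      (F := (resP (preDifferentials f) (X.basicOpen_le r)).comp j.toAddMonoidHom)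
      (G := j'.toAddMonoidHom.comp L) (fun a m => ?_) (fun a m => ?_) ?_ m
    · refine (congrArg (resP (preDifferentials f) (X.basicOpen_le r)) (j.map_smul a m)).trans ?_
      exact resP_smul _ _ _ _
    · exact (congrArg j' (hL1 a m)).trans (j'.map_smul _ _)
    · rintro _ ⟨b, rfl⟩
      refine (congrArg (resP (preDifferentials f) (X.basicOpen_le r)) (hj b)).trans ?_
      refine (resP_preD f _ _).trans ((hj' _).symm.trans ?_)
      exact congrArg j' (hL2 b).symm
  refine ⟨fun r a => j.map_smul r a, fun W h x hx a ha => ?_, fun W h x hx m => ?_⟩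
  · obtain ⟨r, hxr, hrW⟩ := exists_basicOpen_le_of_mem hU h hx
    obtain ⟨L, hL1, hL2, hL3, -⟩ := exists_relRes e hU r
    obtain ⟨j', hj', -⟩ := exists_relToPre f ((X.basicOpen_le r).trans e)
    -- k is a left inverse of the comparison map j' on D(r), so a section killed by restriction is
    -- already zero in the localized Kähler module.
    obtain ⟨k, hk⟩ := exists_pre_lift f (X.basicOpen r) (relD ((X.basicOpen_le r).trans e))
      (relD_mul _) fun b hb => relD_eq_zero _ (hU.basicOpen r) hW₀ hb
    have hkj (m) : k (j' m) = m := by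
      refine addMonoidHom_eq_of_span (RingHom.id _) (relD_span ((X.basicOpen_le r).trans e))
        (F := k.toAddMonoidHom.comp j'.toAddMonoidHom)
        (G := AddMonoidHom.id _) (fun a m => ?_) (fun a m => rfl) ?_ m
      · exact (congrArg k (j'.map_smul a m)).trans (k.map_smul _ _)
      · rintro _ ⟨b, rfl⟩
        exact (congrArg k (hj' b)).trans (hk b)
    have h0 : L a = 0 := by
      have h1 := hjr r L hL1 hL2 j' hj' a
      have h2 : resP (preDifferentials f) (X.basicOpen_le r) (j a) = 0 := by
        refine (resP_resP (preDifferentials f) h hrW (j a)).symm.trans ?_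
        exact (congrArg (resP (preDifferentials f) hrW) ha).trans (map_zero _)
      rw [← hkj (L a)]
      exact (congrArg k (h1.symm.trans h2)).trans (map_zero k)
    obtain ⟨n, hn⟩ := hL3 a h0
    exact ⟨r ^ (n + 1), mem_basicOpen_pow_succ hxr n, by rw [pow_succ', mul_smul, hn, smul_zero]⟩
  · obtain ⟨r, hxr, hrW⟩ := exists_basicOpen_le_of_mem hU h hx
    obtain ⟨L, hL1, hL2, -, hL4⟩ := exists_relRes e hU r
    obtain ⟨j', hj', hjs⟩ := exists_relToPre f ((X.basicOpen_le r).trans e)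
    obtain ⟨m', hm'⟩ := hjs (resP (preDifferentials f) hrW m)
    obtain ⟨n, a, hna⟩ := hL4 m'
    refine ⟨r ^ (n + 1), r • a, X.basicOpen r, hrW, hxr, mem_basicOpen_pow_succ hxr n, ?_⟩
    refine (resP_smul _ _ _ _).trans ?_
    refine Eq.trans ?_ (hjr r L hL1 hL2 j' hj' (r • a)).symm
    rw [hL1, ← hna, smul_smul, ← map_mul, ← pow_succ']
    refine Eq.trans ?_ (j'.map_smul _ _).symm
    rw [hm', resO_resO]
    rfl

lemma isGermLocalizing_preDifferentials (hU : IsAffineOpen U) (hW₀ : IsAffineOpen W₀) 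
    (e : U ≤ f ⁻¹ᵁ W₀) : IsGermLocalizing (preDifferentials f) U := by
  obtain ⟨j, hj, hjs⟩ := exists_relToPre f e
  exact (isGermLocalization_preDifferentials f e hU hW₀ j hj).isGermLocalizing hjs

/-- The sheaf of differentials is quasi-coherent on affine open sets lying over affine open sets. -/
lemma isGermLocalizing_differentials (hU : IsAffineOpen U) (hW₀ : IsAffineOpen W₀) 
    (e : U ≤ f ⁻¹ᵁ W₀) : IsGermLocalizing (differentials f).val U :=
  (isGermLocalizing_preDifferentials f hU hW₀ e).sheafify hU

lemma toSheafify_preDifferentials_bijective (hU : IsAffineOpen U) (hW₀ : IsAffineOpen W₀) 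
    (e : U ≤ f ⁻¹ᵁ W₀) : Function.Bijective (toSheafify (preDifferentials f) U) :=
  (isGermLocalizing_preDifferentials f hU hW₀ e).toSheafify_bijective hU

/-- The differentials on an affine open set lying over an affine open set are generated by the
`db`. -/
lemma d_span (hU : IsAffineOpen U) (hW₀ : IsAffineOpen W₀) (e : U ≤ f ⁻¹ᵁ W₀) :
    Submodule.span Γ(X, U) (Set.range (d f U)) = ⊤ := by
  refine Submodule.eq_top_iff'.2 fun m => ?_
  obtain ⟨m, rfl⟩ := (toSheafify_preDifferentials_bijective f hU hW₀ e).2 m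
  have hm : m ∈ Submodule.span Γ(X, U) (Set.range (preD f U)) := by
    rw [preD_span]; exact Submodule.mem_top
  induction hm using Submodule.span_induction with
  | mem m hm =>
    obtain ⟨b, rfl⟩ := hm
    exact Submodule.subset_span ⟨b, rfl⟩
  | zero =>
    rw [map_zero]
    exact Submodule.zero_mem _
  | add a b _ _ ha hb =>
    rw [map_add]
    exact Submodule.add_mem _ ha hb
  | smul r a _ ha =>
    have := toSheafify_smul' (preDifferentials f) U r a
    exact this ▸ Submodule.smul_mem _ r ha

/-- The universal property of the differentials on an affine open set lying over an affine open
set. -/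
lemma exists_d_lift (hU : IsAffineOpen U) (hW₀ : IsAffineOpen W₀) (e : U ≤ f ⁻¹ᵁ W₀)
    {N : Type*} [AddCommGroup N] [Module Γ(X, U) N] (D : Γ(X, U) →+ N)
    (hD : ∀ a b, D (a * b) = a • D b + b • D a) (hC : ∀ c, D (f.appLE W₀ U e c) = 0) :
    ∃ L : Γ(differentials f, U) →ₗ[Γ(X, U)] N, ∀ b, L (d f U b) = D b := by
  obtain ⟨L₀, hL₀⟩ := exists_rel_lift e D hD hC
  obtain ⟨L₁, hL₁⟩ := exists_pre_lift f U D hD fun b hb => by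
    rw [← hL₀, relD_eq_zero e hU hW₀ hb, map_zero]
  obtain ⟨L, hL⟩ := exists_linearMap_comp_eq (toSheafify (preDifferentials f) U)
    (toSheafify_smul' _ U) (toSheafify_preDifferentials_bijective f hU hW₀ e) L₁
  exact ⟨L, fun b => (hL _).trans (hL₁ b)⟩

end AffineDifferentials

/-! ### The characteristic space over affine open sets -/

section CharSpace

lemma fromSpec_appLE_self {X : Scheme.{0}} {U : X.Opens} (hU : IsAffineOpen U) :
    hU.fromSpec.appLE U ⊤ hU.fromSpec_preimage_self.ge = (Scheme.ΓSpecIso Γ(X, U)).inv := by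
  rw [Scheme.Hom.appLE, hU.fromSpec_app_self, Category.assoc]
  refine Eq.trans ?_ (Category.comp_id _)
  congr 1

lemma fromSpec_comp_appLE {X : Scheme.{0}} {U : X.Opens} (hU : IsAffineOpen U) {A : CommRingCat}
    (f : Γ(X, U) ⟶ A) (e : ⊤ ≤ (Spec.map f ≫ hU.fromSpec) ⁻¹ᵁ U) :
    (Spec.map f ≫ hU.fromSpec).appLE U ⊤ e =
      (Scheme.ΓSpecIso Γ(X, U)).inv ≫ (Spec.map f).appTop := by
  rw [← fromSpec_appLE_self hU, Scheme.Hom.appTop, Scheme.Hom.app_eq_appLE]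
  exact (Scheme.Hom.appLE_comp_appLE _ _ _ _ _ _ _).symm

variable {X : Scheme.{0}} [IsIntegral X] (Λ : AddSubgroup (CartierDivisor X))

lemma charChart_charProj (U : X.affineOpens) :
    charChart Λ U ≫ charProj Λ =
      Spec.map (CommRingCat.ofHom (coxAlgebraMap Λ U.1)) ≫ U.2.fromSpec :=
  Limits.colimit.ι_desc _ _

lemma specMap_charChart {U V : X.affineOpens} (h : V.1 ≤ U.1)
    (hUV : ∃ r : Γ(X, U.1), X.basicOpen r = V.1) :
    Spec.map (CommRingCat.ofHom (coxRestrict Λ h)) ≫ charChart Λ U = charChart Λ V :=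
  Limits.colimit.w (charSpaceGlueData Λ).functor
    (show (show X.AffineZariskiSite from V) ⟶ (show X.AffineZariskiSite from U) from ⟨⟨hUV⟩⟩)

lemma charProj_preimage_isAffineOpen {U : X.Opens} (hU : IsAffineOpen U) :
    IsAffineOpen (charProj Λ ⁻¹ᵁ U) := by
  rw [charProj_preimage Λ ⟨U, hU⟩]
  exact (isAffineOpen_top _).image_of_isOpenImmersion _

lemma coxFunction_bijective (U : X.affineOpens) : Function.Bijective (coxFunction Λ U) := by
  have : IsIso ((Scheme.ΓSpecIso (.of (CoxRing Λ U.1))).inv ≫ ((charChart Λ U).appIso ⊤).inv ≫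
    (charSpace Λ).presheaf.map (eqToHom (charProj_preimage Λ U)).op) := inferInstance
  exact ConcreteCategory.bijective_of_isIso _

lemma top_le_charChart_preimage (U : X.affineOpens) :
    ⊤ ≤ charChart Λ U ⁻¹ᵁ (charProj Λ ⁻¹ᵁ U.1) := by
  rw [charProj_preimage, Scheme.Hom.preimage_image_eq]

/-- On the chart Spec 𝒮̂_Λ(U) the function `coxFunction Λ U F` is F itself. Together with the
injectivity of this evaluation it reduces identities between functions on π⁻¹U to identities in the
Cox ring. -/
lemma charChart_appLE_coxFunction (U : X.affineOpens) (F : CoxRing Λ U.1) :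
    (charChart Λ U).appLE (charProj Λ ⁻¹ᵁ U.1) ⊤ (top_le_charChart_preimage Λ U)
      (coxFunction Λ U F) = (Scheme.ΓSpecIso (.of (CoxRing Λ U.1))).inv F := by
  have : ((Scheme.ΓSpecIso (.of (CoxRing Λ U.1))).inv ≫ ((charChart Λ U).appIso ⊤).inv ≫
    (charSpace Λ).presheaf.map (eqToHom (charProj_preimage Λ U)).op) ≫
      (charChart Λ U).appLE (charProj Λ ⁻¹ᵁ U.1) ⊤ (top_le_charChart_preimage Λ U) =
      (Scheme.ΓSpecIso (.of (CoxRing Λ U.1))).inv := by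
    rw [Category.assoc, Category.assoc, Scheme.Hom.map_appLE, Scheme.Hom.appIso_inv_appLE]
    refine Eq.trans ?_ (Category.comp_id _)
    congr 1
  exact congr($this F)

lemma charChart_appLE_injective (U : X.affineOpens) :
    Function.Injective ((charChart Λ U).appLE (charProj Λ ⁻¹ᵁ U.1) ⊤
      (top_le_charChart_preimage Λ U)) := by
  intro a b h
  obtain ⟨F, rfl⟩ := (coxFunction_bijective Λ U).2 a
  obtain ⟨G, rfl⟩ := (coxFunction_bijective Λ U).2 b
  rw [charChart_appLE_coxFunction, charChart_appLE_coxFunction] at h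
  exact congrArg _ ((ConcreteCategory.bijective_of_isIso
    (Scheme.ΓSpecIso (.of (CoxRing Λ U.1))).inv).1 h)

/-- The composition with the inclusion of functions on `X` is the comorphism of the projection. -/
lemma coxFunction_coxAlgebraMap (U : X.affineOpens) (a : Γ(X, U.1)) :
    coxFunction Λ U (coxAlgebraMap Λ U.1 a) = (charProj Λ).app U.1 a := by
  refine charChart_appLE_injective Λ U ?_
  rw [charChart_appLE_coxFunction]
  have h1 : (charProj Λ).app U.1 ≫ (charChart Λ U).appLE (charProj Λ ⁻¹ᵁ U.1) ⊤
      (top_le_charChart_preimage Λ U) = CommRingCat.ofHom (coxAlgebraMap Λ U.1) ≫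
        (Scheme.ΓSpecIso (.of (CoxRing Λ U.1))).inv := by
    rw [Scheme.Hom.app_eq_appLE, Scheme.Hom.appLE_comp_appLE, Scheme.ΓSpecIso_inv_naturality]
    -- The morphism is generalized so that it can be replaced by an equal one, although the
    -- inclusion of open sets in `appLE` depends on it.
    have h2 : ∀ (g : Spec (.of (CoxRing Λ U.1)) ⟶ X) (hg : g = Spec.map (CommRingCat.ofHom
        (coxAlgebraMap Λ U.1)) ≫ U.2.fromSpec) (e : ⊤ ≤ g ⁻¹ᵁ U.1), g.appLE U.1 ⊤ e =
        (Scheme.ΓSpecIso Γ(X, U.1)).inv ≫ (Spec.map (CommRingCat.ofHom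
          (coxAlgebraMap Λ U.1))).appTop := by
      rintro _ rfl e
      exact fromSpec_comp_appLE U.2 _ e
    exact h2 _ (charChart_charProj Λ U) _
  exact congr($h1 a).symm

lemma coxRestrict_coxRestrict {U V W : X.Opens} (h : V ≤ U) (h' : W ≤ V) (F : CoxRing Λ U) :
    coxRestrict Λ h' (coxRestrict Λ h F) = coxRestrict Λ (h'.trans h) F := rfl

/-- The gluing diagram has arrows only for inclusions of basic open sets; for these, compatibility
with restriction is the cocone relation of the charts. -/
lemma resO_coxFunction_of_basicOpen {U V : X.affineOpens} (h : V.1 ≤ U.1)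
    (hUV : ∃ r : Γ(X, U.1), X.basicOpen r = V.1) (F : CoxRing Λ U.1) :
    resO ((charProj Λ).preimage_mono h) (coxFunction Λ U F) =
      coxFunction Λ V (coxRestrict Λ h F) := by
  refine charChart_appLE_injective Λ V ?_
  rw [charChart_appLE_coxFunction]
  have h1 := (charChart Λ V).map_appLE (top_le_charChart_preimage Λ V)
    (homOfLE ((charProj Λ).preimage_mono h)).op
  refine congr($h1 (coxFunction Λ U F)).trans ?_
  have h2 : ∀ (g : Spec (.of (CoxRing Λ V.1)) ⟶ charSpace Λ) (hg : g = Spec.map (CommRingCat.ofHom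
        (coxRestrict Λ h)) ≫ charChart Λ U) (e : ⊤ ≤ g ⁻¹ᵁ (charProj Λ ⁻¹ᵁ U.1)),
        g.appLE (charProj Λ ⁻¹ᵁ U.1) ⊤ e = (charChart Λ U).appLE (charProj Λ ⁻¹ᵁ U.1) ⊤
          (top_le_charChart_preimage Λ U) ≫ (Spec.map (CommRingCat.ofHom
          (coxRestrict Λ h))).appTop := by
    rintro _ rfl e
    rw [← Scheme.Hom.appLE_comp_appLE (V := ⊤) (e₁ := top_le_charChart_preimage Λ U)
        (e₂ := le_top), Scheme.Hom.appTop, Scheme.Hom.app_eq_appLE]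
    rfl
  refine congr($(h2 _ (specMap_charChart Λ h hUV).symm _) (coxFunction Λ U F)).trans ?_
  refine (congrArg (Spec.map (CommRingCat.ofHom (coxRestrict Λ h))).appTop
    (charChart_appLE_coxFunction Λ U F)).trans ?_
  exact congr($(Scheme.ΓSpecIso_inv_naturality (CommRingCat.ofHom (coxRestrict Λ h))) F).symm

/-- The functions defined by sections of the Cox sheaf are compatible with restriction. -/
lemma resO_coxFunction {U V : X.affineOpens} (h : V.1 ≤ U.1) (F : CoxRing Λ U.1) :
    resO ((charProj Λ).preimage_mono h) (coxFunction Λ U F) =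
      coxFunction Λ V (coxRestrict Λ h F) := by
  -- V is covered by open sets that are basic in U and in V at once, and the case of a basic open
  -- set applies twice.
  refine TopCat.Sheaf.eq_of_locally_eq' (charSpace Λ).sheaf
    (fun W : {W : X.affineOpens // W.1 ≤ V.1 ∧ (∃ r : Γ(X, U.1), X.basicOpen r = W.1) ∧
      ∃ r : Γ(X, V.1), X.basicOpen r = W.1} => charProj Λ ⁻¹ᵁ W.1.1) _
    (fun W => homOfLE ((charProj Λ).preimage_mono W.2.1)) (fun x hx => ?_) _ _ fun W => ?_
  · obtain ⟨f, g, hfg, hxf⟩ := exists_basicOpen_le_affine_inter U.2 V.2 (charProj Λ x) ⟨h hx, hx⟩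
    refine Opens.mem_iSup.2 ⟨⟨⟨X.basicOpen g, V.2.basicOpen g⟩, X.basicOpen_le g, ⟨f, hfg⟩,
      ⟨g, rfl⟩⟩, ?_⟩
    change charProj Λ x ∈ X.basicOpen g
    rw [← hfg]
    exact hxf
  · refine Eq.trans ?_ (resO_coxFunction_of_basicOpen Λ W.2.1 W.2.2.2 _).symm
    rw [coxRestrict_coxRestrict]
    refine Eq.trans ?_ (resO_coxFunction_of_basicOpen Λ (W.2.1.trans h) W.2.2.1 F)
    exact resO_resO ((charProj Λ).preimage_mono h) ((charProj Λ).preimage_mono W.2.1) _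

/-- The isomorphism of the ring of sections of the Cox sheaf with the ring of functions on the
inverse image. -/
def coxFunctionEquiv {U : X.Opens} (hU : IsAffineOpen U) :
    CoxRing Λ U ≃+* Γ(charSpace Λ, charProj Λ ⁻¹ᵁ U) :=
  RingEquiv.ofBijective (coxFunction Λ ⟨U, hU⟩) (coxFunction_bijective Λ ⟨U, hU⟩)

end CharSpace

/-! ### Local structure of the Cox sheaf -/

section Laurent

variable {X : Scheme.{0}} [IsIntegral X] {Λ : AddSubgroup (CartierDivisor X)}

lemma CoxRing.ext {V : X.Opens} {F G : CoxRing Λ V}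
    (h : ∀ (x : V) (l : Λ), (F.1 x).coeff l = (G.1 x).coeff l) : F = G :=
  Subtype.ext (funext fun x => AddMonoidAlgebra.coeff_injective (Finsupp.ext fun l => h x l))

lemma CoxRing.coeff_smul {V : X.Opens} (b : Γ(X, V)) (F : CoxRing Λ V) (x : V) (l : Λ) :
    ((b • F).1 x).coeff l = toRational V x b * (F.1 x).coeff l := by
  change (AddMonoidAlgebra.single (0 : Λ) (toRational V x b) * F.1 x).coeff l = _
  rw [AddMonoidAlgebra.coeff_single_zero_mul]

lemma CoxRing.coeff_add {V : X.Opens} (F G : CoxRing Λ V) (x : V) (l : Λ) :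
    ((F + G).1 x).coeff l = (F.1 x).coeff l + (G.1 x).coeff l := by
  change (F.1 x + G.1 x).coeff l = _
  rw [AddMonoidAlgebra.coeff_add, Finsupp.add_apply]

lemma coeff_coxMonomial [DecidableEq Λ] (l : Λ) (V : X.Opens) (h : X.functionField)
    (hh : ∀ x : V, IsRegularAt l.1 x.1 h) (x : V) (m : Λ) :
    ((coxMonomial Λ l V h hh).1 x).coeff m = if l = m then h else 0 := by
  change (AddMonoidAlgebra.single l h).coeff m = _
  rw [AddMonoidAlgebra.coeff_single, Finsupp.single_apply]

lemma coxRestrict_smul {U V : X.Opens} (e : V ≤ U) (a : Γ(X, U)) (F : CoxRing Λ U) :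
    coxRestrict Λ e (a • F) = resO e a • coxRestrict Λ e F := by
  rw [Algebra.smul_def, Algebra.smul_def, map_mul]
  exact congrArg (· * coxRestrict Λ e F) (coxRestrict_algebraMap Λ (homOfLE e) a)

variable (T : LocalEquations Λ) (i : T.Idx) {V : X.Opens} (hV : V ≤ T.opens i)

lemma generator_zero : generator T i 0 V hV = 1 := by
  refine Subtype.ext (funext fun x => ?_)
  change AddMonoidAlgebra.single (0 : Λ) _ = (1 : AddMonoidAlgebra X.functionField Λ)
  rw [AddMonoidAlgebra.one_def, ofAdd_zero, map_one, inv_one, Units.val_one]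

lemma generator_add (l m : Λ) :
    generator T i (l + m) V hV = generator T i l V hV * generator T i m V hV := by
  refine Subtype.ext (funext fun x => ?_)
  change AddMonoidAlgebra.single (l + m) _ =
    (AddMonoidAlgebra.single l _ * AddMonoidAlgebra.single m _ :
      AddMonoidAlgebra X.functionField Λ)
  rw [AddMonoidAlgebra.single_mul_single, ofAdd_add, map_mul, mul_inv, Units.val_mul]

lemma coxRestrict_generator (l : Λ) {W : X.Opens} (h : W ≤ V) :
    coxRestrict Λ h (generator T i l V hV) = generator T i l W (h.trans hV) := rfl

lemma coeff_linearCombination_generator (b : Λ →₀ Γ(X, V)) (x : V) (l : Λ) :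
    ((Finsupp.linearCombination Γ(X, V) (fun l => generator T i l V hV) b).1 x).coeff l =
      toRational V x (b l) * ((T.eqn i (.ofAdd l))⁻¹ : X.functionFieldˣ) := by
  classical
  induction b using Finsupp.induction_linear with
  | zero =>
    rw [map_zero, Finsupp.zero_apply, map_zero, zero_mul]
    rfl
  | add b c hb hc =>
    rw [map_add, CoxRing.coeff_add, hb, hc, Finsupp.add_apply, map_add, add_mul]
  | single m b =>
    rw [Finsupp.linearCombination_single, CoxRing.coeff_smul, generator, coeff_coxMonomial,
      Finsupp.single_apply]
    split_ifs with h
    · rw [h]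
    · rw [map_zero, mul_zero, zero_mul]

lemma linearCombination_generator_injective :
    Function.Injective (Finsupp.linearCombination Γ(X, V) fun l => generator T i l V hV) := by
  intro b c h
  refine Finsupp.ext fun l => eq_of_toRational fun x => ?_
  have h1 := coeff_linearCombination_generator T i hV b x l
  have h2 := coeff_linearCombination_generator T i hV c x l
  rw [h, h2] at h1
  exact (mul_left_injective₀ (Units.ne_zero _) h1).symm

/-- A coefficient h of degree λ is a section of 𝒪_X(D_λ), so h f_i^λ is regular on V, and it is the
coefficient of (f_i^λ)⁻¹. -/
lemma linearCombination_generator_surjective :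
    Function.Surjective (Finsupp.linearCombination Γ(X, V) fun l => generator T i l V hV) := by
  intro F
  obtain ⟨⟨F₀, hF₀⟩, hF⟩ := F.2
  have key (l : Λ) := exists_section V (F₀.coeff l * T.eqn i (.ofAdd l)) fun x =>
    (isRegularAt_iff (T.eqn_spec i l x.1 (hV x.2))).1 (hF₀ x ▸ hF x l)
  choose b hb using key
  -- A point of V is needed to see that the coefficients vanish outside the support of F₀; over the
  -- empty set the Cox ring has only one element.
  by_cases hne : Nonempty {x // x ∈ V}
  · obtain ⟨y⟩ := hne
    refine ⟨Finsupp.onFinset F₀.coeff.support b fun l hl => Finsupp.mem_support_iff.2 fun h0 =>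
      hl (toRational_injective V y (by rw [hb, h0, zero_mul, map_zero])), CoxRing.ext fun x l => ?_⟩
    rw [coeff_linearCombination_generator, Finsupp.onFinset_apply, hb, mul_assoc, Units.mul_inv,
      mul_one, hF₀]
  · exact ⟨0, CoxRing.ext fun x => (hne ⟨x⟩).elim⟩

/-- The generators `(f_i^λ)⁻¹` form a basis of the Cox sheaf over open subsets of `U_i`. -/
def generatorBasis : Module.Basis Λ Γ(X, V) (CoxRing Λ V) :=
  .ofRepr (LinearEquiv.ofBijective _ ⟨linearCombination_generator_injective T i hV,
    linearCombination_generator_surjective T i hV⟩).symm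

@[simp] lemma generatorBasis_apply (l : Λ) :
    generatorBasis T i hV l = generator T i l V hV := by
  refine (congrArg (LinearEquiv.ofBijective _ ⟨linearCombination_generator_injective T i hV,
    linearCombination_generator_surjective T i hV⟩) ?_).trans
    ((Finsupp.linearCombination_single Γ(X, V) 1 l).trans (one_smul _ _))
  rfl

/-- In the basis of generators only the coefficient of degree l survives, so 𝒪_X(D_λ) is free of
rank one over V. -/
lemma mem_coxDegree_iff {F : CoxRing Λ V} {l : Λ} :
    F ∈ coxDegree Λ l V ↔ ∃ b : Γ(X, V), F = b • generator T i l V hV := by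
  classical
  constructor
  · intro hF
    obtain ⟨b, rfl⟩ := linearCombination_generator_surjective T i hV F
    refine ⟨b l, CoxRing.ext fun x m => ?_⟩
    rw [CoxRing.coeff_smul, generator, coeff_coxMonomial]
    split_ifs with h
    · rw [coeff_linearCombination_generator, h]
    · rw [mul_zero]
      exact hF x m (Ne.symm h)
  · rintro ⟨b, rfl⟩ x m hm
    rw [CoxRing.coeff_smul, generator, coeff_coxMonomial, if_neg hm.symm, mul_zero]

lemma coxMonomial_eq_smul_generator (l : Λ) (h : X.functionField)
    (hh : ∀ x : V, IsRegularAt l.1 x.1 h) (s : Γ(X, V))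
    (hs : ∀ x : V, toRational V x s = h * (T.eqn i (.ofAdd l) : X.functionField)) :
    coxMonomial Λ l V h hh = s • generator T i l V hV := by
  classical
  refine CoxRing.ext fun x m => ?_
  rw [CoxRing.coeff_smul, generator, coeff_coxMonomial, coeff_coxMonomial, hs]
  split_ifs
  · rw [mul_assoc, Units.mul_inv, mul_one]
  · rw [mul_zero]

/-- This is (f_i^λ)⁻¹ = (f_j^λ / f_i^λ) (f_j^λ)⁻¹. -/
lemma generator_eq_transition_smul (j : T.Idx) (hV' : V ≤ T.opens j) (l : Λ) :
    generator T i l V hV =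
      (transition T i j V (le_inf hV hV') (.ofAdd l) : Γ(X, V)) • generator T j l V hV' := by
  refine coxMonomial_eq_smul_generator T j hV' l _ _ _ fun x => ?_
  rw [toRational_transition, ← Units.val_mul, div_eq_inv_mul]

end Laurent

/-! ### Germs of sections as fractions -/

section GermFraction

variable {X : Scheme.{0}} {P : X.PresheafOfModules} {U : X.Opens} {R A : Type*} [CommRing R]
    [AddCommGroup A] [Module R A]

/-- The germ of `m` at `x` is a fraction `j a / r`. -/
def IsGermFraction (P : X.PresheafOfModules) (ρ : R ≃+* Γ(X, U)) (j : A →+ P.obj (op U))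
    {W : X.Opens} (h : W ≤ U) (x : X) (m : P.obj (op W)) : Prop :=
  ∃ (r : R) (a : A) (V : X.Opens) (e : V ≤ W), x ∈ V ∧ x ∈ X.basicOpen (ρ r) ∧
    resP P e (resO h (ρ r) • m) = resP P (e.trans h) (j a)

variable {ρ : R ≃+* Γ(X, U)} {j : A →+ P.obj (op U)} (hj : ∀ r a, j (r • a) = ρ r • j a)
  {W : X.Opens} {h : W ≤ U} {x : X}

-- Addition of fractions over a common denominator. With the closure under multiples below, it
-- suffices to represent germs of generators as fractions.
include hj in
lemma IsGermFraction.add {m m' : P.obj (op W)} (hm : IsGermFraction P ρ j h x m)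
    (hm' : IsGermFraction P ρ j h x m') : IsGermFraction P ρ j h x (m + m') := by
  obtain ⟨r, a, V, e, hxV, hxr, hr⟩ := hm
  obtain ⟨r', a', V', e', hxV', hxr', hr'⟩ := hm'
  refine ⟨r * r', r' • a + r • a', V ⊓ V', inf_le_left.trans e, ⟨hxV, hxV'⟩, ?_, ?_⟩
  · rw [map_mul, Scheme.basicOpen_mul]
    exact ⟨hxr, hxr'⟩
  · have h1 := congrArg (fun z => resO (((inf_le_left : V ⊓ V' ≤ V).trans e).trans h) (ρ r') •
      resP P (inf_le_left : V ⊓ V' ≤ V) z) hr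
    have h2 := congrArg (fun z => resO (((inf_le_left : V ⊓ V' ≤ V).trans e).trans h) (ρ r) •
      resP P (inf_le_right : V ⊓ V' ≤ V') z) hr'
    simp only [resP_smul, resP_resP, resO_resO] at h1 h2
    rw [smul_add, map_add, map_add, map_add, hj, hj, resP_smul, resP_smul, resP_smul, resP_smul,
      ← h1, ← h2, smul_smul, smul_smul, resO_resO, map_mul, map_mul, mul_comm (resO _ (ρ r))]

-- As U is affine, the scalar c is itself a fraction of functions on U near x, and fractions
-- multiply.
include hj in
lemma IsGermFraction.smul (hU : IsAffineOpen U) (hx : x ∈ W) {m : P.obj (op W)}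
    (hm : IsGermFraction P ρ j h x m) (c : Γ(X, W)) : IsGermFraction P ρ j h x (c • m) := by
  obtain ⟨r, a, V, e, hxV, hxr, hr⟩ := hm
  obtain ⟨s, b, V', e', hxV', hxs, hs⟩ := exists_mul_resO_eq hU h hx c
  refine ⟨ρ.symm s * r, ρ.symm b • a, V ⊓ V', inf_le_left.trans e, ⟨hxV, hxV'⟩, ?_, ?_⟩
  · rw [map_mul, Scheme.basicOpen_mul, RingEquiv.apply_symm_apply]
    exact ⟨hxs, hxr⟩
  · have h1 := congrArg (resP P (inf_le_left : V ⊓ V' ≤ V)) hr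
    have h2 := congrArg (resO (inf_le_right : V ⊓ V' ≤ V')) hs
    simp only [resP_smul, resP_resP, resO_resO, map_mul] at h1 h2
    rw [hj, resP_smul, resP_smul, resP_smul, ← h1, smul_smul, smul_smul, map_mul, map_mul, map_mul,
      RingEquiv.apply_symm_apply, RingEquiv.apply_symm_apply, resO_resO, resO_resO, ← h2]
    congr 1
    ring

lemma IsGermFraction.of_res {m : P.obj (op W)} {W' : X.Opens} (e : W' ≤ W)
    (hm : IsGermFraction P ρ j (e.trans h) x (resP P e m)) : IsGermFraction P ρ j h x m := by
  obtain ⟨r, a, V, e', hxV, hxr, hr⟩ := hm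
  refine ⟨r, a, V, e'.trans e, hxV, hxr, ?_⟩
  rw [resP_smul, resP_resP, resO_resO] at hr
  rw [resP_smul, resO_resO, hr]

lemma IsGermFraction.of_eq (hx : x ∈ W) {m : P.obj (op W)} (a : A) (hm : m = resP P h (j a)) :
    IsGermFraction P ρ j h x m := by
  refine ⟨1, a, W, le_rfl, hx, ?_, ?_⟩
  · rw [map_one, Scheme.basicOpen_of_isUnit _ isUnit_one]
    exact h hx
  · rw [map_one, map_one, one_smul, hm, resP_resP]

end GermFraction

/-! ### Tensor products with the Cox sheaf over small open sets -/

section TensorLocal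

variable {X : Scheme.{0}} [IsIntegral X] {Λ : AddSubgroup (CartierDivisor X)} (M : X.Modules)

variable (Λ) in
/-- The tensor `m ⊗ s` in the presheaf tensor product. -/
def preTmul (U : X.Opens) (m : Γ(M, U)) (s : CoxRing Λ U) : (preTensorCox Λ M).obj (op U) :=
  TensorProduct.tmul Γ(X, U) (M := Γ(M, U)) (N := CoxRing Λ U) m s

lemma tmulCox_eq (U : X.Opens) (m : Γ(M, U)) (s : CoxRing Λ U) :
    tmulCox Λ M U m s = toSheafify (preTensorCox Λ M) U (preTmul Λ M U m s) := rfl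

lemma resP_preTmul {U V : X.Opens} (h : V ≤ U) (m : Γ(M, U)) (s : CoxRing Λ U) :
    resP (preTensorCox Λ M) h (preTmul Λ M U m s) =
      preTmul Λ M V (res M h m) (coxRestrict Λ h s) := rfl

lemma add_preTmul (U : X.Opens) (m n : Γ(M, U)) (s : CoxRing Λ U) :
    preTmul Λ M U (m + n) s = preTmul Λ M U m s + preTmul Λ M U n s :=
  TensorProduct.add_tmul (R := Γ(X, U)) (M := Γ(M, U)) (N := CoxRing Λ U) m n s

lemma smul_preTmul (U : X.Opens) (a : Γ(X, U)) (m : Γ(M, U)) (s : CoxRing Λ U) :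
    preTmul Λ M U (a • m) s = a • preTmul Λ M U m s :=
  (TensorProduct.smul_tmul' (R := Γ(X, U)) (M := Γ(M, U)) (N := CoxRing Λ U) a m s).symm

lemma add_tmulCox (U : X.Opens) (m n : Γ(M, U)) (s : CoxRing Λ U) :
    tmulCox Λ M U (m + n) s = tmulCox Λ M U m s + tmulCox Λ M U n s := by
  rw [tmulCox_eq, add_preTmul, map_add]
  rfl

lemma smul_tmulCox (U : X.Opens) (a : Γ(X, U)) (m : Γ(M, U)) (s : CoxRing Λ U) :
    tmulCox Λ M U (a • m) s = a • tmulCox Λ M U m s := by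
  rw [tmulCox_eq, smul_preTmul]
  exact toSheafify_smul' _ _ _ _

lemma res_tmulCox {U V : X.Opens} (h : V ≤ U) (m : Γ(M, U)) (s : CoxRing Λ U) :
    res (tensorCox Λ M) h (tmulCox Λ M U m s) =
      tmulCox Λ M V (res M h m) (coxRestrict Λ h s) :=
  res_toSheafify _ _ _

variable (T : LocalEquations Λ) (i : T.Idx) {V : X.Opens} (hV : V ≤ T.opens i)

/-- The decomposition `M ⊗ 𝒮̂_Λ = ⨁ M · (f_i^λ)⁻¹` over `V ⊆ U_i`. -/
def preTensorEquiv : (Λ →₀ Γ(M, V)) ≃+ (preTensorCox Λ M).obj (op V) :=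
  letI := Classical.decEq Λ
  (TensorProduct.equivFinsuppOfBasisRight (R := Γ(X, V)) (M := Γ(M, V))
    (generatorBasis T i hV)).symm.toAddEquiv

lemma preTensorEquiv_single (l : Λ) (m : Γ(M, V)) :
    preTensorEquiv M T i hV (Finsupp.single l m) = preTmul Λ M V m (generator T i l V hV) := by
  let := Classical.decEq Λ
  refine (TensorProduct.equivFinsuppOfBasisRight_symm_apply (R := Γ(X, V)) (M := Γ(M, V))
    (generatorBasis T i hV) (Finsupp.single l m)).trans ?_
  rw [Finsupp.sum_single_index (TensorProduct.zero_tmul Γ(M, V) (generatorBasis T i hV l)),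
    generatorBasis_apply]
  rfl

lemma preTensorEquiv_smul (r : Γ(X, V)) (b : Λ →₀ Γ(M, V)) :
    preTensorEquiv M T i hV (r • b) = r • preTensorEquiv M T i hV b :=
  let := Classical.decEq Λ
  (TensorProduct.equivFinsuppOfBasisRight (R := Γ(X, V)) (M := Γ(M, V))
    (generatorBasis T i hV)).symm.map_smul r b

lemma resP_preTensorEquiv {W : X.Opens} (h : W ≤ V) (b : Λ →₀ Γ(M, V)) :
    resP (preTensorCox Λ M) h (preTensorEquiv M T i hV b) =
      preTensorEquiv M T i (h.trans hV) (b.mapRange (res M h) (map_zero _)) := by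
  induction b using Finsupp.induction_linear with
  | zero => rw [map_zero, map_zero, Finsupp.mapRange_zero, map_zero]
  | add b c hb hc =>
    rw [map_add, map_add, hb, hc, ← map_add, Finsupp.mapRange_add (map_add (res M h))]
  | single l m =>
    rw [preTensorEquiv_single, Finsupp.mapRange_single, preTensorEquiv_single, resP_preTmul,
      coxRestrict_generator]

/-- The product of the annihilators over the finite support kills all components at once. -/
lemma exists_smul_finsupp_eq_zero {R N ι : Type*} [CommRing R] [AddCommGroup N] [Module R N]
    (S : Submonoid R) (b : ι →₀ N) (hb : ∀ k, ∃ r ∈ S, r • b k = 0) : ∃ r ∈ S, r • b = 0 := by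
  classical
  choose r hr hrb using hb
  refine ⟨∏ k ∈ b.support, r k, Submonoid.prod_mem _ fun k _ => hr k, Finsupp.ext fun k => ?_⟩
  rw [Finsupp.smul_apply, Finsupp.zero_apply]
  by_cases hk : k ∈ b.support
  · rw [← Finset.prod_erase_mul _ _ hk, mul_smul, hrb, smul_zero]
  · rw [Finsupp.notMem_support_iff.1 hk, smul_zero]

/-- The functions which do not vanish at `x`. -/
def nonvanishing {V : X.Opens} {x : X} (hx : x ∈ V) : Submonoid Γ(X, V) where
  carrier := {r | x ∈ X.basicOpen r}
  one_mem' := by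
    change x ∈ X.basicOpen (1 : Γ(X, V))
    rw [Scheme.basicOpen_of_isUnit _ isUnit_one]
    exact hx
  mul_mem' {a b} ha hb := by
    change x ∈ X.basicOpen (a * b)
    rw [Scheme.basicOpen_mul]
    exact ⟨ha, hb⟩

-- Over V the presheaf tensor product is a direct sum of copies of M indexed by Λ, and direct sums
-- commute with localization.
include i hV in
lemma isGermLocalizing_preTensorCox (hM : IsGermLocalizing M.val V) :
    IsGermLocalizing (preTensorCox Λ M) V where
  map_smul _ _ := rfl
  exists_smul_eq_zero W h x hx t ht := by
    obtain ⟨b, rfl⟩ := (preTensorEquiv M T i hV).surjective t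
    have hb := (resP_preTensorEquiv M T i hV h b).symm.trans ht
    rw [EmbeddingLike.map_eq_zero_iff] at hb
    obtain ⟨r, hr, hrb⟩ := exists_smul_finsupp_eq_zero (nonvanishing (h hx)) b fun k =>
      hM.exists_smul_eq_zero W h x hx (b k) (by simpa using! DFunLike.congr_fun hb k)
    refine ⟨r, hr, ?_⟩
    rw [← preTensorEquiv_smul, hrb, map_zero]
  exists_smul_eq W h x hx t := by
    obtain ⟨b, rfl⟩ := (preTensorEquiv M T i (h.trans hV)).surjective t
    change IsGermFraction _ (RingEquiv.refl Γ(X, V)) (AddMonoidHom.id _) h x _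
    induction b using Finsupp.induction_linear with
    | zero => exact .of_eq hx 0 (by rw [map_zero, map_zero, map_zero])
    | add b c hb hc =>
      rw [map_add]
      exact hb.add (fun _ _ => rfl) hc
    | single l m =>
      obtain ⟨r, a, V', e, hxV', hxr, hra⟩ := hM.exists_smul_eq W h x hx m
      refine ⟨r, preTmul Λ M V a (generator T i l V hV), V', e, hxV', hxr, ?_⟩
      rw [preTensorEquiv_single, ← smul_preTmul, resP_preTmul]
      refine Eq.trans ?_ (resP_preTmul M (e.trans h) a (generator T i l V hV)).symm
      exact congrArg (fun z => preTmul Λ M V' z (generator T i l V' ((e.trans h).trans hV))) hra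

/-- The sum `∑ m_λ ⊗ (f_i^λ)⁻¹`. -/
def tmulSum : (Λ →₀ Γ(M, V)) →+ Γ(tensorCox Λ M, V) :=
  (toSheafify (preTensorCox Λ M) V).comp (preTensorEquiv M T i hV).toAddMonoidHom

lemma tmulSum_single (l : Λ) (m : Γ(M, V)) :
    tmulSum M T i hV (Finsupp.single l m) = tmulCox Λ M V m (generator T i l V hV) :=
  congrArg (toSheafify (preTensorCox Λ M) V) (preTensorEquiv_single M T i hV l m)

lemma res_tmulSum {W : X.Opens} (h : W ≤ V) (b : Λ →₀ Γ(M, V)) :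
    res (tensorCox Λ M) h (tmulSum M T i hV b) =
      tmulSum M T i (h.trans hV) (b.mapRange (res M h) (map_zero _)) :=
  (res_toSheafify (preTensorCox Λ M) h _).trans
    (congrArg (toSheafify (preTensorCox Λ M) W) (resP_preTensorEquiv M T i hV h b))

/-- Sections of M ⊗ 𝒮̂_Λ over V become finitely supported families of sections of M. This is how the
lower row and the gradings are computed. -/
lemma tmulSum_bijective (hVa : IsAffineOpen V) (hM : IsGermLocalizing M.val V) :
    Function.Bijective (tmulSum M T i hV) :=
  ((isGermLocalizing_preTensorCox M T i hV hM).toSheafify_bijective hVa).comp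
    (preTensorEquiv M T i hV).bijective

lemma tensorCoxMap_tmulSum {N : X.Modules} (φ : M ⟶ N) (b : Λ →₀ Γ(M, V)) :
    (tensorCoxMap Λ φ).app V (tmulSum M T i hV b) =
      tmulSum N T i hV (b.mapRange (φ.app V) (map_zero _)) := by
  induction b using Finsupp.induction_linear with
  | zero => rw [map_zero, map_zero, Finsupp.mapRange_zero, map_zero]
  | add b c hb hc =>
    rw [map_add, map_add, hb, hc, ← map_add, Finsupp.mapRange_add (map_add _)]
  | single l m =>
    rw [tmulSum_single, Finsupp.mapRange_single, tmulSum_single, tensorCoxMap_tmul]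

end TensorLocal

/-! ### The Euler sequence over small open sets -/

section EulerLocal

variable {X S : Scheme.{0}} [IsIntegral X] (p : X ⟶ S) {Λ : AddSubgroup (CartierDivisor X)}
  (T : LocalEquations Λ)

lemma eulerSections_ext {V : X.Opens} {s t : eulerSections p T V} (h1 : s.1.1 = t.1.1)
    (h2 : ∀ j, s.1.2 j = t.1.2 j) : s = t :=
  Subtype.ext (Prod.ext h1 (funext h2))

variable (i : T.Idx) {V : X.Opens} (hV : V ≤ T.opens i)

/-- The `j`-th component of `frameSection`. -/
def frameComp (w : Γ(differentials p, V)) (m : Γ(X, V) ⊗[ℤ] Λ) (j : T.Idx) :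
    Γ(differentials p, V ⊓ T.opens j) :=
  res (differentials p) inf_le_left w + chernLin p T i j (V ⊓ T.opens j)
    (inf_le_inf_right _ hV) (latticeRestrict Λ (homOfLE inf_le_left) m)

lemma frameSection_snd (w : Γ(differentials p, V)) (m : Γ(X, V) ⊗[ℤ] Λ) (j : T.Idx) :
    (frameSection T p i V hV w m).1.2 j =
      (show FormsOn p (T.opens j) V from frameComp p T i hV w m j) := rfl

lemma frameComp_add (w w' : Γ(differentials p, V)) (m m' : Γ(X, V) ⊗[ℤ] Λ) (j : T.Idx) :
    frameComp p T i hV (w + w') (m + m') j =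
      frameComp p T i hV w m j + frameComp p T i hV w' m' j := by
  rw [frameComp, map_add, map_add, map_add, add_add_add_comm]
  rfl

lemma frameComp_smul (a : Γ(X, V)) (w : Γ(differentials p, V)) (m : Γ(X, V) ⊗[ℤ] Λ)
    (j : T.Idx) :
    frameComp p T i hV (a • w) (a • m) j =
      resO (inf_le_left : V ⊓ T.opens j ≤ V) a • frameComp p T i hV w m j := by
  rw [frameComp, res_smul, latticeRestrict_smul, map_smul]
  exact (smul_add (resO (inf_le_left : V ⊓ T.opens j ≤ V) a) _ _).symm

lemma frameSection_add (w w' : Γ(differentials p, V)) (m m' : Γ(X, V) ⊗[ℤ] Λ) :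
    frameSection T p i V hV (w + w') (m + m') =
      frameSection T p i V hV w m + frameSection T p i V hV w' m' :=
  Subtype.ext (Prod.ext rfl (funext fun j => frameComp_add p T i hV w w' m m' j))

lemma frameSection_smul (a : Γ(X, V)) (w : Γ(differentials p, V)) (m : Γ(X, V) ⊗[ℤ] Λ) :
    frameSection T p i V hV (a • w) (a • m) = a • frameSection T p i V hV w m :=
  Subtype.ext (Prod.ext rfl (funext fun j => frameComp_smul p T i hV a w m j))

lemma res_frameComp {W : X.Opens} (h : W ≤ V) (w : Γ(differentials p, V))
    (m : Γ(X, V) ⊗[ℤ] Λ) (j : T.Idx) :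
    res (differentials p) (inf_le_inf_right _ h : W ⊓ T.opens j ≤ V ⊓ T.opens j)
        (frameComp p T i hV w m j) =
      frameComp p T i (h.trans hV) (res (differentials p) h w)
        (latticeRestrict Λ (homOfLE h) m) j := by
  rw [frameComp, frameComp, map_add, res_res, res_res, ← latticeRestrict_comp]
  refine congrArg₂ (· + ·) rfl ((chernLin_map p T i j _ _ _).trans ?_)
  rw [← latticeRestrict_comp]
  rfl

lemma resP_frameSection {W : X.Opens} (h : W ≤ V) (w : Γ(differentials p, V))
    (m : Γ(X, V) ⊗[ℤ] Λ) :
    resP (preEuler p T) h (frameSection T p i V hV w m) =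
      frameSection T p i W (h.trans hV) (res (differentials p) h w)
        (latticeRestrict Λ (homOfLE h) m) :=
  eulerSections_ext p T rfl fun j => res_frameComp p T i hV h w m j

/-- The form is recovered from the i-th component, as V ∩ U_i = V and the correction terms of both
sides coincide. -/
lemma frameSection_injective {w w' : Γ(differentials p, V)} {m m' : Γ(X, V) ⊗[ℤ] Λ}
    (h : frameSection T p i V hV w m = frameSection T p i V hV w' m') : w = w' ∧ m = m' := by
  have hm : m = m' := congrArg (fun s => s.1.1) h
  subst hm
  refine ⟨?_, rfl⟩
  have h2 : res (differentials p) (inf_le_left : V ⊓ T.opens i ≤ V) w + _ =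
      res (differentials p) (inf_le_left : V ⊓ T.opens i ≤ V) w' + _ :=
    congrArg (fun s => s.1.2 i) h
  have h3 := congrArg (res (differentials p) (le_inf le_rfl hV : V ≤ V ⊓ T.opens i))
    (add_right_cancel h2)
  rwa [res_res, res_res, res_self, res_self] at h3

/-- Over V ⊆ U_i the gluing condition for the pairs (i, j) expresses every component of s through
the i-th one. -/
lemma exists_frameSection_eq (s : eulerSections p T V) :
    ∃ w m, frameSection T p i V hV w m = s := by
  refine ⟨FormsOn.res p V (le_inf le_rfl hV) (s.1.2 i), s.1.1, eulerSections_ext p T rfl fun j => ?_⟩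
  have h : V ⊓ T.opens j ≤ V ⊓ (T.opens i ⊓ T.opens j) :=
    le_inf inf_le_left (le_inf (inf_le_left.trans hV) inf_le_right)
  have key := congrArg ((differentials p).presheaf.map (homOfLE h).op) (s.2 i j)
  rw [map_add, chernLin_map, ← latticeRestrict_comp, FormsOn.map_res, FormsOn.map_res] at key
  refine Eq.trans ?_ (key.symm.trans (presheaf_map_id (differentials p) le_rfl (s.1.2 j)))
  refine (frameSection_snd p T i hV _ _ j).trans ?_
  exact congrArg₂ (· + ·) (FormsOn.map_res p _ inf_le_left (s.1.2 i)) rfl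

/-- The cocycle identity ψ_ij + ψ_jk = ψ_ik. -/
lemma frameComp_change (j : T.Idx) (hV' : V ≤ T.opens j) (w : Γ(differentials p, V))
    (m : Γ(X, V) ⊗[ℤ] Λ) (k : T.Idx) :
    frameComp p T j hV' (w + chernLin p T i j V (le_inf hV hV') m) m k =
      frameComp p T i hV w m k := by
  rw [frameComp, frameComp, map_add, add_assoc]
  refine congrArg₂ (· + ·) rfl ?_
  refine Eq.trans ?_ (chernLin_add p T i j k _ (inf_le_left.trans (le_inf hV hV'))
    (inf_le_inf_right _ hV') (inf_le_inf_right _ hV) _)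
  exact congrArg₂ (· + ·) (chernLin_map p T i j _ _ _) rfl

lemma frameSection_change (j : T.Idx) (hV' : V ≤ T.opens j) (w : Γ(differentials p, V))
    (m : Γ(X, V) ⊗[ℤ] Λ) :
    frameSection T p j V hV' (w + chernLin p T i j V (le_inf hV hV') m) m =
      frameSection T p i V hV w m :=
  eulerSections_ext p T rfl fun k => frameComp_change p T i hV j hV' w m k

lemma mul_smul_eq_zero_of_right {R N : Type*} [CommRing R] [AddCommGroup N] [Module R N] {r : R}
    {n : N} (h : r • n = 0) (r' : R) : (r' * r) • n = 0 := by
  rw [mul_smul, h, smul_zero]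

lemma mul_smul_eq_zero_of_left {R N : Type*} [CommRing R] [AddCommGroup N] [Module R N] {r : R}
    {n : N} (h : r • n = 0) (r' : R) : (r * r') • n = 0 := by
  rw [mul_comm, mul_smul, h, smul_zero]

/-- Restriction of functions to a nonempty open subset of an integral scheme is injective, and
tensoring with the flat ℤ-module Λ preserves this. -/
lemma latticeRestrict_injective {U V : X.Opens} [Module.Flat ℤ Λ] (h : V ≤ U) {x : X}
    (hx : x ∈ V) : Function.Injective (latticeRestrict Λ (homOfLE h)) := by
  refine Module.Flat.rTensor_preserves_injective_linearMap (M := Λ)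
    (X.presheaf.map (homOfLE h).op).hom.toAddMonoidHom.toIntLinearMap fun a b hab => ?_
  have : Nonempty V := ⟨⟨x, hx⟩⟩
  exact map_injective_of_isIntegral X (homOfLE h) hab

lemma isGermLocalizing_preLattice [Module.Flat ℤ Λ] (hV : IsAffineOpen V) :
    IsGermLocalizing (preLattice Λ) V where
  map_smul _ _ := rfl
  exists_smul_eq_zero W h x hx a ha := by
    have ha' : a = 0 := latticeRestrict_injective h hx (ha.trans (map_zero (latticeRestrict Λ _)).symm)
    refine ⟨1, (nonvanishing (h hx)).one_mem, ?_⟩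
    rw [ha', smul_zero]
  exists_smul_eq W h x hx m := by
    change IsGermFraction _ (RingEquiv.refl Γ(X, V)) (AddMonoidHom.id _) h x _
    change Γ(X, W) ⊗[ℤ] Λ at m
    induction m using TensorProduct.induction_on with
    | zero => exact .of_eq hx 0 (by rw [map_zero, map_zero]; rfl)
    | add a b ha hb => exact ha.add (fun _ _ => rfl) hb
    | tmul c l =>
      obtain ⟨r, a, V', e, hxV', hxr, hra⟩ := exists_mul_resO_eq hV h hx c
      refine ⟨r, (a ⊗ₜ[ℤ] l : Γ(X, V) ⊗[ℤ] Λ), V', e, hxV', hxr, ?_⟩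
      exact congrArg (· ⊗ₜ[ℤ] l) hra

/-- `frameSection` as a section of the presheaf `ℛ_Λ`. -/
def preFrame (w : Γ(differentials p, V)) (m : Γ(X, V) ⊗[ℤ] Λ) : (preEuler p T).obj (op V) :=
  frameSection T p i V hV w m

lemma preFrame_add (w w' : Γ(differentials p, V)) (m m' : Γ(X, V) ⊗[ℤ] Λ) :
    preFrame p T i hV (w + w') (m + m') = preFrame p T i hV w m + preFrame p T i hV w' m' :=
  frameSection_add p T i hV w w' m m'

lemma preFrame_smul (a : Γ(X, V)) (w : Γ(differentials p, V)) (m : Γ(X, V) ⊗[ℤ] Λ) :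
    preFrame p T i hV (a • w) (a • m) = a • preFrame p T i hV w m :=
  frameSection_smul p T i hV a w m

lemma preFrame_zero : preFrame p T i hV 0 0 = 0 := by
  have := preFrame_smul p T i hV 0 0 0
  rwa [zero_smul, zero_smul, zero_smul] at this

lemma resP_preFrame {W : X.Opens} (h : W ≤ V) (w : Γ(differentials p, V))
    (m : Γ(X, V) ⊗[ℤ] Λ) :
    resP (preEuler p T) h (preFrame p T i hV w m) = preFrame p T i (h.trans hV)
      (res (differentials p) h w) (latticeRestrict Λ (homOfLE h) m) :=
  resP_frameSection p T i hV h w m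

lemma preFrame_eq_zero {w : Γ(differentials p, V)} {m : Γ(X, V) ⊗[ℤ] Λ}
    (h : preFrame p T i hV w m = 0) : w = 0 ∧ m = 0 :=
  frameSection_injective p T i hV (h.trans (preFrame_zero p T i hV).symm)

lemma exists_preFrame_eq (s : (preEuler p T).obj (op V)) : ∃ w m, preFrame p T i hV w m = s :=
  exists_frameSection_eq p T i hV s

lemma preFrame_change (j : T.Idx) (hV' : V ≤ T.opens j) (w : Γ(differentials p, V))
    (m : Γ(X, V) ⊗[ℤ] Λ) :
    preFrame p T j hV' (w + chernLin p T i j V (le_inf hV hV') m) m = preFrame p T i hV w m :=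
  frameSection_change p T i hV j hV' w m

-- The i-th component splits the presheaf ℛ_Λ over V into Ω_X ⊕ 𝒪_X ⊗ Λ, and both summands have the
-- property.
include i hV in
lemma isGermLocalizing_preEuler [Module.Flat ℤ Λ] (hVa : IsAffineOpen V)
    (hΩ : IsGermLocalizing (differentials p).val V) : IsGermLocalizing (preEuler p T) V where
  map_smul _ _ := rfl
  exists_smul_eq_zero W h x hx s hs := by
    obtain ⟨w, m, rfl⟩ := exists_preFrame_eq p T i hV s
    obtain ⟨hw, hm⟩ := preFrame_eq_zero p T i (h.trans hV)
      ((resP_preFrame p T i hV h w m).symm.trans hs)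
    obtain ⟨r, hr, hrw⟩ := hΩ.exists_smul_eq_zero W h x hx w hw
    obtain ⟨r', hr', hrm⟩ := (isGermLocalizing_preLattice hVa).exists_smul_eq_zero W h x hx m hm
    have h1 : (r * r') • w = 0 := mul_smul_eq_zero_of_left hrw r'
    have h2 : (r * r') • m = 0 := mul_smul_eq_zero_of_right hrm r
    refine ⟨r * r', (nonvanishing (h hx)).mul_mem hr hr', ?_⟩
    rw [← preFrame_smul, h1, h2, preFrame_zero]
  exists_smul_eq W h x hx s := by
    obtain ⟨w, m, rfl⟩ := exists_preFrame_eq p T i (h.trans hV) s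
    change IsGermFraction _ (RingEquiv.refl Γ(X, V)) (AddMonoidHom.id _) h x _
    have h1 := preFrame_add p T i (h.trans hV) w 0 0 m
    rw [add_zero, zero_add] at h1
    rw [h1]
    refine IsGermFraction.add (fun _ _ => rfl) ?_ ?_
    · obtain ⟨r, a, V', e, hxV', hxr, hra⟩ := hΩ.exists_smul_eq W h x hx w
      refine ⟨r, preFrame p T i hV a 0, V', e, hxV', hxr, ?_⟩
      have h2 := preFrame_smul p T i (h.trans hV) (resO h r) w 0
      rw [smul_zero] at h2
      refine (congrArg (resP (preEuler p T) e) h2.symm).trans ?_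
      refine (resP_preFrame p T i (h.trans hV) e _ _).trans ?_
      refine Eq.trans ?_ (resP_preFrame p T i hV (e.trans h) a 0).symm
      rw [map_zero, map_zero]
      exact congrArg (fun z => preFrame p T i ((e.trans h).trans hV) z 0) hra
    · obtain ⟨r, a, V', e, hxV', hxr, hra⟩ :=
        (isGermLocalizing_preLattice hVa).exists_smul_eq W h x hx m
      refine ⟨r, preFrame p T i hV 0 a, V', e, hxV', hxr, ?_⟩
      have h2 := preFrame_smul p T i (h.trans hV) (resO h r) 0 m
      rw [smul_zero] at h2
      refine (congrArg (resP (preEuler p T) e) h2.symm).trans ?_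
      refine (resP_preFrame p T i (h.trans hV) e _ _).trans ?_
      refine Eq.trans ?_ (resP_preFrame p T i hV (e.trans h) 0 a).symm
      rw [map_zero, map_zero]
      exact congrArg (fun z => preFrame p T i ((e.trans h).trans hV) 0 z) hra

lemma eulerDifferential_eq (l : Λ) (s : Γ(X, V)) :
    eulerDifferential T p i l V hV s =
      toSheafify (preEuler p T) V (preFrame p T i hV (d p V s) (s ⊗ₜ[ℤ] l)) := rfl

lemma eulerDifferential_add (l : Λ) (s t : Γ(X, V)) :
    eulerDifferential T p i l V hV (s + t) =
      eulerDifferential T p i l V hV s + eulerDifferential T p i l V hV t := by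
  rw [eulerDifferential_eq, map_add, TensorProduct.add_tmul, preFrame_add, map_add]
  rfl

/-- The form component is the Leibniz rule for d; in the lattice component, st ⊗ (λ + μ) = s (t ⊗ μ)
+ t (s ⊗ λ), so that λ plays the part of a logarithmic derivative. -/
lemma eulerDifferential_mul (l m : Λ) (s t : Γ(X, V)) :
    eulerDifferential T p i (l + m) V hV (s * t) =
      s • eulerDifferential T p i m V hV t + t • eulerDifferential T p i l V hV s := by
  have h1 : preFrame p T i hV (d p V (s * t)) ((s * t) ⊗ₜ[ℤ] (l + m)) =
      s • preFrame p T i hV (d p V t) (t ⊗ₜ[ℤ] m) +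
        t • preFrame p T i hV (d p V s) (s ⊗ₜ[ℤ] l) := by
    rw [← preFrame_smul, ← preFrame_smul, ← preFrame_add, d_mul,
      TensorProduct.smul_tmul', TensorProduct.smul_tmul', smul_eq_mul, smul_eq_mul, mul_comm t s,
      TensorProduct.tmul_add, add_comm (_ ⊗ₜ[ℤ] l)]
  rw [eulerDifferential_eq, h1, map_add, toSheafify_smul', toSheafify_smul']
  rfl

lemma res_eulerDifferential {W : X.Opens} (h : W ≤ V) (l : Λ) (s : Γ(X, V)) :
    res (eulerSheaf p T) h (eulerDifferential T p i l V hV s) =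
      eulerDifferential T p i l W (h.trans hV) (resO h s) := by
  refine (res_toSheafify (preEuler p T) h _).trans (congrArg (toSheafify (preEuler p T) W) ?_)
  refine (resP_preFrame p T i hV h _ _).trans ?_
  rw [latticeRestrict_tmul]
  exact congrArg (fun z => preFrame p T i (h.trans hV) z _) (d_map p (homOfLE h) s).symm

/-- The factor g cancels the denominator in d log g = dg / g. -/
lemma chernLin_tmul (j : T.Idx) (h : V ≤ T.opens i ⊓ T.opens j) (l : Λ) (s : Γ(X, V)) :
    chernLin p T i j V h (((transition T i j V h (.ofAdd l) : Γ(X, V)) * s) ⊗ₜ[ℤ] l) =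
      s • d p V (transition T i j V h (.ofAdd l) : Γ(X, V)) := by
  rw [chernLin, LinearMap.liftBaseChange_tmul]
  change _ • dlog p V _ = _
  rw [dlog, smul_smul]
  congr 1
  rw [mul_comm, ← mul_assoc, Units.inv_mul, one_mul]

/-- The reason why ℛ_Λ appears. With g = g_ij^λ one has d(gs) = g ds + s dg, and the extra term s dg
is ψ_ij(gs ⊗ λ), the correction prescribed by the gluing of ℛ_Λ. -/
lemma eulerDifferential_change (j : T.Idx) (hV' : V ≤ T.opens j) (l : Λ) (s : Γ(X, V)) :
    eulerDifferential T p j l V hV'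
        ((transition T i j V (le_inf hV hV') (.ofAdd l) : Γ(X, V)) * s) =
      (transition T i j V (le_inf hV hV') (.ofAdd l) : Γ(X, V)) •
        eulerDifferential T p i l V hV s := by
  refine Eq.trans ?_ (toSheafify_smul' (preEuler p T) V _ _)
  refine congrArg (toSheafify (preEuler p T) V) ?_
  refine Eq.trans ?_ (preFrame_smul p T i hV _ _ _)
  rw [← preFrame_change p T i hV j hV', d_mul, TensorProduct.smul_tmul', smul_eq_mul, chernLin_tmul]
  rfl

lemma eulerFst_app (w : Γ(differentials p, V)) :
    (eulerFst p T).app V w = toSheafify (preEuler p T) V (preFrame p T i hV w 0) := by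
  refine congrArg (toSheafify (preEuler p T) V) (eulerSections_ext p T rfl fun j => ?_)
  refine Eq.trans ?_ (frameSection_snd p T i hV w 0 j).symm
  rw [frameComp, map_zero, map_zero, add_zero]
  rfl

lemma eulerSnd_app_toSheafify (w : Γ(differentials p, V)) (m : Γ(X, V) ⊗[ℤ] Λ) :
    (eulerSnd p T).app V (toSheafify (preEuler p T) V (preFrame p T i hV w m)) =
      toSheafify (preLattice Λ) V m :=
  sheafifyMap_app _ _ _

end EulerLocal

/-! ### Derivations of Laurent algebras -/

section LaurentDerivation

variable {B A N L : Type*} [CommRing B] [CommRing A] [Algebra B A] [AddCommGroup N] [Module B N]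
  [AddCommGroup L] {e : L → A} (b : Module.Basis L B A) (hb : ∀ l, b l = e l)

include hb in
lemma basis_additive_induction {P : A → Prop} (h0 : P 0) (hadd : ∀ x y, P x → P y → P (x + y))
    (hs : ∀ l (c : B), P (c • e l)) (x : A) : P x := by
  obtain ⟨f, rfl⟩ := b.repr.symm.surjective x
  induction f using Finsupp.induction_linear with
  | zero => rwa [map_zero]
  | add f g hf hg =>
    rw [map_add]
    exact hadd _ _ hf hg
  | single l c =>
    rw [b.repr_symm_single, hb]
    exact hs l c

variable (hadd : ∀ l m, e (l + m) = e l * e m) (ε : L → B →+ N)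
  (hε : ∀ l m s t, ε (l + m) (s * t) = s • ε m t + t • ε l s)

include hb hadd hε in
/-- The derivation `c e^λ ↦ e^λ ⊗ ε_λ(c)` of a Laurent algebra. -/
lemma exists_laurentDerivation : ∃ δ : A →+ A ⊗[B] N,
    (∀ l (c : B), δ (c • e l) = e l ⊗ₜ ε l c) ∧ ∀ x y, δ (x * y) = x • δ y + y • δ x := by
  let δ : A →+ A ⊗[B] N := (Finsupp.liftAddHom fun l =>
    (TensorProduct.mk B A N (e l)).toAddMonoidHom.comp (ε l)).comp b.repr.toLinearMap.toAddMonoidHom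
  have hδ (l c) : δ (c • e l) = e l ⊗ₜ ε l c := by
    change Finsupp.liftAddHom _ (b.repr (c • e l)) = _
    rw [← hb, map_smul, b.repr_self, Finsupp.smul_single, smul_eq_mul, mul_one,
      Finsupp.liftAddHom_apply_single]
    exact congrArg (· ⊗ₜ ε l c) (hb l).symm
  refine ⟨δ, hδ, fun x y => ?_⟩
  -- Both sides are biadditive in x and y, so it is enough to treat monomials, where the rule is
  -- `hε` multiplied by e_λ e_μ.
  induction x using basis_additive_induction b hb with
  | h0 => rw [zero_mul, map_zero, zero_smul, smul_zero, add_zero]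
  | hadd x x' hx hx' => rw [add_mul, map_add, hx, hx', map_add, add_smul, smul_add]; abel
  | hs l c =>
    induction y using basis_additive_induction b hb with
    | h0 => rw [mul_zero, map_zero, zero_smul, smul_zero, add_zero]
    | hadd x x' hx hx' => rw [mul_add, map_add, hx, hx', map_add, add_smul, smul_add]; abel
    | hs m c' =>
      rw [smul_mul_smul_comm, ← hadd, hδ, hδ, hδ, hε, TensorProduct.tmul_add,
        TensorProduct.smul_tmul', TensorProduct.smul_tmul', TensorProduct.tmul_smul,
        TensorProduct.tmul_smul, smul_eq_mul, smul_eq_mul, hadd, smul_mul_assoc, smul_mul_assoc,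
        TensorProduct.smul_tmul', TensorProduct.smul_tmul', mul_comm (e m)]

variable {A' Z : Type*} [CommRing A'] [AddCommGroup Z] [Module A' Z] (ρ : A ≃+* A') (δZ : A' →+ Z)

include hb hadd hε in
/-- The module of differentials of a Laurent algebra. -/
lemma exists_laurentDifferentials_equiv (hzero : e 0 = 1)
    (hspanN : Submodule.span B {n | ∃ l c, ε l c = n} = ⊤)
    (hspanZ : Submodule.span A' (Set.range δZ) = ⊤)
    (hlift : ∀ δ : A →+ A ⊗[B] N, (∀ l (c : B), δ (c • e l) = e l ⊗ₜ ε l c) →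
      (∀ x y, δ (x * y) = x • δ y + y • δ x) → ∃ F : Z →+ A ⊗[B] N,
        (∀ x z, F (ρ x • z) = x • F z) ∧ ∀ x, F (δZ (ρ x)) = δ x)
    (hψ : ∃ ψ : N →+ Z, (∀ (c : B) n, ψ (c • n) = ρ (algebraMap B A c) • ψ n) ∧
      ∀ l (c : B), ψ (ε l c) = ρ (e (-l)) • δZ (ρ (c • e l))) :
    ∃ E : Z ≃+ A ⊗[B] N, (∀ x z, E (ρ x • z) = x • E z) ∧
      ∀ t l (c : B), E (ρ t • δZ (ρ (c • e l))) = (e l * t) ⊗ₜ ε l c := by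
  obtain ⟨δ, hδ, hδm⟩ := exists_laurentDerivation b hb hadd ε hε
  obtain ⟨F, hF, hFδ⟩ := hlift δ hδ hδm
  obtain ⟨ψ, hψs, hψ⟩ := hψ
  let _ : Module A Z := Module.compHom Z ρ.toRingHom
  let _ : Module B Z := Module.compHom Z (ρ.toRingHom.comp (algebraMap B A))
  have : IsScalarTower B A Z := IsScalarTower.of_algebraMap_smul fun _ _ => rfl
  have hsA (x : A) (z : Z) : x • z = ρ x • z := rfl
  -- K is the inverse of F. Both composites are checked on generators: the elements ε_λ(c) of N on
  -- one side, the differentials of monomials on the other. The factor e_{-λ} in `hψ` cancels e_λ.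
  let K : A ⊗[B] N →ₗ[A] Z := LinearMap.liftBaseChange A (⟨⟨ψ, map_add ψ⟩, hψs⟩ : N →ₗ[B] Z)
  have hK (x : A) (n : N) : K (x ⊗ₜ n) = ρ x • ψ n := LinearMap.liftBaseChange_tmul ..
  have he (l : L) : e l * e (-l) = 1 := by rw [← hadd, add_neg_cancel, hzero]
  have h1 (l c) : F (ψ (ε l c)) = (1 : A) ⊗ₜ ε l c := by
    rw [hψ, hF, hFδ, hδ, TensorProduct.smul_tmul', smul_eq_mul, mul_comm, he]
  have h2 (n : N) : F (ψ n) = (1 : A) ⊗ₜ n := by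
    have hn : n ∈ Submodule.span B {n | ∃ l c, ε l c = n} := hspanN ▸ Submodule.mem_top
    induction hn using Submodule.span_induction with
    | mem n hn =>
      obtain ⟨l, c, rfl⟩ := hn
      exact h1 l c
    | zero => rw [map_zero, map_zero, TensorProduct.tmul_zero]
    | add n n' _ _ hn hn' => rw [map_add, map_add, hn, hn', TensorProduct.tmul_add]
    | smul c n _ hn =>
      rw [hψs, hF, hn, TensorProduct.tmul_smul, algebraMap_smul]
  have h3 (t : A ⊗[B] N) : F (K t) = t := by
    induction t using TensorProduct.induction_on with
    | zero => rw [map_zero, map_zero]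
    | add t t' ht ht' => rw [map_add, map_add, ht, ht']
    | tmul x n => rw [hK, hF, h2, TensorProduct.smul_tmul', smul_eq_mul, mul_one]
  have h4 (x : A) : K (F (δZ (ρ x))) = δZ (ρ x) := by
    induction x using basis_additive_induction b hb with
    | h0 => simp
    | hadd x x' hx hx' => simp only [map_add, hx, hx']
    | hs l c => rw [hFδ, hδ, hK, hψ, smul_smul, ← map_mul, he, map_one, one_smul]
  have h5 (z : Z) : K (F z) = z := by
    refine addMonoidHom_eq_of_span (RingHom.id A') hspanZ (F := K.toAddMonoidHom.comp F)
      (G := AddMonoidHom.id Z) (fun x z => ?_) (fun _ _ => rfl) ?_ z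
    · obtain ⟨x, rfl⟩ := ρ.surjective x
      exact (congrArg K (hF x z)).trans (K.map_smul x _)
    · rintro _ ⟨x, rfl⟩
      obtain ⟨x, rfl⟩ := ρ.surjective x
      exact h4 x
  refine ⟨⟨⟨F, K, h5, h3⟩, map_add F⟩, hF, fun t l c => (hF _ _).trans ?_⟩
  rw [hFδ, hδ, TensorProduct.smul_tmul', smul_eq_mul, mul_comm]

end LaurentDerivation

/-! ### The basis of small affine open sets -/

section Basis

variable {X : Scheme.{0}} [IsIntegral X] {Λ : AddSubgroup (CartierDivisor X)}
  (T : LocalEquations Λ)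

/-- The affine open sets which are contained in a member of the covering `(U_i)`. -/
def smallAffines : Set X.Opens := {V | IsAffineOpen V ∧ ∃ i, V ≤ T.opens i}

lemma isBasis_smallAffines : Opens.IsBasis (smallAffines T) := by
  rw [Opens.isBasis_iff_nbhd]
  intro U x hx
  obtain ⟨i, hi⟩ := T.covers x
  obtain ⟨V, hV, hxV, hVU⟩ := Opens.isBasis_iff_nbhd.1 X.isBasis_affineOpens
    (show x ∈ U ⊓ T.opens i from ⟨hx, hi⟩)
  exact ⟨V, ⟨hV, i, hVU.trans inf_le_right⟩, hxV, hVU.trans inf_le_left⟩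

end Basis

/-! ### Logarithmic derivations and the differentials of the characteristic space -/

section LogDerivation

variable {X : Scheme.{0}} [IsIntegral X] {Λ : AddSubgroup (CartierDivisor X)}
  (T : LocalEquations Λ) (N : X.Modules)

/-- A logarithmic derivation of the Cox sheaf with values in `N`: for a function `s` on `V ⊆ U_i`,
`toFun i l _ s` is the value on `s · (f_i^λ)⁻¹`, divided by `(f_i^λ)⁻¹`. -/
structure LogDerivation where
  toFun (i : T.Idx) (l : Λ) {V : X.Opens} (hV : V ≤ T.opens i) : Γ(X, V) →+ Γ(N, V)
  map_mul (i : T.Idx) (l m : Λ) {V : X.Opens} (hV : V ≤ T.opens i) (s t : Γ(X, V)) :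
    toFun i (l + m) hV (s * t) = s • toFun i m hV t + t • toFun i l hV s
  res_toFun (i : T.Idx) (l : Λ) {V W : X.Opens} (hV : V ≤ T.opens i) (h : W ≤ V) (s : Γ(X, V)) :
    res N h (toFun i l hV s) = toFun i l (h.trans hV) (resO h s)
  toFun_change (i j : T.Idx) (l : Λ) {V : X.Opens} (hV : V ≤ T.opens i) (hV' : V ≤ T.opens j)
    (s : Γ(X, V)) :
    toFun j l hV' ((transition T i j V (le_inf hV hV') (.ofAdd l) : Γ(X, V)) * s) =
      (transition T i j V (le_inf hV hV') (.ofAdd l) : Γ(X, V)) • toFun i l hV s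
  isGermLocalizing (i : T.Idx) {V : X.Opens} (hV : V ≤ T.opens i) (hVa : IsAffineOpen V) :
    IsGermLocalizing N.val V
  span_eq_top (i : T.Idx) {V : X.Opens} (hV : V ≤ T.opens i) (hVa : IsAffineOpen V) :
    Submodule.span Γ(X, V) {n | ∃ l c, toFun i l hV c = n} = ⊤

/-- The target carries no R-action here, so agreement is required on all multiples of the
generators. -/
lemma addMonoidHom_eq_of_span_smul {R A B : Type*} [CommRing R] [AddCommGroup A]
    [Module R A] [AddCommGroup B] {s : Set A} (hs : Submodule.span R s = ⊤) {F G : A →+ B}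
    (h : ∀ (r : R), ∀ a ∈ s, F (r • a) = G (r • a)) (a : A) : F a = G a := by
  suffices ∀ r : R, F (r • a) = G (r • a) by simpa using this 1
  have ha : a ∈ Submodule.span R s := hs ▸ Submodule.mem_top
  induction ha using Submodule.span_induction with
  | mem a ha => exact fun r => h r a ha
  | zero => intro r; rw [smul_zero, map_zero, map_zero]
  | add a b _ _ ha hb => intro r; rw [smul_add, map_add, map_add, ha, hb]
  | smul r a _ ha => intro r'; rw [smul_smul, ha]

variable {T} {S' : Scheme.{0}} (q : charSpace Λ ⟶ S')

/-- The form `t · d(c (f_i^λ)⁻¹)`. -/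
def coxForm {V : X.Opens} (hVa : IsAffineOpen V) (t s : CoxRing Λ V) :
    Γ(differentials q, charProj Λ ⁻¹ᵁ V) :=
  coxFunction Λ ⟨V, hVa⟩ t • d q (charProj Λ ⁻¹ᵁ V) (coxFunction Λ ⟨V, hVa⟩ s)

lemma res_coxForm {V W : X.Opens} (hVa : IsAffineOpen V) (hWa : IsAffineOpen W) (h : W ≤ V)
    (t s : CoxRing Λ V) :
    res (differentials q) ((charProj Λ).preimage_mono h) (coxForm q hVa t s) =
      coxForm q hWa (coxRestrict Λ h t) (coxRestrict Λ h s) := by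
  rw [coxForm, res_smul]
  refine congrArg₂ (· • ·) (resO_coxFunction Λ (U := ⟨V, hVa⟩) (V := ⟨W, hWa⟩) h t) ?_
  refine (d_map q (homOfLE ((charProj Λ).preimage_mono h)) _).symm.trans ?_
  exact congrArg (d q (charProj Λ ⁻¹ᵁ W))
    (resO_coxFunction Λ (U := ⟨V, hVa⟩) (V := ⟨W, hWa⟩) h s)

lemma coxForm_add {V : X.Opens} (hVa : IsAffineOpen V) (t s s' : CoxRing Λ V) :
    coxForm q hVa t (s + s') = coxForm q hVa t s + coxForm q hVa t s' := by
  rw [coxForm, map_add, map_add, smul_add]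
  rfl

/-- The set π⁻¹V is affine and its functions are sums of monomials c (f_i^λ)⁻¹, so its forms are
sums of the t · d(c (f_i^λ)⁻¹). All later comparisons of maps on these forms use this test. -/
lemma addMonoidHom_eq_of_coxForm (i : T.Idx) {V : X.Opens} (hV : V ≤ T.opens i)
    (hVa : IsAffineOpen V) {W₀ : S'.Opens} (hW₀ : IsAffineOpen W₀)
    (e : charProj Λ ⁻¹ᵁ V ≤ q ⁻¹ᵁ W₀) {Q : Type*} [AddCommGroup Q]
    {F G : Γ(differentials q, charProj Λ ⁻¹ᵁ V) →+ Q}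
    (h : ∀ t l (c : Γ(X, V)), F (coxForm q hVa t (c • generator T i l V hV)) =
      G (coxForm q hVa t (c • generator T i l V hV))) (z) : F z = G z := by
  refine addMonoidHom_eq_of_span_smul
    (d_span q (charProj_preimage_isAffineOpen Λ hVa) hW₀ e) ?_ z
  rintro t' _ ⟨x', rfl⟩
  obtain ⟨t, rfl⟩ := (coxFunctionEquiv Λ hVa).surjective t'
  obtain ⟨x, rfl⟩ := (coxFunctionEquiv Λ hVa).surjective x'
  change F (coxForm q hVa t x) = G (coxForm q hVa t x)
  induction x using basis_additive_induction (generatorBasis T i hV)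
    (generatorBasis_apply T i hV) with
  | h0 => rw [coxForm, map_zero, map_zero, smul_zero, map_zero, map_zero]
  | hadd x x' hx hx' => rw [coxForm_add, map_add, map_add, hx, hx']
  | hs l c => exact h t l c

lemma charProj_app_eq {V : X.Opens} (hVa : IsAffineOpen V) (c : Γ(X, V)) :
    (charProj Λ).app V c =
      coxFunctionEquiv Λ hVa (algebraMap Γ(X, V) (CoxRing Λ V) c) :=
  (coxFunction_coxAlgebraMap Λ ⟨V, hVa⟩ c).symm

/-- The universal property of the differentials of the characteristic space over an affine open
set. -/
lemma exists_coxForm_lift {V : X.Opens} (hVa : IsAffineOpen V) {W₀ : S'.Opens}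
    (hW₀ : IsAffineOpen W₀) (e : charProj Λ ⁻¹ᵁ V ≤ q ⁻¹ᵁ W₀) {Q : Type*} [AddCommGroup Q]
    [Module (CoxRing Λ V) Q] (δ : CoxRing Λ V →+ Q) (hδ : ∀ x y, δ (x * y) = x • δ y + y • δ x)
    (h0 : ∀ c, δ ((coxFunctionEquiv Λ hVa).symm (q.appLE W₀ _ e c)) = 0) :
    ∃ F : Γ(differentials q, charProj Λ ⁻¹ᵁ V) →+ Q,
      (∀ x z, F (coxFunctionEquiv Λ hVa x • z) = x • F z) ∧
      ∀ x, F (d q (charProj Λ ⁻¹ᵁ V) (coxFunctionEquiv Λ hVa x)) = δ x := by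
  let _ : Module Γ(charSpace Λ, charProj Λ ⁻¹ᵁ V) Q :=
    Module.compHom _ (coxFunctionEquiv Λ hVa).symm.toRingHom
  have hsm (x) (z : Q) : x • z = (coxFunctionEquiv Λ hVa).symm x • z := rfl
  obtain ⟨F, hF⟩ := exists_d_lift q (charProj_preimage_isAffineOpen Λ hVa) hW₀ e
    (δ.comp (coxFunctionEquiv Λ hVa).symm.toAddEquiv.toAddMonoidHom) (fun a b => by
      refine (congrArg δ (map_mul (coxFunctionEquiv Λ hVa).symm a b)).trans ?_
      exact hδ _ _) h0
  refine ⟨F.toAddMonoidHom, fun x z => ?_, fun x => ?_⟩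
  · refine (F.map_smul _ z).trans ?_
    rw [hsm, RingEquiv.symm_apply_apply]
    rfl
  · refine (hF _).trans (congrArg δ ?_)
    exact (coxFunctionEquiv Λ hVa).symm_apply_apply x

/-- Condition `hq` says that functions from the base of q come from functions on V killed by D in
degree zero; hence the derivation defined by D factors through Ω_q. The map of `hψ` supplies the
inverse on generators. -/
lemma exists_differentials_equiv_tensorProduct (D : LogDerivation T N) (i : T.Idx) {V : X.Opens}
    (hV : V ≤ T.opens i) (hVa : IsAffineOpen V) {W₀ : S'.Opens} (hW₀ : IsAffineOpen W₀)
    (e : charProj Λ ⁻¹ᵁ V ≤ q ⁻¹ᵁ W₀)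
    (hq : ∀ c, ∃ b : Γ(X, V), q.appLE W₀ _ e c = (charProj Λ).app V b ∧ D.toFun i 0 hV b = 0)
    (hψ : ∃ ψ : Γ(N, V) →+ Γ(differentials q, charProj Λ ⁻¹ᵁ V),
      (∀ (c : Γ(X, V)) n, ψ (c • n) = (charProj Λ).app V c • ψ n) ∧
      ∀ l c, ψ (D.toFun i l hV c) =
        coxForm q hVa (generator T i (-l) V hV) (c • generator T i l V hV)) :
    ∃ E : Γ(differentials q, charProj Λ ⁻¹ᵁ V) ≃+ CoxRing Λ V ⊗[Γ(X, V)] Γ(N, V),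
      (∀ (c : Γ(X, V)) z, E ((charProj Λ).app V c • z) = c • E z) ∧
      ∀ t l c, E (coxForm q hVa t (c • generator T i l V hV)) =
        (generator T i l V hV * t) ⊗ₜ D.toFun i l hV c := by
  obtain ⟨ψ, hψs, hψ⟩ := hψ
  have h1 := d_span q (charProj_preimage_isAffineOpen Λ hVa) hW₀ e
  have h3 := exists_laurentDifferentials_equiv (generatorBasis T i hV)
    (generatorBasis_apply T i hV) (generator_add T i hV) (fun l => D.toFun i l hV)
    (fun l m s t => D.map_mul i l m hV s t) (coxFunctionEquiv Λ hVa)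
    (d q (charProj Λ ⁻¹ᵁ V)) (generator_zero T i hV) (D.span_eq_top i hV hVa)
    h1
  have h4 := h3 (fun δ hδ hδm => exists_coxForm_lift q hVa hW₀ e δ hδm fun c => by
      obtain ⟨b, hb, hb0⟩ := hq c
      -- A function b on V is the monomial b e_0, so its value under δ is e_0 ⊗ D(b) = 0.
      have h5 := hδ 0 b
      rw [hb0, TensorProduct.tmul_zero] at h5
      rw [hb, charProj_app_eq hVa, RingEquiv.symm_apply_apply, Algebra.algebraMap_eq_smul_one,
        ← generator_zero T i hV, h5])
  have h5 : ∃ ψ : Γ(N, V) →+ Γ(differentials q, charProj Λ ⁻¹ᵁ V),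
      (∀ (c : Γ(X, V)) n, ψ (c • n) =
        coxFunctionEquiv Λ hVa (algebraMap Γ(X, V) (CoxRing Λ V) c) • ψ n) ∧
      ∀ l (c : Γ(X, V)), ψ (D.toFun i l hV c) = coxFunctionEquiv Λ hVa (generator T i (-l) V hV) •
        d q (charProj Λ ⁻¹ᵁ V) (coxFunctionEquiv Λ hVa (c • generator T i l V hV)) :=
    ⟨ψ, fun c n => by rw [hψs, charProj_app_eq hVa], hψ⟩
  obtain ⟨E, hE, hEd⟩ := h4 h5
  refine ⟨E, fun c z => ?_, hEd⟩
  rw [charProj_app_eq hVa, hE, algebraMap_smul]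

lemma exists_tensorProduct_equiv_tensorCox (D : LogDerivation T N) (i : T.Idx) {V : X.Opens}
    (hV : V ≤ T.opens i) (hVa : IsAffineOpen V) :
    ∃ G : CoxRing Λ V ⊗[Γ(X, V)] Γ(N, V) ≃+ Γ(tensorCox Λ N, V),
      (∀ (c : Γ(X, V)) z, G (c • z) = c • G z) ∧ ∀ s n, G (s ⊗ₜ n) = tmulCox Λ N V n s := by
  let C : CoxRing Λ V ⊗[Γ(X, V)] Γ(N, V) ≃+ (preTensorCox Λ N).obj (op V) :=
    (TensorProduct.comm Γ(X, V) (CoxRing Λ V) Γ(N, V)).toAddEquiv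
  have hCs (c : Γ(X, V)) (z) : C (c • z) = c • C z :=
    (TensorProduct.comm Γ(X, V) (CoxRing Λ V) Γ(N, V)).map_smul c z
  let G : (preTensorCox Λ N).obj (op V) ≃+ Γ(tensorCox Λ N, V) := AddEquiv.ofBijective
    (toSheafify (preTensorCox Λ N) V)
    ((isGermLocalizing_preTensorCox N T i hV (D.isGermLocalizing i hV hVa)).toSheafify_bijective hVa)
  refine ⟨C.trans G, fun c z => ?_, fun s n => rfl⟩
  exact (congrArg G (hCs c z)).trans (toSheafify_smul' _ _ _ _)

/-- The differentials of the characteristic space over an affine open set. -/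
lemma exists_differentials_equiv_of_affine (D : LogDerivation T N) (i : T.Idx) {V : X.Opens}
    (hV : V ≤ T.opens i) (hVa : IsAffineOpen V) {W₀ : S'.Opens} (hW₀ : IsAffineOpen W₀)
    (e : charProj Λ ⁻¹ᵁ V ≤ q ⁻¹ᵁ W₀)
    (hq : ∀ c, ∃ b : Γ(X, V), q.appLE W₀ _ e c = (charProj Λ).app V b ∧ D.toFun i 0 hV b = 0)
    (hψ : ∃ ψ : Γ(N, V) →+ Γ(differentials q, charProj Λ ⁻¹ᵁ V),
      (∀ (c : Γ(X, V)) n, ψ (c • n) = (charProj Λ).app V c • ψ n) ∧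
      ∀ l c, ψ (D.toFun i l hV c) =
        coxForm q hVa (generator T i (-l) V hV) (c • generator T i l V hV)) :
    ∃ F : Γ(differentials q, charProj Λ ⁻¹ᵁ V) ≃+ Γ(tensorCox Λ N, V),
      (∀ (c : Γ(X, V)) z, F ((charProj Λ).app V c • z) = c • F z) ∧
      ∀ t l c, F (coxForm q hVa t (c • generator T i l V hV)) =
        tmulCox Λ N V (D.toFun i l hV c) (generator T i l V hV * t) := by
  obtain ⟨E, hE, hEd⟩ := exists_differentials_equiv_tensorProduct N q D i hV hVa hW₀ e hq hψ
  obtain ⟨G, hG, hGt⟩ := exists_tensorProduct_equiv_tensorCox N D i hV hVa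
  refine ⟨E.trans G, fun c z => ?_, fun t l c => ?_⟩
  · exact (congrArg G (hE c z)).trans (hG c _)
  · exact (congrArg G (hEd t l c)).trans (hGt _ _)

-- The transition function coming out of D moves across the tensor product and turns (f_i^λ)⁻¹ into
-- (f_j^λ)⁻¹; so the local formula does not depend on the member of the covering.
variable {N} in
lemma LogDerivation.tmulCox_change (D : LogDerivation T N) (i j : T.Idx) {V : X.Opens}
    (hV : V ≤ T.opens i) (hV' : V ≤ T.opens j) (l : Λ) (c : Γ(X, V)) (t : CoxRing Λ V) :
    tmulCox Λ N V (D.toFun i l hV ((transition T j i V (le_inf hV' hV) (.ofAdd l) : Γ(X, V)) * c))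
        (generator T i l V hV * t) =
      tmulCox Λ N V (D.toFun j l hV' c) (generator T j l V hV' * t) := by
  rw [D.toFun_change, tmulCox_smul, generator_eq_transition_smul T j hV' i hV, smul_mul_assoc]

/-- The direct image of the differentials of the characteristic space is a tensor product with the
Cox sheaf. -/
theorem exists_pushforward_differentials_iso (D : LogDerivation T N)
    (H : ∀ (i : T.Idx) (V : X.Opens) (hV : V ≤ T.opens i) (hVa : IsAffineOpen V),
      ∃ (W₀ : S'.Opens) (_ : IsAffineOpen W₀) (e : charProj Λ ⁻¹ᵁ V ≤ q ⁻¹ᵁ W₀),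
      (∀ c, ∃ b : Γ(X, V), q.appLE W₀ _ e c = (charProj Λ).app V b ∧ D.toFun i 0 hV b = 0) ∧
      ∃ ψ : Γ(N, V) →+ Γ(differentials q, charProj Λ ⁻¹ᵁ V),
        (∀ (c : Γ(X, V)) n, ψ (c • n) = (charProj Λ).app V c • ψ n) ∧
        ∀ l c, ψ (D.toFun i l hV c) =
          coxForm q hVa (generator T i (-l) V hV) (c • generator T i l V hV)) :
    ∃ φ : (Scheme.Modules.pushforward (charProj Λ)).obj (differentials q) ≅ tensorCox Λ N,
      ∀ (i : T.Idx) (l : Λ) (V : X.Opens) (hV : V ≤ T.opens i) (hVa : IsAffineOpen V)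
        (t : CoxRing Λ V) (c : Γ(X, V)),
        φ.hom.app V (coxForm q hVa t (c • generator T i l V hV)) =
          tmulCox Λ N V (D.toFun i l hV c) (generator T i l V hV * t) := by
  have key : ∀ V ∈ smallAffines T, ∃ F : Γ((Scheme.Modules.pushforward (charProj Λ)).obj
      (differentials q), V) ≃+ Γ(tensorCox Λ N, V), (∀ (c : Γ(X, V)) z, F (c • z) = c • F z) ∧
      ∀ (i : T.Idx) (l : Λ) (hV : V ≤ T.opens i) (hVa : IsAffineOpen V)
        (t : CoxRing Λ V) (c : Γ(X, V)),
        F (coxForm q hVa t (c • generator T i l V hV)) =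
          tmulCox Λ N V (D.toFun i l hV c) (generator T i l V hV * t) := by
    rintro V ⟨hVa, i, hV⟩
    obtain ⟨W₀, hW₀, e, hq, hψ⟩ := H i V hV hVa
    obtain ⟨F, hFs, hF⟩ := exists_differentials_equiv_of_affine N q D i hV hVa hW₀ e hq hψ
    -- F was built with the index i, but it satisfies the formula for every j with V ⊆ U_j; this
    -- makes the chosen local maps compatible with restriction.
    refine ⟨F, hFs, fun j l hV' _ t c => ?_⟩
    rw [← D.tmulCox_change i j hV hV', ← hF, generator_eq_transition_smul T j hV' i hV, smul_smul,
      mul_comm]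
    rfl
  choose F hFs hF using key
  obtain ⟨φ, hφ, -⟩ := exists_iso_of_basis (isBasis_smallAffines T) F hFs
    (fun V hV W hW h z => by
      obtain ⟨hVa, i, hVi⟩ := hV
      obtain ⟨W₀, hW₀, e, -, -⟩ := H i V hVi hVa
      refine addMonoidHom_eq_of_coxForm q i hVi hVa hW₀ e
        (F := (F W hW).toAddMonoidHom.comp (res (differentials q) ((charProj Λ).preimage_mono h)))
        (G := (res (tensorCox Λ N) h).comp (F V ⟨hVa, i, hVi⟩).toAddMonoidHom) (fun t l c => ?_) z
      refine (congrArg (F W hW) (res_coxForm q hVa hW.1 h t _)).trans ?_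
      rw [coxRestrict_smul, coxRestrict_generator, hF W hW i l (h.trans hVi)]
      refine Eq.trans ?_ (congrArg (res (tensorCox Λ N) h) (hF V _ i l hVi hVa t c)).symm
      rw [res_tmulCox, D.res_toFun, map_mul, coxRestrict_generator])
  exact ⟨φ, fun i l V hV hVa t c => (hφ V ⟨hVa, i, hV⟩ _).trans (hF V ⟨hVa, i, hV⟩ i l hV hVa t c)⟩

end LogDerivation

/-! ### The differentials of the characteristic space -/

lemma differentialsPush_d {X Y S : Scheme.{0}} (g : Y ⟶ X) (f : X ⟶ S) (V : X.Opens)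
    (c : Γ(X, V)) :
    (differentialsPush g f).app V (d f V c) = d (g ≫ f) (g ⁻¹ᵁ V) (g.app V c) :=
  differentialsDesc_d f _ _ _ _ _ V c

section Middle

variable {X S : Scheme.{0}} [IsIntegral X] (p : X ⟶ S) {Λ : AddSubgroup (CartierDivisor X)}
  (T : LocalEquations Λ)

lemma isGermLocalizing_differentials_of_isAffine [IsAffine S] {V : X.Opens}
    (hV : IsAffineOpen V) : IsGermLocalizing (differentials p).val V :=
  isGermLocalizing_differentials p hV (isAffineOpen_top S) le_top

/-! ### The splitting of ℛ_Λ and generators of its sections -/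

section Frame

variable [Module.Flat ℤ Λ] [IsAffine S] (i : T.Idx) {V : X.Opens} (hV : V ≤ T.opens i)
  (hVa : IsAffineOpen V)

include hVa in
/-- The splitting `ℛ_Λ = Ω_X ⊕ Λ_X` over affine open subsets of `U_i`. -/
lemma exists_frame_equiv : ∃ F : Γ(differentials p, V) × (Γ(X, V) ⊗[ℤ] Λ) ≃+ Γ(eulerSheaf p T, V),
    (∀ (a : Γ(X, V)) z, F (a • z) = a • F z) ∧
    ∀ w m, F (w, m) = toSheafify (preEuler p T) V (preFrame p T i hV w m) := by
  let F₀ : Γ(differentials p, V) × (Γ(X, V) ⊗[ℤ] Λ) →+ Γ(eulerSheaf p T, V) :=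
    (toSheafify (preEuler p T) V).comp
      (AddMonoidHom.mk' (fun z => preFrame p T i hV z.1 z.2) fun z z' =>
        preFrame_add p T i hV _ _ _ _)
  have hb := (isGermLocalizing_preEuler p T i hV hVa
    (isGermLocalizing_differentials_of_isAffine p hVa)).toSheafify_bijective hVa
  have hF₀ : Function.Bijective F₀ := by
    refine hb.comp ⟨fun z z' h => ?_, fun s => ?_⟩
    · have := frameSection_injective p T i hV h
      exact Prod.ext this.1 this.2
    · obtain ⟨w, m, h⟩ := exists_preFrame_eq p T i hV s
      exact ⟨(w, m), h⟩
  refine ⟨AddEquiv.ofBijective F₀ hF₀, fun a z => ?_, fun w m => rfl⟩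
  refine (congrArg (toSheafify (preEuler p T) V) (preFrame_smul p T i hV a z.1 z.2)).trans ?_
  exact toSheafify_smul' _ _ _ _

lemma eulerDifferential_zero (c : Γ(X, V)) :
    eulerDifferential T p i 0 V hV c =
      toSheafify (preEuler p T) V (preFrame p T i hV (d p V c) 0) := by
  rw [eulerDifferential_eq, TensorProduct.tmul_zero]

lemma d_one (f : X ⟶ S) (U : X.Opens) : d f U 1 = 0 := by
  have := d_mul f U 1 1
  rwa [one_mul, one_smul, left_eq_add] at this

lemma eulerDifferential_one (l : Λ) :
    eulerDifferential T p i l V hV 1 =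
      toSheafify (preEuler p T) V (preFrame p T i hV 0 (1 ⊗ₜ[ℤ] l)) := by
  rw [eulerDifferential_eq, d_one]

-- The first summand is generated by the (dc, 0), the values in degree zero, and the second by the
-- (0, 1 ⊗ λ), the values at 1 in degree λ.
include hVa in
lemma eulerDifferential_span :
    Submodule.span Γ(X, V) {n | ∃ l c, eulerDifferential T p i l V hV c = n} = ⊤ := by
  obtain ⟨F, hFs, hF⟩ := exists_frame_equiv p T i hV hVa
  refine Submodule.eq_top_iff'.2 fun n => ?_
  obtain ⟨⟨w, m⟩, rfl⟩ := F.surjective n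
  have h : ((w, m) : Γ(differentials p, V) × (Γ(X, V) ⊗[ℤ] Λ)) = (w, 0) + (0, m) := by
    rw [Prod.mk_add_mk, add_zero, zero_add]
  rw [h, map_add]
  refine Submodule.add_mem _ ?_ ?_
  · have hw : w ∈ Submodule.span Γ(X, V) (Set.range (d p V)) := by
      rw [d_span p hVa (isAffineOpen_top S) le_top]; exact Submodule.mem_top
    induction hw using Submodule.span_induction with
    | mem w hw =>
      obtain ⟨c, rfl⟩ := hw
      exact Submodule.subset_span ⟨0, c, (eulerDifferential_zero p T i hV c).trans (hF _ _).symm⟩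
    | zero =>
      rw [Prod.mk_zero_zero, map_zero]
      exact Submodule.zero_mem _
    | add a b _ _ ha hb =>
      rw [show ((a + b, 0) : Γ(differentials p, V) × (Γ(X, V) ⊗[ℤ] Λ)) = (a, 0) + (b, 0) by
        rw [Prod.mk_add_mk, add_zero], map_add]
      exact Submodule.add_mem _ (ha (by rw [Prod.mk_add_mk, add_zero, zero_add]))
        (hb (by rw [Prod.mk_add_mk, add_zero, zero_add]))
    | smul r a _ ha =>
      rw [show ((r • a, 0) : Γ(differentials p, V) × (Γ(X, V) ⊗[ℤ] Λ)) = r • (a, 0) by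
        rw [Prod.smul_mk, smul_zero], hFs]
      exact Submodule.smul_mem _ r (ha (by rw [Prod.mk_add_mk, add_zero, zero_add]))
  · clear h
    induction m using TensorProduct.induction_on with
    | zero =>
      rw [Prod.mk_zero_zero, map_zero]
      exact Submodule.zero_mem _
    | add a b ha hb =>
      rw [show ((0, a + b) : Γ(differentials p, V) × (Γ(X, V) ⊗[ℤ] Λ)) = (0, a) + (0, b) by
        rw [Prod.mk_add_mk, add_zero], map_add]
      exact Submodule.add_mem _ ha hb
    | tmul c l =>
      rw [show ((0, c ⊗ₜ[ℤ] l) : Γ(differentials p, V) × (Γ(X, V) ⊗[ℤ] Λ)) =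
        c • (0, 1 ⊗ₜ[ℤ] l) by
          rw [Prod.smul_mk, smul_zero, TensorProduct.smul_tmul', smul_eq_mul, mul_one], hFs]
      exact Submodule.smul_mem _ c (Submodule.subset_span
        ⟨l, 1, (eulerDifferential_one p T i hV l).trans (hF _ _).symm⟩)

end Frame

/-- The derivation of the Cox sheaf with values in `ℛ_Λ`. -/
def eulerLogDerivation [Module.Flat ℤ Λ] [IsAffine S] : LogDerivation T (eulerSheaf p T) where
  toFun i l V hV := AddMonoidHom.mk' (eulerDifferential T p i l V hV)
    (eulerDifferential_add p T i hV l)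
  map_mul i l m V hV s t := eulerDifferential_mul p T i hV l m s t
  res_toFun i l V W hV h s := res_eulerDifferential p T i hV h l s
  toFun_change i j l V hV hV' s := eulerDifferential_change p T i hV j hV' l s
  isGermLocalizing i V hV hVa := (isGermLocalizing_preEuler p T i hV hVa
    (isGermLocalizing_differentials_of_isAffine p hVa)).sheafify hVa
  span_eq_top i V hV hVa := eulerDifferential_span p T i hV hVa

/-- The section of `Λ_X` defined by a section of `𝒪_X ⊗ Λ`. -/
def latticeSection (V : X.Opens) : Γ(X, V) ⊗[ℤ] Λ →+ Γ(latticeSheaf Λ, V) :=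
  toSheafify (preLattice Λ) V

lemma latticeSection_smul (V : X.Opens) (a : Γ(X, V)) (m : Γ(X, V) ⊗[ℤ] Λ) :
    latticeSection V (a • m) = a • latticeSection V m :=
  toSheafify_smul' _ _ _ _

lemma latticeSection_bijective [Module.Flat ℤ Λ] {V : X.Opens} (hVa : IsAffineOpen V) :
    Function.Bijective (latticeSection (Λ := Λ) V) :=
  (isGermLocalizing_preLattice hVa).toSheafify_bijective hVa

lemma latticeSection_span [Module.Flat ℤ Λ] {V : X.Opens} (hVa : IsAffineOpen V) :
    Submodule.span Γ(X, V) {n | ∃ l c, latticeSection (Λ := Λ) V (c ⊗ₜ l) = n} = ⊤ := by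
  refine Submodule.eq_top_iff'.2 fun n => ?_
  obtain ⟨m, rfl⟩ := (latticeSection_bijective hVa).2 n
  induction m using TensorProduct.induction_on with
  | zero =>
    rw [map_zero]
    exact Submodule.zero_mem _
  | add a b ha hb =>
    rw [map_add]
    exact Submodule.add_mem _ ha hb
  | tmul c l => exact Submodule.subset_span ⟨l, c, rfl⟩

/-- The derivation of the Cox sheaf with values in `Λ_X`. -/
def latticeLogDerivation [Module.Flat ℤ Λ] : LogDerivation T (latticeSheaf Λ) where
  toFun i l V hV := (latticeSection V).comp ((TensorProduct.mk ℤ Γ(X, V) Λ).flip l).toAddMonoidHom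
  map_mul i l m V hV s t := by
    change latticeSection V ((s * t) ⊗ₜ (l + m)) =
      s • latticeSection V (t ⊗ₜ m) + t • latticeSection V (s ⊗ₜ l)
    rw [← latticeSection_smul, ← latticeSection_smul, ← map_add, TensorProduct.smul_tmul',
      TensorProduct.smul_tmul', smul_eq_mul, smul_eq_mul, mul_comm t s, TensorProduct.tmul_add,
      add_comm (_ ⊗ₜ[ℤ] l)]
  res_toFun i l V W hV h s := res_toSheafify (preLattice Λ) h _
  toFun_change i j l V hV hV' s := by
    change latticeSection V ((_ * s) ⊗ₜ l) = _ • latticeSection V (s ⊗ₜ l)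
    rw [← latticeSection_smul, TensorProduct.smul_tmul', smul_eq_mul]
  isGermLocalizing i V hV hVa := (isGermLocalizing_preLattice hVa).sheafify hVa
  span_eq_top i V hV hVa := latticeSection_span hVa

/-! ### Logarithmic forms of the generators -/

section LogForm

variable {T} {S' : Scheme.{0}} (q : charSpace Λ ⟶ S') (i : T.Idx) {V : X.Opens}
  (hV : V ≤ T.opens i) (hVa : IsAffineOpen V)

lemma smul_coxForm (t t' s : CoxRing Λ V) :
    coxFunction Λ ⟨V, hVa⟩ t' • coxForm q hVa t s = coxForm q hVa (t' * t) s := by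
  rw [coxForm, coxForm, map_mul, mul_smul]

lemma coxForm_mul (t s s' : CoxRing Λ V) :
    coxForm q hVa t (s * s') = coxForm q hVa (t * s) s' + coxForm q hVa (t * s') s := by
  rw [coxForm, coxForm, coxForm, map_mul, d_mul, map_mul, map_mul, mul_smul, mul_smul, smul_add]

/-- The logarithmic derivative of a product of units is the sum of the logarithmic derivatives. -/
lemma coxForm_generator_add (l m : Λ) :
    coxForm q hVa (generator T i (-(l + m)) V hV) (generator T i (l + m) V hV) =
      coxForm q hVa (generator T i (-l) V hV) (generator T i l V hV) +
        coxForm q hVa (generator T i (-m) V hV) (generator T i m V hV) := by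
  have h (l : Λ) : generator T i (-l) V hV * generator T i l V hV = 1 := by
    rw [← generator_add, neg_add_cancel, generator_zero]
  have hn : generator T i (-(l + m)) V hV = generator T i (-l) V hV * generator T i (-m) V hV := by
    rw [← generator_add]
    exact congrArg (fun k => generator T i k V hV) (neg_add l m)
  rw [hn, generator_add, coxForm_mul, mul_right_comm, h, one_mul, mul_assoc, h, mul_one, add_comm]

/-- `λ ↦ f_i^λ · d (f_i^λ)⁻¹`. -/
def logForm : Λ →+ Γ((Scheme.Modules.pushforward (charProj Λ)).obj (differentials q), V) :=
  AddMonoidHom.mk' (fun l => coxForm q hVa (generator T i (-l) V hV) (generator T i l V hV))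
    fun l m => coxForm_generator_add q i hV hVa l m

/-- The Leibniz rule e⁻¹ d(c e) = dc + c · e⁻¹ de. It splits the form into the two parts matching
Ω_X and Λ_X. -/
lemma coxForm_smul_generator (l : Λ) (c : Γ(X, V)) :
    coxForm q hVa (generator T i (-l) V hV) (c • generator T i l V hV) =
      d q (charProj Λ ⁻¹ᵁ V) ((charProj Λ).app V c) +
        (show Γ(differentials q, charProj Λ ⁻¹ᵁ V) from c • logForm q i hV hVa l) := by
  have h : generator T i (-l) V hV * generator T i l V hV = 1 := by
    rw [← generator_add, neg_add_cancel, generator_zero]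
  rw [Algebra.smul_def, coxForm_mul, mul_comm _ (algebraMap _ _ _), h, add_comm]
  refine congrArg₂ (· + ·) ?_ ?_
  · rw [coxForm, map_one, one_smul]
    exact congrArg (d q (charProj Λ ⁻¹ᵁ V)) (coxFunction_coxAlgebraMap Λ ⟨V, hVa⟩ c)
  · rw [← smul_coxForm]
    exact congrArg (· • coxForm q hVa _ _) (coxFunction_coxAlgebraMap Λ ⟨V, hVa⟩ c)

/-- The `𝒪_X`-linear extension of `logForm`. -/
def logFormLin : Γ(X, V) ⊗[ℤ] Λ →ₗ[Γ(X, V)]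
    Γ((Scheme.Modules.pushforward (charProj Λ)).obj (differentials q), V) :=
  (logForm q i hV hVa).toIntLinearMap.liftBaseChange Γ(X, V)

lemma logFormLin_tmul (c : Γ(X, V)) (l : Λ) :
    logFormLin q i hV hVa (c ⊗ₜ l) = c • logForm q i hV hVa l :=
  LinearMap.liftBaseChange_tmul ..

end LogForm

/-- The isomorphism `π_* Ω_Ŷ ≅ ℛ_Λ ⊗ 𝒮̂_Λ`. -/
theorem exists_pushforward_differentials_iso_euler [Module.Flat ℤ Λ] [IsAffine S] :
    ∃ φ : (Scheme.Modules.pushforward (charProj Λ)).obj (differentials (charProj Λ ≫ p)) ≅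
        tensorCox Λ (eulerSheaf p T),
      ∀ (i : T.Idx) (l : Λ) (V : X.Opens) (hV : V ≤ T.opens i) (hVa : IsAffineOpen V)
        (t : CoxRing Λ V) (c : Γ(X, V)),
        φ.hom.app V (coxForm (charProj Λ ≫ p) hVa t (c • generator T i l V hV)) =
          tmulCox Λ (eulerSheaf p T) V (eulerDifferential T p i l V hV c)
            (generator T i l V hV * t) := by
  refine exists_pushforward_differentials_iso (eulerSheaf p T) (charProj Λ ≫ p)
    (eulerLogDerivation p T) fun i V hV hVa =>
      ⟨⊤, isAffineOpen_top S,
        (show charProj Λ ⁻¹ᵁ V ≤ (charProj Λ ≫ p) ⁻¹ᵁ ⊤ from le_top), fun c => ?_, ?_⟩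
  · refine ⟨p.appLE ⊤ V le_top c, ?_, ?_⟩
    · rw [Scheme.Hom.app_eq_appLE]
      exact congr($(Scheme.Hom.appLE_comp_appLE (charProj Λ) p ⊤ V (charProj Λ ⁻¹ᵁ V)
        le_top le_rfl) c).symm
    · refine (eulerDifferential_zero p T i hV _).trans ?_
      refine (congrArg (fun z => toSheafify (preEuler p T) V (preFrame p T i hV z 0))
        (d_appLE p V le_top c)).trans ?_
      exact (congrArg (toSheafify (preEuler p T) V) (preFrame_zero p T i hV)).trans
        (map_zero (toSheafify (preEuler p T) V))
  · obtain ⟨F, hFs, hF⟩ := exists_frame_equiv p T i hV hVa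
    -- The inverse on generators: a form on X is pulled back and λ goes to the logarithmic form of
    -- (f_i^λ)⁻¹.
    let ψ₀ : Γ(differentials p, V) × (Γ(X, V) ⊗[ℤ] Λ) →+
        Γ((Scheme.Modules.pushforward (charProj Λ)).obj (differentials (charProj Λ ≫ p)), V) :=
      AddMonoidHom.coprod ((differentialsPush (charProj Λ) p).app V).hom
        (logFormLin (charProj Λ ≫ p) i hV hVa).toAddMonoidHom
    have hψ₀ (c : Γ(X, V)) (z) : ψ₀ (c • z) = c • ψ₀ z := by
      refine (congrArg₂ (· + ·) (Scheme.Modules.Hom.app_smul (differentialsPush (charProj Λ) p) c z.1)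
        (map_smul (logFormLin (charProj Λ ≫ p) i hV hVa) c z.2)).trans ?_
      exact (smul_add c _ _).symm
    refine ⟨ψ₀.comp F.symm.toAddMonoidHom, fun c n => ?_, fun l c => ?_⟩
    · obtain ⟨z, rfl⟩ := F.surjective n
      have h1 : F.symm (c • F z) = c • z := by rw [← hFs, F.symm_apply_apply]
      refine (congrArg ψ₀ h1).trans ((hψ₀ c z).trans ?_)
      exact congrArg (fun y => (charProj Λ).app V c •
        (show Γ(differentials (charProj Λ ≫ p), charProj Λ ⁻¹ᵁ V) from ψ₀ y))
        (F.symm_apply_apply z).symm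
    · change ψ₀ (F.symm (eulerDifferential T p i l V hV c)) = _
      rw [eulerDifferential_eq, ← hF, F.symm_apply_apply, coxForm_smul_generator]
      refine congrArg₂ (· + ·) ?_ (logFormLin_tmul _ i hV hVa c l)
      exact differentialsPush_d (charProj Λ) p V c

/-- The isomorphism `π_* Ω_{Ŷ/X} ≅ Λ_X ⊗ 𝒮̂_Λ`. -/
theorem exists_pushforward_differentials_iso_lattice [Module.Flat ℤ Λ] :
    ∃ γ : (Scheme.Modules.pushforward (charProj Λ)).obj (differentials (charProj Λ)) ≅
        tensorCox Λ (latticeSheaf Λ),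
      ∀ (i : T.Idx) (l : Λ) (V : X.Opens) (hV : V ≤ T.opens i) (hVa : IsAffineOpen V)
        (t : CoxRing Λ V) (c : Γ(X, V)),
        γ.hom.app V (coxForm (charProj Λ) hVa t (c • generator T i l V hV)) =
          tmulCox Λ (latticeSheaf Λ) V (latticeSection V (c ⊗ₜ l))
            (generator T i l V hV * t) := by
  refine exists_pushforward_differentials_iso (latticeSheaf Λ) (charProj Λ)
    -- Relative to X the base functions over V are all c in 𝒪_X(V), and they are killed because c ⊗
    -- 0 = 0.
    (latticeLogDerivation T) fun i V hV hVa => ⟨V, hVa, le_rfl, fun c => ⟨c, ?_, ?_⟩, ?_⟩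
  · rw [Scheme.Hom.app_eq_appLE]
  · change latticeSection V (c ⊗ₜ 0) = 0
    rw [TensorProduct.tmul_zero, map_zero]
  · let F := AddEquiv.ofBijective _ (latticeSection_bijective (Λ := Λ) hVa)
    have hFs (c : Γ(X, V)) (z) : F (c • z) = c • F z := latticeSection_smul V c z
    refine ⟨(logFormLin (charProj Λ) i hV hVa).toAddMonoidHom.comp F.symm.toAddMonoidHom,
      fun c n => ?_, fun l c => ?_⟩
    · obtain ⟨z, rfl⟩ := F.surjective n
      have h1 : F.symm (c • F z) = c • z := by rw [← hFs, F.symm_apply_apply]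
      refine (congrArg (logFormLin (charProj Λ) i hV hVa) h1).trans
        ((map_smul (logFormLin (charProj Λ) i hV hVa) c z).trans ?_)
      exact congrArg (fun y => (charProj Λ).app V c •
        (show Γ(differentials (charProj Λ), charProj Λ ⁻¹ᵁ V) from
          logFormLin (charProj Λ) i hV hVa y)) (F.symm_apply_apply z).symm
    · change logFormLin (charProj Λ) i hV hVa (F.symm (F (c ⊗ₜ l))) = _
      rw [F.symm_apply_apply, coxForm_smul_generator, Scheme.Hom.app_eq_appLE, d_appLE, zero_add]
      exact logFormLin_tmul _ i hV hVa c l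

end Middle

/-! ### Sections of inverse images -/

section Pullback

variable {Y X : Scheme.{0}} (g : Y ⟶ X) (M : X.Modules)

/-- The section `g^* m` of `g^* M`. -/
def pullbackSection (V : X.Opens) :
    Γ(M, V) →+ Γ((Scheme.Modules.pullback g).obj M, g ⁻¹ᵁ V) :=
  (((Scheme.Modules.pullbackPushforwardAdjunction g).unit.app M).app V).hom

lemma pullbackSection_smul (V : X.Opens) (c : Γ(X, V)) (m : Γ(M, V)) :
    pullbackSection g M V (c • m) = g.app V c • pullbackSection g M V m :=
  Scheme.Modules.Hom.app_smul ((Scheme.Modules.pullbackPushforwardAdjunction g).unit.app M) c m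

lemma res_pullbackSection {V W : X.Opens} (h : W ≤ V) (m : Γ(M, V)) :
    res ((Scheme.Modules.pullback g).obj M) (g.preimage_mono h) (pullbackSection g M V m) =
      pullbackSection g M W (res M h m) :=
  res_app ((Scheme.Modules.pullbackPushforwardAdjunction g).unit.app M) h m

/-- The sections of `g^* M` over `W` which are linear combinations of sections `g^* m`. -/
def pullbackSpan (W : Y.Opens) : Submodule Γ(Y, W) Γ((Scheme.Modules.pullback g).obj M, W) :=
  Submodule.span Γ(Y, W) {n | ∃ (V : X.Opens) (e : W ≤ g ⁻¹ᵁ V) (m : Γ(M, V)),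
    res ((Scheme.Modules.pullback g).obj M) e (pullbackSection g M V m) = n}

lemma res_mem_pullbackSpan {W W' : Y.Opens} (h : W' ≤ W)
    {z : Γ((Scheme.Modules.pullback g).obj M, W)} (hz : z ∈ pullbackSpan g M W) :
    res ((Scheme.Modules.pullback g).obj M) h z ∈ pullbackSpan g M W' := by
  induction hz using Submodule.span_induction with
  | mem z hz =>
    obtain ⟨V, e, m, rfl⟩ := hz
    exact Submodule.subset_span ⟨V, h.trans e, m, (res_res _ _ _ _).symm⟩
  | zero =>
    rw [map_zero]
    exact Submodule.zero_mem _
  | add a b _ _ ha hb =>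
    rw [map_add]
    exact Submodule.add_mem _ ha hb
  | smul c a _ ha =>
    rw [res_smul]
    exact Submodule.smul_mem _ _ ha

/-- The presheaf of abelian groups underlying `prePullbackSpan`. -/
def pullbackSpanAb : Y.Opensᵒᵖ ⥤ Ab where
  obj W := .of (pullbackSpan g M W.unop)
  map e := AddCommGrpCat.ofHom (AddMonoidHom.mk'
    (fun z => ⟨res _ e.unop.le z.1, res_mem_pullbackSpan g M e.unop.le z.2⟩)
    fun a b => Subtype.ext (map_add (res _ e.unop.le) a.1 b.1))
  map_id W := by
    refine AddCommGrpCat.hom_ext (AddMonoidHom.ext fun z => Subtype.ext ?_)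
    exact res_self _ _ _
  map_comp e e' := by
    refine AddCommGrpCat.hom_ext (AddMonoidHom.ext fun z => Subtype.ext ?_)
    exact (res_res _ e.unop.le e'.unop.le _).symm

instance (W : Y.Opensᵒᵖ) : Module (Y.ringCatSheaf.obj.obj W) ((pullbackSpanAb g M).obj W) :=
  inferInstanceAs (Module Γ(Y, W.unop) (pullbackSpan g M W.unop))

/-- The presheaf of linear combinations of sections `g^* m`. -/
def prePullbackSpan : Y.PresheafOfModules :=
  PresheafOfModules.ofPresheaf (pullbackSpanAb g M) fun _ _ e a z =>
    Subtype.ext (res_smul _ e.unop.le a z.1)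

/-- The inclusion in `g^* M`. -/
def prePullbackSpanIncl : prePullbackSpan g M ⟶ ((Scheme.Modules.pullback g).obj M).val :=
  PresheafOfModules.homMk
    { app W := AddCommGrpCat.ofHom (X := (prePullbackSpan g M).presheaf.obj W)
        (Y := ((Scheme.Modules.pullback g).obj M).presheaf.obj W)
        (pullbackSpan g M W.unop).toAddSubgroup.subtype
      naturality _ _ _ := rfl }
    (fun _ _ _ => rfl)

/-- The element `g^* m` of the presheaf `prePullbackSpan`. -/
def prePullbackSection (V : X.Opens) : Γ(M, V) →+ (prePullbackSpan g M).obj (op (g ⁻¹ᵁ V)) :=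
  AddMonoidHom.codRestrict (pullbackSection g M V) (pullbackSpan g M (g ⁻¹ᵁ V)).toAddSubgroup
    fun m => Submodule.subset_span ⟨V, le_rfl, m, res_self _ _ _⟩

/-- `M ⟶ g_* N`, where `N` is the sheaf associated with `prePullbackSpan`. -/
def toPushforwardSpan : M ⟶ (Scheme.Modules.pushforward g).obj (sheafify (prePullbackSpan g M)) :=
  homOfSections
    (fun V => (toSheafify (prePullbackSpan g M) (g ⁻¹ᵁ V)).comp (prePullbackSection g M V))
    (fun V a m => by
      have : prePullbackSection g M V (a • m) = g.app V a • prePullbackSection g M V m :=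
        Subtype.ext (pullbackSection_smul g M V a m)
      exact (congrArg (toSheafify (prePullbackSpan g M) (g ⁻¹ᵁ V)) this).trans
        (toSheafify_smul' _ _ _ _))
    (fun V W h m => by
      have : prePullbackSection g M W (res M h m) =
          resP (prePullbackSpan g M) (g.preimage_mono h) (prePullbackSection g M V m) :=
        Subtype.ext (res_pullbackSection g M h m).symm
      exact (congrArg (toSheafify (prePullbackSpan g M) (g ⁻¹ᵁ W)) this).trans
        (res_toSheafify (prePullbackSpan g M) (g.preimage_mono h) _).symm)

/-- The unit M → g_* g^* M takes values in linear combinations of pulled-back sections, hence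
factors through their sheaf. By adjunction g^* M becomes a retract of that sheaf. -/
lemma toPushforwardSpan_comp : toPushforwardSpan g M ≫
    (Scheme.Modules.pushforward g).map (sheafifyDesc (prePullbackSpanIncl g M)) =
      (Scheme.Modules.pullbackPushforwardAdjunction g).unit.app M := by
  refine Scheme.Modules.hom_ext _ _ fun V => ?_
  ext m
  exact sheafifyDesc_app (prePullbackSpanIncl g M) (g ⁻¹ᵁ V) (prePullbackSection g M V m)

/-- Locally, the sections of `g^* M` are linear combinations of sections `g^* m`. -/
lemma exists_res_mem_pullbackSpan {W : Y.Opens} (z : Γ((Scheme.Modules.pullback g).obj M, W))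
    {y : Y} (hy : y ∈ W) : ∃ (W' : Y.Opens) (e : W' ≤ W), y ∈ W' ∧
      res ((Scheme.Modules.pullback g).obj M) e z ∈ pullbackSpan g M W' := by
  let adj := Scheme.Modules.pullbackPushforwardAdjunction g
  let s := sheafifyDesc (prePullbackSpanIncl g M)
  let t : (Scheme.Modules.pullback g).obj M ⟶ sheafify (prePullbackSpan g M) :=
    (adj.homEquiv _ _).symm (toPushforwardSpan g M)
  -- Under the adjunction both sides correspond to the unit. So every section of g^* M is the image
  -- under s of a section of the sheaf of linear combinations, and locally it is such a combination.
  have hts : t ≫ s = 𝟙 _ := by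
    refine (adj.homEquiv _ _).injective ?_
    rw [adj.homEquiv_naturality_right, Equiv.apply_symm_apply, adj.homEquiv_id]
    exact toPushforwardSpan_comp g M
  obtain ⟨W', e, n, hyW', hn⟩ := exists_res_eq_toSheafify (prePullbackSpan g M) (t.app W z) hy
  refine ⟨W', e, hyW', ?_⟩
  have h1 : s.app W (t.app W z) = z := congr(($hts).app W z)
  rw [← h1, res_app, hn]
  refine Set.mem_of_eq_of_mem (sheafifyDesc_app (prePullbackSpanIncl g M) W' n) ?_
  exact n.2

end Pullback

/-! ### The tensor product of the generalized Euler sequence with the Cox sheaf -/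

section EulerRow

variable {X S : Scheme.{0}} [IsIntegral X] (p : X ⟶ S) {Λ : AddSubgroup (CartierDivisor X)}
  (T : LocalEquations Λ)

section Local

variable [Module.Flat ℤ Λ] [IsAffine S] {i : T.Idx} {V : X.Opens} (hV : V ≤ T.opens i)
  (hVa : IsAffineOpen V)

include hV hVa

lemma eulerFst_app_injective : Function.Injective ((eulerFst p T).app V) := by
  obtain ⟨F, -, hF⟩ := exists_frame_equiv p T i hV hVa
  intro w w' h
  rw [eulerFst_app p T i hV, eulerFst_app p T i hV, ← hF, ← hF] at h
  exact congrArg Prod.fst (F.injective h)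

lemma exists_eulerFst_app_eq {n : Γ(eulerSheaf p T, V)} (hn : (eulerSnd p T).app V n = 0) :
    ∃ w, (eulerFst p T).app V w = n := by
  obtain ⟨F, -, hF⟩ := exists_frame_equiv p T i hV hVa
  obtain ⟨⟨w, m⟩, rfl⟩ := F.surjective n
  rw [hF, eulerSnd_app_toSheafify] at hn
  have hm : m = 0 := (latticeSection_bijective (Λ := Λ) hVa).1
    (Eq.trans hn (map_zero (latticeSection V)).symm)
  refine ⟨w, ?_⟩
  rw [eulerFst_app p T i hV, hF, hm]

lemma eulerSnd_app_surjective : Function.Surjective ((eulerSnd p T).app V) := by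
  intro n
  obtain ⟨m, rfl⟩ := (latticeSection_bijective (Λ := Λ) hVa).2 n
  exact ⟨_, eulerSnd_app_toSheafify p T i hV 0 m⟩

lemma eulerSnd_app_eulerFst_app (w : Γ(differentials p, V)) :
    (eulerSnd p T).app V ((eulerFst p T).app V w) = 0 := by
  rw [eulerFst_app p T i hV, eulerSnd_app_toSheafify]
  exact map_zero (toSheafify (preLattice Λ) V)

end Local

/-- Left exactness passes to finitely supported families. Injectivity of f forces the chosen
preimage of 0 to be 0, so the support stays finite. -/
lemma exists_mapRange_eq {ι A B C : Type*} [AddCommGroup A] [AddCommGroup B] [AddCommGroup C]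
    (f : A →+ B) (g : B →+ C) (hf : Function.Injective f) (hfg : ∀ b, g b = 0 → ∃ a, f a = b)
    (b : ι →₀ B) (hb : b.mapRange g (map_zero g) = 0) :
    ∃ a : ι →₀ A, a.mapRange f (map_zero f) = b := by
  have h0 : Function.invFun f 0 = 0 := by
    have := Function.leftInverse_invFun hf 0
    rwa [map_zero] at this
  refine ⟨b.mapRange (Function.invFun f) h0, Finsupp.ext fun k => ?_⟩
  rw [Finsupp.mapRange_apply, Finsupp.mapRange_apply]
  exact Function.invFun_eq (hfg _ (by simpa using! DFunLike.congr_fun hb k))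

lemma tmulSum_bijective_euler [Module.Flat ℤ Λ] [IsAffine S] {i : T.Idx} {V : X.Opens}
    (hV : V ≤ T.opens i) (hVa : IsAffineOpen V) :
    Function.Bijective (tmulSum (eulerSheaf p T) T i hV) :=
  tmulSum_bijective _ T i hV hVa ((eulerLogDerivation p T).isGermLocalizing i hV hVa)

lemma tmulSum_bijective_lattice [Module.Flat ℤ Λ] {i : T.Idx} {V : X.Opens}
    (hV : V ≤ T.opens i) (hVa : IsAffineOpen V) :
    Function.Bijective (tmulSum (latticeSheaf Λ) T i hV) :=
  tmulSum_bijective _ T i hV hVa ((latticeLogDerivation T).isGermLocalizing i hV hVa)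

lemma tmulSum_bijective_differentials [IsAffine S] {i : T.Idx} {V : X.Opens}
    (hV : V ≤ T.opens i) (hVa : IsAffineOpen V) :
    Function.Bijective (tmulSum (differentials p) T i hV) :=
  tmulSum_bijective _ T i hV hVa (isGermLocalizing_differentials_of_isAffine p hVa)

variable [Module.Flat ℤ Λ] [IsAffine S]

lemma eulerRowFst_app_injective {V : X.Opens} (hV : V ∈ smallAffines T) :
    Function.Injective ((eulerRowFst p T).app V) := by
  obtain ⟨hVa, i, hVi⟩ := hV
  intro z z' h
  obtain ⟨b, rfl⟩ := (tmulSum_bijective_differentials p T hVi hVa).2 z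
  obtain ⟨b', rfl⟩ := (tmulSum_bijective_differentials p T hVi hVa).2 z'
  rw [eulerRowFst, tensorCoxMap_tmulSum, tensorCoxMap_tmulSum] at h
  exact congrArg _ (Finsupp.mapRange_injective _ _ (eulerFst_app_injective p T hVi hVa)
    ((tmulSum_bijective_euler p T hVi hVa).1 h))

lemma eulerRow_comp : eulerRowFst p T ≫ eulerRowSnd p T = 0 := by
  refine hom_ext_of_basis (isBasis_smallAffines T) fun V hV z => ?_
  obtain ⟨hVa, i, hVi⟩ := hV
  obtain ⟨b, rfl⟩ := (tmulSum_bijective_differentials p T hVi hVa).2 z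
  change (tensorCoxMap Λ (eulerSnd p T)).app V ((tensorCoxMap Λ (eulerFst p T)).app V _) = 0
  rw [tensorCoxMap_tmulSum, tensorCoxMap_tmulSum]
  refine (congrArg (tmulSum (latticeSheaf Λ) T i hVi) (Finsupp.ext fun l => ?_)).trans (map_zero _)
  rw [Finsupp.mapRange_apply, Finsupp.mapRange_apply]
  exact eulerSnd_app_eulerFst_app p T hVi hVa _

/-- The generalized Euler sequence tensored with the Cox sheaf is exact. -/
theorem eulerRow_shortExact :
    (ShortComplex.mk (eulerRowFst p T) (eulerRowSnd p T) (eulerRow_comp p T)).ShortExact := by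
  refine shortExact_of_basis (isBasis_smallAffines T) _
    (fun V hV => eulerRowFst_app_injective p T hV) ?_ ?_
  · rintro V ⟨hVa, i, hVi⟩ n hn
    obtain ⟨b, rfl⟩ := (tmulSum_bijective_euler p T hVi hVa).2 n
    rw [eulerRowSnd, tensorCoxMap_tmulSum] at hn
    obtain ⟨a, rfl⟩ := exists_mapRange_eq ((eulerFst p T).app V).hom ((eulerSnd p T).app V).hom
      (eulerFst_app_injective p T hVi hVa) (fun b => exists_eulerFst_app_eq p T hVi hVa) b
      ((tmulSum_bijective_lattice T hVi hVa).1 (hn.trans (map_zero _).symm))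
    exact ⟨tmulSum (differentials p) T i hVi a, tensorCoxMap_tmulSum _ T i hVi _ a⟩
  · rintro V ⟨hVa, i, hVi⟩ n
    obtain ⟨b, rfl⟩ := (tmulSum_bijective_lattice T hVi hVa).2 n
    obtain ⟨a, rfl⟩ := Finsupp.mapRange_surjective (α := Λ) ((eulerSnd p T).app V) (map_zero _)
      (eulerSnd_app_surjective p T hVi hVa) b
    exact ⟨tmulSum (eulerSheaf p T) T i hVi a, tensorCoxMap_tmulSum _ T i hVi _ a⟩

end EulerRow

/-! ### The direct image of the inverse image -/

section PullbackForms

variable {X S : Scheme.{0}} [IsIntegral X] {Λ : AddSubgroup (CartierDivisor X)} (M : X.Modules)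

/-- The section `t · π^* m` of `π^* M`. -/
def pullForm {V : X.Opens} (hVa : IsAffineOpen V) (t : CoxRing Λ V) (m : Γ(M, V)) :
    Γ((Scheme.Modules.pullback (charProj Λ)).obj M, charProj Λ ⁻¹ᵁ V) :=
  coxFunction Λ ⟨V, hVa⟩ t • pullbackSection (charProj Λ) M V m

lemma pullForm_add {V : X.Opens} (hVa : IsAffineOpen V) (t : CoxRing Λ V) (m m' : Γ(M, V)) :
    pullForm M hVa t (m + m') = pullForm M hVa t m + pullForm M hVa t m' := by
  rw [pullForm, map_add, smul_add]
  rfl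

lemma add_pullForm {V : X.Opens} (hVa : IsAffineOpen V) (t t' : CoxRing Λ V) (m : Γ(M, V)) :
    pullForm M hVa (t + t') m = pullForm M hVa t m + pullForm M hVa t' m := by
  rw [pullForm, map_add, add_smul]
  rfl

lemma smul_pullForm {V : X.Opens} (hVa : IsAffineOpen V) (t t' : CoxRing Λ V) (m : Γ(M, V)) :
    pullForm M hVa (t * t') m = coxFunction Λ ⟨V, hVa⟩ t • pullForm M hVa t' m := by
  rw [pullForm, map_mul, mul_smul]
  rfl

lemma pullForm_smul {V : X.Opens} (hVa : IsAffineOpen V) (c : Γ(X, V)) (t : CoxRing Λ V)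
    (m : Γ(M, V)) : pullForm M hVa (c • t) m = pullForm M hVa t (c • m) := by
  rw [pullForm, pullForm, pullbackSection_smul, smul_smul, Algebra.smul_def, mul_comm, map_mul]
  exact congrArg (fun z => (_ * z) • _) (coxFunction_coxAlgebraMap Λ ⟨V, hVa⟩ c)

lemma res_pullForm {V W : X.Opens} (hVa : IsAffineOpen V) (hWa : IsAffineOpen W) (h : W ≤ V)
    (t : CoxRing Λ V) (m : Γ(M, V)) :
    res ((Scheme.Modules.pullback (charProj Λ)).obj M) ((charProj Λ).preimage_mono h)
        (pullForm M hVa t m) =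
      pullForm M hWa (coxRestrict Λ h t) (res M h m) := by
  rw [pullForm, res_smul, res_pullbackSection]
  exact congrArg (· • _) (resO_coxFunction Λ (U := ⟨V, hVa⟩) (V := ⟨W, hWa⟩) h t)

/-- The map `t ⊗ m ↦ t · π^* m`. -/
def pullTensor {V : X.Opens} (hVa : IsAffineOpen V) :
    CoxRing Λ V ⊗[Γ(X, V)] Γ(M, V) →+
      Γ((Scheme.Modules.pullback (charProj Λ)).obj M, charProj Λ ⁻¹ᵁ V) :=
  TensorProduct.liftAddHom
    (AddMonoidHom.mk' (fun t => AddMonoidHom.mk' (pullForm M hVa t) (pullForm_add M hVa t))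
      fun t t' => AddMonoidHom.ext fun m => add_pullForm M hVa t t' m)
    fun c t m => pullForm_smul M hVa c t m

lemma pullTensor_tmul {V : X.Opens} (hVa : IsAffineOpen V) (t : CoxRing Λ V) (m : Γ(M, V)) :
    pullTensor M hVa (t ⊗ₜ m) = pullForm M hVa t m := rfl

lemma pullTensor_smul {V : X.Opens} (hVa : IsAffineOpen V) (r : CoxRing Λ V)
    (z : CoxRing Λ V ⊗[Γ(X, V)] Γ(M, V)) :
    pullTensor M hVa (r • z) = coxFunctionEquiv Λ hVa r • pullTensor M hVa z := by
  induction z using TensorProduct.induction_on with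
  | zero => rw [smul_zero, map_zero, smul_zero]
  | add a b ha hb => rw [smul_add, map_add, map_add, ha, hb, smul_add]
  | tmul t m =>
    rw [TensorProduct.smul_tmul', pullTensor_tmul, pullTensor_tmul, smul_eq_mul, smul_pullForm]
    rfl

lemma resO_app {Y X : Scheme.{0}} (g : Y ⟶ X) {V W : X.Opens} (h : W ≤ V) (c : Γ(X, V)) :
    resO (g.preimage_mono h) (g.app V c) = g.app W (resO h c) :=
  congr($((g.naturality (homOfLE h).op).symm) c)

/-- Near the image of y the section m is a fraction a / r of a section over V; pulling back the
relation r m = a gives a fraction with denominator r, viewed in degree zero of the Cox ring. -/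
lemma isGermFraction_pullbackSection {V : X.Opens} (hVa : IsAffineOpen V)
    (hM : IsGermLocalizing M.val V) {W : (charSpace Λ).Opens} (h : W ≤ charProj Λ ⁻¹ᵁ V)
    {y : charSpace Λ} (hy : y ∈ W) {V' : X.Opens} (e : W ≤ charProj Λ ⁻¹ᵁ V') (m : Γ(M, V')) :
    IsGermFraction ((Scheme.Modules.pullback (charProj Λ)).obj M).val (coxFunctionEquiv Λ hVa)
      (pullTensor M hVa) h y
      (res ((Scheme.Modules.pullback (charProj Λ)).obj M) e
        (pullbackSection (charProj Λ) M V' m)) := by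
  let g := charProj Λ
  let Q := (Scheme.Modules.pullback g).obj M
  obtain ⟨r, a, V₁, e₁, hxV₁, hxr, hra⟩ : ∃ (r : Γ(X, V)) (a : Γ(M, V)) (V₁ : X.Opens)
      (e₁ : V₁ ≤ V' ⊓ V), g y ∈ V₁ ∧ g y ∈ X.basicOpen r ∧
      res M e₁ (resO inf_le_right r • res M inf_le_left m) =
        res M (e₁.trans inf_le_right) a :=
    hM.exists_smul_eq (V' ⊓ V) inf_le_right (g y) ⟨e hy, h hy⟩ (res M inf_le_left m)
  have hra' : resO (e₁.trans inf_le_right) r • res M (e₁.trans inf_le_left) m =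
      res M (e₁.trans inf_le_right) a := by
    rwa [res_smul, resO_resO, res_res] at hra
  have h1 := congrArg (fun w => res Q (inf_le_right : W ⊓ g ⁻¹ᵁ V₁ ≤ g ⁻¹ᵁ V₁)
    (pullbackSection g M V₁ w)) hra'
  simp only [pullbackSection_smul, res_smul] at h1
  rw [← res_pullbackSection, ← res_pullbackSection, res_res, res_res, ← resO_app, resO_resO] at h1
  have hρ : coxFunctionEquiv Λ hVa (algebraMap Γ(X, V) (CoxRing Λ V) r) = g.app V r :=
    (charProj_app_eq hVa r).symm
  have hj : pullTensor M hVa (1 ⊗ₜ a) = pullbackSection g M V a := by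
    rw [pullTensor_tmul, pullForm, map_one, one_smul]
  refine ⟨algebraMap Γ(X, V) (CoxRing Λ V) r, 1 ⊗ₜ a, W ⊓ g ⁻¹ᵁ V₁, inf_le_left, ⟨hy, hxV₁⟩, ?_, ?_⟩
  · rw [hρ, ← Scheme.preimage_basicOpen]
    exact hxr
  · rw [hρ]
    refine Eq.trans ?_ (congrArg (res Q (inf_le_left.trans h)) hj.symm)
    change res Q inf_le_left (resO h (g.app V r) • res Q e (pullbackSection g M V' m)) = _
    rw [res_smul, resO_resO, res_res]
    exact h1

/-- Germs of π^* M are combinations of pulled-back sections, and fractions are stable under sums and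
multiples. -/
lemma isGermFraction_pullTensor {V : X.Opens} (hVa : IsAffineOpen V)
    (hM : IsGermLocalizing M.val V) {W : (charSpace Λ).Opens} (h : W ≤ charProj Λ ⁻¹ᵁ V)
    {y : charSpace Λ} (hy : y ∈ W)
    (z : Γ((Scheme.Modules.pullback (charProj Λ)).obj M, W)) :
    IsGermFraction ((Scheme.Modules.pullback (charProj Λ)).obj M).val (coxFunctionEquiv Λ hVa)
      (pullTensor M hVa) h y z := by
  obtain ⟨W', e, hyW', hz⟩ := exists_res_mem_pullbackSpan (charProj Λ) M z hy
  refine .of_res e ?_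
  change IsGermFraction _ _ _ _ y (res ((Scheme.Modules.pullback (charProj Λ)).obj M) e z)
  generalize res ((Scheme.Modules.pullback (charProj Λ)).obj M) e z = z' at hz
  induction hz using Submodule.span_induction with
  | zero =>
    exact .of_eq hyW' (0 : CoxRing Λ V ⊗[Γ(X, V)] Γ(M, V))
      ((map_zero (res ((Scheme.Modules.pullback (charProj Λ)).obj M) (e.trans h))).symm.trans
        (congrArg (res ((Scheme.Modules.pullback (charProj Λ)).obj M) (e.trans h))
          (map_zero (pullTensor M hVa)).symm))
  | add a b _ _ ha hb => exact ha.add (pullTensor_smul M hVa) hb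
  | smul c a _ ha =>
    exact ha.smul (pullTensor_smul M hVa)
      (charProj_preimage_isAffineOpen Λ hVa) hyW' c
  | mem n hn =>
    obtain ⟨V', e', m, rfl⟩ := hn
    exact isGermFraction_pullbackSection M hVa hM (e.trans h) hyW' e' m

end PullbackForms

section PushSection

variable {Y X : Scheme.{0}} (f : Y ⟶ X) (M : Y.Modules)

/-- The sections of `M` over `f⁻¹ V`, as sections of `f_* M`. -/
def pushSection (V : X.Opens) : Γ(M, f ⁻¹ᵁ V) ≃+ Γ((Scheme.Modules.pushforward f).obj M, V) :=
  AddEquiv.refl _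

lemma pushSection_smul (V : X.Opens) (c : Γ(X, V)) (m : Γ(M, f ⁻¹ᵁ V)) :
    pushSection f M V (f.app V c • m) = c • pushSection f M V m := rfl

lemma res_pushSection {V W : X.Opens} (h : W ≤ V) (m : Γ(M, f ⁻¹ᵁ V)) :
    res ((Scheme.Modules.pushforward f).obj M) h (pushSection f M V m) =
      pushSection f M W (res M (f.preimage_mono h) m) := rfl

end PushSection

/-! ### The left-hand square and the isomorphism on inverse images -/

section PullbackIso

variable {X S : Scheme.{0}} [IsIntegral X] (p : X ⟶ S) {Λ : AddSubgroup (CartierDivisor X)}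
  (T : LocalEquations Λ)

lemma cotangentFst_pullbackSection {Y X S : Scheme.{0}} (g : Y ⟶ X) (f : X ⟶ S) (V : X.Opens)
    (w : Γ(differentials f, V)) :
    (cotangentFst g f).app (g ⁻¹ᵁ V) (pullbackSection g (differentials f) V w) =
      (differentialsPush g f).app V w := by
  have h := ((Scheme.Modules.pullbackPushforwardAdjunction g).homEquiv _ _).apply_symm_apply
    (differentialsPush g f)
  rw [Adjunction.homEquiv_unit] at h
  exact congr(($h).app V w)

lemma cotangentFst_pullForm {V : X.Opens} (hVa : IsAffineOpen V) (t : CoxRing Λ V) (c : Γ(X, V)) :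
    (cotangentFst (charProj Λ) p).app (charProj Λ ⁻¹ᵁ V)
        (pullForm (differentials p) hVa t (d p V c)) =
      coxForm (charProj Λ ≫ p) hVa t (algebraMap Γ(X, V) (CoxRing Λ V) c) := by
  rw [pullForm, Scheme.Modules.Hom.app_smul, cotangentFst_pullbackSection, differentialsPush_d,
    coxForm]
  exact congrArg (fun z => _ • d (charProj Λ ≫ p) (charProj Λ ⁻¹ᵁ V) z)
    (coxFunction_coxAlgebraMap Λ ⟨V, hVa⟩ c).symm

lemma algebraMap_eq_smul_generator {i : T.Idx} {V : X.Opens} (hV : V ≤ T.opens i) (c : Γ(X, V)) :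
    algebraMap Γ(X, V) (CoxRing Λ V) c = c • generator T i 0 V hV := by
  rw [generator_zero, Algebra.algebraMap_eq_smul_one]

/-- Additive maps on a tensor product with a module of differentials agree if they agree on
the tensors `t ⊗ dc`. -/
lemma addMonoidHom_eq_of_tmul_d [IsAffine S] {V : X.Opens} (hVa : IsAffineOpen V) {Q : Type*}
    [AddCommGroup Q] {F G : CoxRing Λ V ⊗[Γ(X, V)] Γ(differentials p, V) →+ Q}
    (h : ∀ t (c : Γ(X, V)), F (t ⊗ₜ d p V c) = G (t ⊗ₜ d p V c)) (z) : F z = G z := by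
  induction z using TensorProduct.induction_on with
  | zero => rw [map_zero, map_zero]
  | add a b ha hb => rw [map_add, map_add, ha, hb]
  | tmul t w =>
    refine addMonoidHom_eq_of_span_smul (R := Γ(X, V))
      (d_span p hVa (isAffineOpen_top S) le_top)
      (F := F.comp (TensorProduct.mk Γ(X, V) (CoxRing Λ V) Γ(differentials p, V) t).toAddMonoidHom)
      (G := G.comp (TensorProduct.mk Γ(X, V) (CoxRing Λ V) Γ(differentials p, V) t).toAddMonoidHom)
      ?_ w
    rintro r _ ⟨c, rfl⟩
    change F (t ⊗ₜ (r • d p V c)) = G (t ⊗ₜ (r • d p V c))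
    rw [← TensorProduct.smul_tmul]
    exact h _ c

section Square

variable [Module.Flat ℤ Λ] [IsAffine S]
  (φ : (Scheme.Modules.pushforward (charProj Λ)).obj (differentials (charProj Λ ≫ p)) ≅
    tensorCox Λ (eulerSheaf p T))
  (hφ : ∀ (i : T.Idx) (l : Λ) (V : X.Opens) (hV : V ≤ T.opens i) (hVa : IsAffineOpen V)
    (t : CoxRing Λ V) (c : Γ(X, V)),
    φ.hom.app V (coxForm (charProj Λ ≫ p) hVa t (c • generator T i l V hV)) =
      tmulCox Λ (eulerSheaf p T) V (eulerDifferential T p i l V hV c) (generator T i l V hV * t))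

/-- The map `t ⊗ w ↦ w ⊗ t`. -/
def tmulCoxFlip (M : X.Modules) (V : X.Opens) :
    CoxRing Λ V ⊗[Γ(X, V)] Γ(M, V) →+ Γ(tensorCox Λ M, V) :=
  (toSheafify (preTensorCox Λ M) V).comp
    (TensorProduct.comm Γ(X, V) (CoxRing Λ V) Γ(M, V)).toAddEquiv.toAddMonoidHom

lemma tmulCoxFlip_bijective {i : T.Idx} {V : X.Opens} (hV : V ≤ T.opens i)
    (hVa : IsAffineOpen V) : Function.Bijective (tmulCoxFlip (Λ := Λ) (differentials p) V) :=
  ((isGermLocalizing_preTensorCox (differentials p) T i hV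
    (isGermLocalizing_differentials_of_isAffine p hVa)).toSheafify_bijective hVa).comp
    (TensorProduct.comm Γ(X, V) (CoxRing Λ V) Γ(differentials p, V)).bijective

include hφ

/-- The left square, before its left arrow is known. On t ⊗ dc the form π^*(dc) is the differential
of a monomial of degree zero, which φ sends to (dc, 0) ⊗ t. -/
lemma hom_app_cotangentFst_pullTensor {i : T.Idx} {V : X.Opens} (hV : V ≤ T.opens i)
    (hVa : IsAffineOpen V) (z : CoxRing Λ V ⊗[Γ(X, V)] Γ(differentials p, V)) :
    φ.hom.app V (show Γ(differentials (charProj Λ ≫ p), charProj Λ ⁻¹ᵁ V) from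
        (cotangentFst (charProj Λ) p).app (charProj Λ ⁻¹ᵁ V)
          (pullTensor (differentials p) hVa z)) =
      (eulerRowFst p T).app V (tmulCoxFlip (differentials p) V z) := by
  let F₂ : Γ(differentials (charProj Λ ≫ p), charProj Λ ⁻¹ᵁ V) →+
    Γ(tensorCox Λ (eulerSheaf p T), V) := (φ.hom.app V).hom
  let F₁ : Γ((Scheme.Modules.pullback (charProj Λ)).obj (differentials p), charProj Λ ⁻¹ᵁ V) →+
    Γ(tensorCox Λ (eulerSheaf p T), V) :=
    F₂.comp ((cotangentFst (charProj Λ) p).app (charProj Λ ⁻¹ᵁ V)).hom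
  refine addMonoidHom_eq_of_tmul_d p hVa (F := F₁.comp (pullTensor (differentials p) hVa))
    (G := ((eulerRowFst p T).app V).hom.comp (tmulCoxFlip (differentials p) V)) (fun t c => ?_) z
  refine (congrArg F₂ (cotangentFst_pullForm p hVa t c)).trans ?_
  rw [algebraMap_eq_smul_generator T hV]
  refine (hφ i 0 V hV hVa t c).trans ?_
  rw [generator_zero, one_mul, eulerDifferential_zero, ← eulerFst_app]
  exact (tensorCoxMap_tmul Λ (eulerFst p T) V _ t).symm

/-- Sections are fractions because pulled-back sections generate. For vanishing, a tensor z that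
dies in π^* Ω_X locally also dies in Ω_Ŷ, whose germs are localizations; so some r z dies in Ω_Ŷ
over π⁻¹V. By the square its image in ℛ_Λ ⊗ 𝒮̂_Λ under the injective first map of the lower row is
zero, whence r z = 0. -/
lemma isGermLocalization_pullTensor {i : T.Idx} {V : X.Opens} (hV : V ≤ T.opens i)
    (hVa : IsAffineOpen V) :
    IsGermLocalization ((Scheme.Modules.pullback (charProj Λ)).obj (differentials p)).val
      (coxFunctionEquiv Λ hVa) (pullTensor (differentials p) hVa) where
  map_smul := pullTensor_smul _ hVa
  exists_smul_eq W h y hy z := isGermFraction_pullTensor _ hVa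
    (isGermLocalizing_differentials_of_isAffine p hVa) h hy z
  exists_smul_eq_zero W h y hy z hz := by
    let cf := cotangentFst (charProj Λ) p
    have hΩ := isGermLocalizing_differentials (charProj Λ ≫ p)
      (charProj_preimage_isAffineOpen Λ hVa) (isAffineOpen_top S) le_top
    have h0 : res (differentials (charProj Λ ≫ p)) h
        (cf.app _ (pullTensor (differentials p) hVa z)) = 0 := by
      rw [res_app]
      exact (congrArg (cf.app W) hz).trans (map_zero _)
    obtain ⟨r, hr, hrz⟩ := hΩ.exists_smul_eq_zero W h y hy _ h0
    obtain ⟨r, rfl⟩ := (coxFunctionEquiv Λ hVa).surjective r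
    refine ⟨r, hr, (tmulCoxFlip_bijective p T hV hVa).1 ?_⟩
    rw [map_zero]
    refine eulerRowFst_app_injective p T ⟨hVa, i, hV⟩ ?_
    rw [map_zero, ← hom_app_cotangentFst_pullTensor p T φ hφ hV hVa]
    have h1 : cf.app _ (pullTensor (differentials p) hVa (r • z)) = 0 := by
      rw [pullTensor_smul, Scheme.Modules.Hom.app_smul]
      exact hrz
    exact (congrArg (φ.hom.app V) h1).trans (map_zero (φ.hom.app V).hom)

/-- The isomorphism `π_* π^* Ω_X ≅ Ω_X ⊗ 𝒮̂_Λ`. -/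
theorem exists_pushforward_pullback_iso :
    ∃ α : (Scheme.Modules.pushforward (charProj Λ)).obj
        ((Scheme.Modules.pullback (charProj Λ)).obj (differentials p)) ≅
          tensorCox Λ (differentials p),
      ∀ (i : T.Idx) (V : X.Opens) (_ : V ≤ T.opens i) (hVa : IsAffineOpen V)
        (z : CoxRing Λ V ⊗[Γ(X, V)] Γ(differentials p, V)),
        α.hom.app V (pushSection (charProj Λ) _ V (pullTensor (differentials p) hVa z)) =
          tmulCoxFlip (differentials p) V z := by
  have key : ∀ V ∈ smallAffines T, ∃ F : Γ((Scheme.Modules.pushforward (charProj Λ)).obj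
      ((Scheme.Modules.pullback (charProj Λ)).obj (differentials p)), V) ≃+
        Γ(tensorCox Λ (differentials p), V), (∀ (c : Γ(X, V)) z, F (c • z) = c • F z) ∧
      ∀ (hVa : IsAffineOpen V) z,
        F (pushSection (charProj Λ) _ V (pullTensor (differentials p) hVa z)) =
        tmulCoxFlip (differentials p) V z := by
    rintro V ⟨hVa, i, hV⟩
    let J := AddEquiv.ofBijective _ ((isGermLocalization_pullTensor p T φ hφ hV hVa).bijective
      (charProj_preimage_isAffineOpen Λ hVa))
    let G := AddEquiv.ofBijective _ (tmulCoxFlip_bijective p T hV hVa)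
    have hG (c : Γ(X, V)) (z : CoxRing Λ V ⊗[Γ(X, V)] Γ(differentials p, V)) :
        G (algebraMap Γ(X, V) (CoxRing Λ V) c • z) = c • G z := by
      rw [algebraMap_smul]
      refine (congrArg (toSheafify (preTensorCox Λ (differentials p)) V)
        ((TensorProduct.comm Γ(X, V) (CoxRing Λ V) Γ(differentials p, V)).map_smul c z)).trans ?_
      exact toSheafify_smul' _ _ _ _
    have hJ (c : Γ(X, V)) (z : CoxRing Λ V ⊗[Γ(X, V)] Γ(differentials p, V)) :
        J (algebraMap Γ(X, V) (CoxRing Λ V) c • z) = (charProj Λ).app V c • J z := by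
      rw [charProj_app_eq hVa]
      exact pullTensor_smul _ hVa _ z
    let K := J.trans (pushSection (charProj Λ)
      ((Scheme.Modules.pullback (charProj Λ)).obj (differentials p)) V)
    have hK (c : Γ(X, V)) (z : CoxRing Λ V ⊗[Γ(X, V)] Γ(differentials p, V)) :
        K (algebraMap Γ(X, V) (CoxRing Λ V) c • z) = c • K z :=
      (congrArg (pushSection (charProj Λ) _ V) (hJ c z)).trans (pushSection_smul _ _ V c _)
    refine ⟨K.symm.trans G, fun c z => ?_, fun _ z => ?_⟩
    · obtain ⟨z, rfl⟩ := K.surjective z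
      rw [← hK, AddEquiv.trans_apply, AddEquiv.trans_apply, K.symm_apply_apply,
        K.symm_apply_apply, hG]
    · exact congrArg G (K.symm_apply_apply z)
  choose F hFs hF using key
  obtain ⟨α, hα, -⟩ := exists_iso_of_basis (isBasis_smallAffines T) F hFs
    (fun V hV W hW h z => by
      obtain ⟨hVa, i, hVi⟩ := hV
      let P := pushSection (charProj Λ)
        ((Scheme.Modules.pullback (charProj Λ)).obj (differentials p)) V
      obtain ⟨z, rfl⟩ := P.surjective z
      obtain ⟨z, rfl⟩ := ((isGermLocalization_pullTensor p T φ hφ hVi hVa).bijective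
        (charProj_preimage_isAffineOpen Λ hVa)).2 z
      refine Eq.trans ?_ (congrArg (res (tensorCox Λ (differentials p)) h)
        (hF V ⟨hVa, i, hVi⟩ hVa z).symm)
      refine addMonoidHom_eq_of_tmul_d p hVa
        (F := ((F W hW).toAddMonoidHom.comp (res ((Scheme.Modules.pushforward (charProj Λ)).obj
          ((Scheme.Modules.pullback (charProj Λ)).obj (differentials p))) h)).comp
            (P.toAddMonoidHom.comp (pullTensor (differentials p) hVa)))
        (G := (res (tensorCox Λ (differentials p)) h).comp (tmulCoxFlip (differentials p) V))
        (fun t c => ?_) z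
      refine (congrArg (F W hW) (congrArg (pushSection (charProj Λ) _ W)
        (res_pullForm (differentials p) hVa hW.1 h t (d p V c)))).trans ?_
      refine (hF W hW hW.1 (_ ⊗ₜ _)).trans ?_
      exact (res_tmulCox (differentials p) h (d p V c) t).symm)
  exact ⟨α, fun i V hV hVa z => (hα V ⟨hVa, i, hV⟩ _).trans (hF V ⟨hVa, i, hV⟩ hVa z)⟩

end Square

end PullbackIso

/-! ### The diagram -/

section Diagram

variable {X S : Scheme.{0}} [IsIntegral X] (p : X ⟶ S) {Λ : AddSubgroup (CartierDivisor X)}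
  (T : LocalEquations Λ)

lemma cotangentSnd_coxForm {V : X.Opens} (hVa : IsAffineOpen V) (t s : CoxRing Λ V) :
    (cotangentSnd (charProj Λ) p).app (charProj Λ ⁻¹ᵁ V) (coxForm (charProj Λ ≫ p) hVa t s) =
      coxForm (charProj Λ) hVa t s := by
  rw [coxForm, Scheme.Modules.Hom.app_smul]
  exact congrArg (coxFunction Λ ⟨V, hVa⟩ t • ·)
    (differentialsDesc_d (charProj Λ ≫ p) _ _ _ _ _ (charProj Λ ⁻¹ᵁ V) _)

lemma eulerSnd_eulerDifferential (i : T.Idx) (l : Λ) {V : X.Opens} (hV : V ≤ T.opens i)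
    (c : Γ(X, V)) :
    (eulerSnd p T).app V (eulerDifferential T p i l V hV c) = latticeSection V (c ⊗ₜ l) := by
  rw [eulerDifferential_eq, eulerSnd_app_toSheafify]
  rfl

variable [Module.Flat ℤ Λ] [IsAffine S]
  (φ : (Scheme.Modules.pushforward (charProj Λ)).obj (differentials (charProj Λ ≫ p)) ≅
    tensorCox Λ (eulerSheaf p T))
  (hφ : ∀ (i : T.Idx) (l : Λ) (V : X.Opens) (hV : V ≤ T.opens i) (hVa : IsAffineOpen V)
    (t : CoxRing Λ V) (c : Γ(X, V)),
    φ.hom.app V (coxForm (charProj Λ ≫ p) hVa t (c • generator T i l V hV)) =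
      tmulCox Λ (eulerSheaf p T) V (eulerDifferential T p i l V hV c) (generator T i l V hV * t))
  (γ : (Scheme.Modules.pushforward (charProj Λ)).obj (differentials (charProj Λ)) ≅
    tensorCox Λ (latticeSheaf Λ))
  (hγ : ∀ (i : T.Idx) (l : Λ) (V : X.Opens) (hV : V ≤ T.opens i) (hVa : IsAffineOpen V)
    (t : CoxRing Λ V) (c : Γ(X, V)),
    γ.hom.app V (coxForm (charProj Λ) hVa t (c • generator T i l V hV)) =
      tmulCox Λ (latticeSheaf Λ) V (latticeSection V (c ⊗ₜ l)) (generator T i l V hV * t))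
  (α : (Scheme.Modules.pushforward (charProj Λ)).obj
      ((Scheme.Modules.pullback (charProj Λ)).obj (differentials p)) ≅
        tensorCox Λ (differentials p))
  (hα : ∀ (i : T.Idx) (V : X.Opens) (_ : V ≤ T.opens i) (hVa : IsAffineOpen V)
    (z : CoxRing Λ V ⊗[Γ(X, V)] Γ(differentials p, V)),
    α.hom.app V (pushSection (charProj Λ) _ V (pullTensor (differentials p) hVa z)) =
      tmulCoxFlip (differentials p) V z)

include hφ in
lemma isInducedByDerivation : IsInducedByDerivation p T φ.hom := by
  intro i l V hVa hV h hh s hs t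
  rw [coxMonomial_eq_smul_generator T i hV l h hh s hs]
  exact hφ i l V hV hVa t s

include hφ hα in
lemma cotangentRowFst_comp : cotangentRowFst p Λ ≫ φ.hom = α.hom ≫ eulerRowFst p T := by
  refine hom_ext_of_basis (isBasis_smallAffines T) fun V hV z => ?_
  obtain ⟨hVa, i, hVi⟩ := hV
  obtain ⟨z, rfl⟩ := (pushSection (charProj Λ)
    ((Scheme.Modules.pullback (charProj Λ)).obj (differentials p)) V).surjective z
  obtain ⟨z, rfl⟩ := ((isGermLocalization_pullTensor p T φ hφ hVi hVa).bijective
    (charProj_preimage_isAffineOpen Λ hVa)).2 z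
  refine (hom_app_cotangentFst_pullTensor p T φ hφ hVi hVa z).trans ?_
  exact congrArg ((eulerRowFst p T).app V) (hα i V hVi hVa z).symm

include hφ hγ in
lemma cotangentRowSnd_comp : cotangentRowSnd p Λ ≫ γ.hom = φ.hom ≫ eulerRowSnd p T := by
  refine hom_ext_of_basis (isBasis_smallAffines T) fun V hV z => ?_
  obtain ⟨hVa, i, hVi⟩ := hV
  let F₂ : Γ(differentials (charProj Λ), charProj Λ ⁻¹ᵁ V) →+
    Γ(tensorCox Λ (latticeSheaf Λ), V) := (γ.hom.app V).hom
  let F₁ : Γ(differentials (charProj Λ ≫ p), charProj Λ ⁻¹ᵁ V) →+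
    Γ(tensorCox Λ (eulerSheaf p T), V) := (φ.hom.app V).hom
  refine addMonoidHom_eq_of_coxForm (charProj Λ ≫ p) i hVi hVa (isAffineOpen_top S) le_top
    (F := F₂.comp ((cotangentSnd (charProj Λ) p).app (charProj Λ ⁻¹ᵁ V)).hom)
    (G := ((eulerRowSnd p T).app V).hom.comp F₁) (fun t l c => ?_) z
  refine (congrArg F₂ (cotangentSnd_coxForm p hVa t _)).trans ((hγ i l V hVi hVa t c).trans ?_)
  refine Eq.trans ?_ (congrArg ((eulerRowSnd p T).app V) (hφ i l V hVi hVa t c)).symm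
  rw [eulerRowSnd, tensorCoxMap_tmul, eulerSnd_eulerDifferential]

-- Since γ is an isomorphism, the composite vanishes because the corresponding composite in the
-- lower row does.
include hφ hγ hα in
lemma cotangentRow_comp : cotangentRowFst p Λ ≫ cotangentRowSnd p Λ = 0 := by
  rw [← cancel_mono γ.hom, Category.assoc, cotangentRowSnd_comp p T φ hφ γ hγ, ← Category.assoc,
    cotangentRowFst_comp p T φ hφ α hα, Category.assoc, eulerRow_comp, Limits.comp_zero,
    Limits.zero_comp]

include hφ hγ hα in
/-- The direct image of the relative cotangent sequence is exact. -/
lemma cotangentRow_shortExact (w : cotangentRowFst p Λ ≫ cotangentRowSnd p Λ = 0) :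
    (ShortComplex.mk (cotangentRowFst p Λ) (cotangentRowSnd p Λ) w).ShortExact :=
  ShortComplex.shortExact_of_iso (ShortComplex.isoMk α φ γ
    (cotangentRowFst_comp p T φ hφ α hα).symm (cotangentRowSnd_comp p T φ hφ γ hγ).symm).symm
    (eulerRow_shortExact p T)

end Diagram

/-! ### Decompositions -/

section Decomposition

variable {ι A : Type*} [AddCommGroup A]

/-- `A` is the direct sum of the subgroups `S l`. -/
structure HasDecomposition (S : ι → AddSubgroup A) : Prop where
  exists_sum_eq : ∀ m, ∃ f : ι →₀ A, (∀ l, f l ∈ S l) ∧ f.sum (fun _ a => a) = m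
  eq_zero : ∀ f : ι →₀ A, (∀ l, f l ∈ S l) → f.sum (fun _ a => a) = 0 → f = 0

lemma HasDecomposition.isInternal [DecidableEq ι] {S : ι → AddSubgroup A}
    (H : HasDecomposition S) : DirectSum.IsInternal S := by
  classical
  constructor
  · rw [injective_iff_map_eq_zero]
    intro x hx
    let f : ι →₀ A := Finsupp.onFinset x.support (fun l => (x l : A)) fun l hl =>
      DFinsupp.mem_support_iff.2 fun h => hl (by rw [h]; rfl)
    have hf : f = 0 := H.eq_zero f (fun l => (x l).2) (by
      rw [← hx, DirectSum.coeAddMonoidHom_eq_dfinsuppSum]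
      exact Finsupp.onFinset_sum _ fun _ => rfl)
    refine DFinsupp.ext fun l => Subtype.ext ?_
    exact DFunLike.congr_fun hf l
  · intro m
    obtain ⟨f, hf, rfl⟩ := H.exists_sum_eq m
    refine ⟨∑ l ∈ f.support, DirectSum.of (fun l => S l) l ⟨f l, hf l⟩, ?_⟩
    rw [map_sum]
    exact Finset.sum_congr rfl fun l _ => DirectSum.coeAddMonoidHom_of _ _ _

lemma HasDecomposition.of_equiv {B : Type*} [AddCommGroup B] {S : ι → AddSubgroup A}
    {S' : ι → AddSubgroup B} (H : HasDecomposition S) (e : B ≃+ A)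
    (he : ∀ l b, b ∈ S' l → e b ∈ S l) (he' : ∀ l a, a ∈ S l → e.symm a ∈ S' l) :
    HasDecomposition S' where
  exists_sum_eq m := by
    obtain ⟨f, hf, hfm⟩ := H.exists_sum_eq (e m)
    refine ⟨f.mapRange e.symm (map_zero _), fun l => he' l _ (hf l), ?_⟩
    rw [Finsupp.sum_mapRange_index fun _ => rfl]
    apply e.injective
    rw [← hfm, map_finsuppSum]
    simp only [AddEquiv.apply_symm_apply]
  eq_zero f hf h := by
    have := H.eq_zero (f.mapRange e (map_zero _)) (fun l => he l _ (hf l)) (by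
      rw [Finsupp.sum_mapRange_index fun _ => rfl, ← map_finsuppSum, h, map_zero])
    refine Finsupp.ext fun l => e.injective ?_
    rw [Finsupp.zero_apply, map_zero]
    exact DFunLike.congr_fun this l

end Decomposition

/-! ### Subsheaves generated by sections -/

section SheafSpan

variable {X : Scheme.{0}} {M N : X.Modules}

lemma germ_res (M : X.Modules) {U V : X.Opens} (h : V ≤ U) {x : X} (hx : x ∈ V) (m : Γ(M, U)) :
    (M.presheaf.germ V x hx).hom (res M h m) = (M.presheaf.germ U x (h hx)).hom m :=
  TopCat.Presheaf.germ_res_apply M.presheaf (homOfLE h) x hx m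

lemma exists_res_eq_of_germ_eq (M : X.Modules) {U V : X.Opens} {x : X} (hx : x ∈ U) (hx' : x ∈ V)
    {m : Γ(M, U)} {n : Γ(M, V)}
    (h : (M.presheaf.germ U x hx).hom m = (M.presheaf.germ V x hx').hom n) :
    ∃ (W : X.Opens) (e : W ≤ U) (e' : W ≤ V), x ∈ W ∧ res M e m = res M e' n := by
  obtain ⟨W, hxW, e, e', he⟩ := TopCat.Presheaf.germ_eq M.presheaf x hx hx' m n h
  exact ⟨W, e.le, e'.le, hxW, he⟩

variable (G : ∀ V : X.Opens, Set Γ(M, V))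

/-- The group of germs generated by given sections. -/
def germSpan (x : X) : AddSubgroup (M.presheaf.stalk x) :=
  AddSubgroup.closure {g | ∃ (V : X.Opens) (hx : x ∈ V), ∃ m ∈ G V,
    (M.presheaf.germ V x hx).hom m = g}

variable {G}

lemma mem_sheafSpan_iff {U : X.Opens} {m : Γ(M, U)} : m ∈ sheafSpan M G U ↔
    ∀ (x : X) (hx : x ∈ U), (M.presheaf.germ U x hx).hom m ∈ germSpan G x := by
  rw [sheafSpan, AddSubgroup.mem_iInf]
  exact ⟨fun h x hx => h ⟨x, hx⟩, fun h x => h x.1 x.2⟩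

lemma res_mem_sheafSpan {U V : X.Opens} (h : V ≤ U) {m : Γ(M, U)} (hm : m ∈ sheafSpan M G U) :
    res M h m ∈ sheafSpan M G V := by
  rw [mem_sheafSpan_iff] at hm ⊢
  intro x hx
  rw [germ_res]
  exact hm x (h hx)

lemma mem_sheafSpan_of_local {U : X.Opens} {m : Γ(M, U)}
    (H : ∀ x ∈ U, ∃ (V : X.Opens) (e : V ≤ U), x ∈ V ∧ res M e m ∈ sheafSpan M G V) :
    m ∈ sheafSpan M G U := by
  rw [mem_sheafSpan_iff]
  intro x hx
  obtain ⟨V, e, hxV, h⟩ := H x hx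
  rw [← germ_res M e hxV]
  exact mem_sheafSpan_iff.1 h x hxV

lemma subset_sheafSpan {U : X.Opens} {m : Γ(M, U)} (hm : m ∈ G U) : m ∈ sheafSpan M G U :=
  mem_sheafSpan_iff.2 fun _ hx => AddSubgroup.subset_closure ⟨U, hx, m, hm, rfl⟩

lemma germ_app (φ : M ⟶ N) {U : X.Opens} {x : X} (hx : x ∈ U) (m : Γ(M, U)) :
    (N.presheaf.germ U x hx).hom (φ.app U m) =
      ((TopCat.Presheaf.stalkFunctor Ab x).map φ.mapPresheaf).hom
        ((M.presheaf.germ U x hx).hom m) :=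
  (TopCat.Presheaf.stalkFunctor_map_germ_apply U x hx φ.mapPresheaf m).symm

variable {Λ : Type} {G : Λ → ∀ V : X.Opens, Set Γ(M, V)} {H : Λ → ∀ V : X.Opens, Set Γ(N, V)}

/-- Membership in `sheafSpan` is tested on germs, and φ is additive on stalks, so only germs of
generators matter. -/
lemma isGraded_of_local {φ : M ⟶ N}
    (h : ∀ (l : Λ) (V : X.Opens), ∀ m ∈ G l V, ∀ x ∈ V, ∃ (W : X.Opens) (e : W ≤ V), x ∈ W ∧
      φ.app W (res M e m) ∈ sheafSpan N (H l) W) : IsGraded φ G H := by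
  intro l U m hm
  rw [mem_sheafSpan_iff] at hm ⊢
  intro x hx
  rw [germ_app]
  have key : germSpan (G l) x ≤ (germSpan (H l) x).comap
      ((TopCat.Presheaf.stalkFunctor Ab x).map φ.mapPresheaf).hom := by
    refine (AddSubgroup.closure_le _).2 ?_
    rintro _ ⟨V, hxV, n, hn, rfl⟩
    obtain ⟨W, e, hxW, h'⟩ := h l V n hn x hxV
    have h1 := mem_sheafSpan_iff.1 h' x hxW
    rw [germ_app, germ_res] at h1
    exact h1
  exact key (hm x hx)

lemma IsGraded.comp {K : X.Modules} {L : Λ → ∀ V : X.Opens, Set Γ(K, V)} {φ : M ⟶ N} {ψ : N ⟶ K}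
    (hφ : IsGraded φ G H) (hψ : IsGraded ψ H L) : IsGraded (φ ≫ ψ) G L :=
  fun l U m hm => hψ l U _ (hφ l U m hm)

/-- Decompositions over members of the basis are unique, so the homogeneous components agree on
overlaps and glue. Compactness of U is what keeps the number of nonzero components finite. -/
lemma hasDecomposition_of_basis {𝔅 : Set X.Opens} (h𝔅 : Opens.IsBasis 𝔅)
    (hG : ∀ V ∈ 𝔅, HasDecomposition fun l => sheafSpan M (G l) V) {U : X.Opens}
    (hU : IsCompact (U : Set X)) : HasDecomposition fun l => sheafSpan M (G l) U := by
  -- Uniqueness holds over every open set, without compactness; this is needed on the intersections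
  -- of members of the basis.
  have hzero : ∀ (W : X.Opens) (f : Λ →₀ Γ(M, W)), (∀ l, f l ∈ sheafSpan M (G l) W) →
      f.sum (fun _ a => a) = 0 → f = 0 := by
    intro W f hf h0
    refine Finsupp.ext fun l => eq_zero_of_res_eq_zero M fun x hx => ?_
    obtain ⟨V, hV, hVW, hxV⟩ := exists_mem_basis h𝔅 hx
    refine ⟨V, hVW, hxV, ?_⟩
    have := (hG V hV).eq_zero (f.mapRange (res M hVW) (map_zero _))
      (fun l => res_mem_sheafSpan hVW (hf l)) (by
        rw [Finsupp.sum_mapRange_index fun _ => rfl, ← map_finsuppSum, h0, map_zero])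
    exact DFunLike.congr_fun this l
  refine ⟨fun m => ?_, hzero U⟩
  classical
  choose f hf hfm using fun V : {V // V ∈ 𝔅 ∧ V ≤ U} =>
    (hG V.1 V.2.1).exists_sum_eq (res M V.2.2 m)
  have hcompat (V W : {V // V ∈ 𝔅 ∧ V ≤ U}) (l : Λ) :
      res M (inf_le_left : V.1 ⊓ W.1 ≤ V.1) (f V l) = res M inf_le_right (f W l) := by
    have := hzero (V.1 ⊓ W.1) ((f V).mapRange (res M inf_le_left) (map_zero _) -
      (f W).mapRange (res M inf_le_right) (map_zero _))
      (fun l => AddSubgroup.sub_mem _ (res_mem_sheafSpan _ (hf V l))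
        (res_mem_sheafSpan _ (hf W l))) (by
        rw [Finsupp.sum_sub_index fun _ _ _ => rfl, Finsupp.sum_mapRange_index fun _ => rfl,
          Finsupp.sum_mapRange_index fun _ => rfl, ← map_finsuppSum, ← map_finsuppSum, hfm, hfm,
          res_res, res_res, sub_self])
    exact sub_eq_zero.1 (DFunLike.congr_fun this l)
  have hcov : ∀ x ∈ U, ∃ V : {V // V ∈ 𝔅 ∧ V ≤ U}, x ∈ V.1 := fun x hx =>
    let ⟨V, hV, hVU, hxV⟩ := exists_mem_basis h𝔅 hx
    ⟨⟨V, hV, hVU⟩, hxV⟩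
  choose g hg using fun l => exists_glue M (fun V : {V // V ∈ 𝔅 ∧ V ≤ U} => V.1)
    (fun V => V.2.2) hcov (fun V => f V l) fun V W => hcompat V W l
  obtain ⟨t, ht⟩ := hU.elim_finite_subcover (fun V : {V // V ∈ 𝔅 ∧ V ≤ U} => (V.1 : Set X))
    (fun V => V.1.isOpen) (fun x hx => Set.mem_iUnion.2 (hcov x hx))
  -- A degree outside the supports over a finite subcover has a component that vanishes on each of
  -- its members.
  let F : Λ →₀ Γ(M, U) := Finsupp.onFinset (t.biUnion fun V => (f V).support) g fun l hl => by
    by_contra hl'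
    refine hl (eq_zero_of_res_eq_zero M fun x hx => ?_)
    obtain ⟨V, hV⟩ := Set.mem_iUnion.1 (ht hx)
    obtain ⟨hVt, hxV⟩ := Set.mem_iUnion.1 hV
    refine ⟨V.1, V.2.2, hxV, (hg l V).trans ?_⟩
    exact Finsupp.notMem_support_iff.1 fun h => hl' (Finset.mem_biUnion.2 ⟨V, hVt, h⟩)
  refine ⟨F, fun l => mem_sheafSpan_of_local fun x hx => ?_, eq_of_res_eq M fun x hx => ?_⟩
  · obtain ⟨V, hxV⟩ := hcov x hx
    refine ⟨V.1, V.2.2, hxV, ?_⟩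
    have : res M V.2.2 (F l) = f V l := hg l V
    rw [this]
    exact hf V l
  · obtain ⟨V, hxV⟩ := hcov x hx
    refine ⟨V.1, V.2.2, hxV, ?_⟩
    rw [← hfm V, map_finsuppSum]
    have : F.mapRange (res M V.2.2) (map_zero _) = f V := Finsupp.ext fun l => hg l V
    rw [← this, Finsupp.sum_mapRange_index fun _ => rfl]

lemma isGrading_of_hasDecomposition (hG : ∀ U, HasDecomposition fun l => sheafSpan M (G l) U) :
    IsGrading M G := by
  intro U
  classical
  exact (hG U).isInternal

lemma isGrading_of_iso (φ : M ≅ N) (hφ : IsGraded φ.hom G H) (hφ' : IsGraded φ.inv H G)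
    (hH : ∀ U, HasDecomposition fun l => sheafSpan N (H l) U) : IsGrading M G :=
  isGrading_of_hasDecomposition fun U => (hH U).of_equiv
    { toFun := φ.hom.app U
      invFun := φ.inv.app U
      left_inv := fun m => congr(($(φ.hom_inv_id)).app U m)
      right_inv := fun m => congr(($(φ.inv_hom_id)).app U m)
      map_add' := map_add (φ.hom.app U).hom } (fun l => hφ l U) (fun l => hφ' l U)

end SheafSpan

/-! ### The gradings of the diagram -/

section TensorGrading

variable {X : Scheme.{0}} [IsIntegral X] {Λ : AddSubgroup (CartierDivisor X)}
  (T : LocalEquations Λ) (N : X.Modules)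

lemma coxRestrict_mem_coxDegree {U V : X.Opens} (h : V ≤ U) {l : Λ} {s : CoxRing Λ U}
    (hs : s ∈ coxDegree Λ l U) : coxRestrict Λ h s ∈ coxDegree Λ l V :=
  fun x => hs ⟨x.1, h x.2⟩

/-- The germs of the sections `n ⊗ (f_i^λ)⁻¹`. -/
def generatorGerms (i : T.Idx) (l : Λ) {x : X} (hx : x ∈ T.opens i) :
    AddSubgroup ((tensorCox Λ N).presheaf.stalk x) where
  carrier := {g | ∃ (W : X.Opens) (hxW : x ∈ W) (hW : W ≤ T.opens i) (n : Γ(N, W)),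
    ((tensorCox Λ N).presheaf.germ W x hxW).hom (tmulCox Λ N W n (generator T i l W hW)) = g}
  zero_mem' := by
    refine ⟨T.opens i, hx, le_rfl, 0, ?_⟩
    rw [← zero_smul Γ(X, T.opens i) (0 : Γ(N, T.opens i)), smul_tmulCox, zero_smul, map_zero]
  add_mem' := by
    rintro _ _ ⟨W, hxW, hW, n, rfl⟩ ⟨W', hxW', hW', n', rfl⟩
    refine ⟨W ⊓ W', ⟨hxW, hxW'⟩, inf_le_left.trans hW,
      res N inf_le_left n + res N inf_le_right n', ?_⟩
    rw [add_tmulCox, map_add,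
      ← germ_res (tensorCox Λ N) (inf_le_left : W ⊓ W' ≤ W) ⟨hxW, hxW'⟩,
      ← germ_res (tensorCox Λ N) (inf_le_right : W ⊓ W' ≤ W') ⟨hxW, hxW'⟩, res_tmulCox,
      res_tmulCox, coxRestrict_generator, coxRestrict_generator]
  neg_mem' := by
    rintro _ ⟨W, hxW, hW, n, rfl⟩
    refine ⟨W, hxW, hW, -n, ?_⟩
    rw [← neg_one_smul Γ(X, W) n, smul_tmulCox, neg_one_smul, map_neg]

/-- Near x a homogeneous s is b (f_i^λ)⁻¹, so n ⊗ s = bn ⊗ (f_i^λ)⁻¹, and germs of this form are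
closed under sums. -/
lemma germSpan_tensorDegree_le (i : T.Idx) (l : Λ) {x : X} (hx : x ∈ T.opens i) :
    germSpan (tensorDegree Λ N l) x ≤ generatorGerms T N i l hx := by
  refine (AddSubgroup.closure_le _).2 ?_
  rintro _ ⟨V, hxV, _, ⟨n, s, hs, rfl⟩, rfl⟩
  have hW : V ⊓ T.opens i ≤ T.opens i := inf_le_right
  obtain ⟨b, hb⟩ := (mem_coxDegree_iff T i hW).1
    (coxRestrict_mem_coxDegree (inf_le_left : V ⊓ T.opens i ≤ V) hs)
  refine ⟨V ⊓ T.opens i, ⟨hxV, hx⟩, hW, b • res N inf_le_left n, ?_⟩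
  rw [tmulCox_smul, ← hb, ← res_tmulCox]
  exact germ_res _ _ _ _

section

variable {T N} (hN : ∀ (i : T.Idx) (V : X.Opens) (hV : V ≤ T.opens i), IsAffineOpen V →
  Function.Bijective (tmulSum N T i hV))

lemma generator_mem_coxDegree (i : T.Idx) (l : Λ) {V : X.Opens} (hV : V ≤ T.opens i) :
    generator T i l V hV ∈ coxDegree Λ l V := coxMonomial_mem _ _ _ _ _

include hN

/-- Near each point an element of degree l is a single term n ⊗ (f_i^l)⁻¹; uniqueness of
coefficients over small affine sets makes the other coefficients vanish locally, hence on V. -/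
lemma tmulSum_mem_sheafSpan_iff {i : T.Idx} {V : X.Opens} (hV : V ≤ T.opens i)
    (l : Λ) (b : Λ →₀ Γ(N, V)) :
    tmulSum N T i hV b ∈ sheafSpan (tensorCox Λ N) (tensorDegree Λ N l) V ↔
      ∀ k, k ≠ l → b k = 0 := by
  constructor
  · intro h k hk
    refine eq_zero_of_res_eq_zero N fun x hx => ?_
    obtain ⟨W, hxW, hW, n, hn⟩ :=
      germSpan_tensorDegree_le T N i l (hV hx) (mem_sheafSpan_iff.1 h x hx)
    obtain ⟨W₁, e₁, e₁', hxW₁, he⟩ := exists_res_eq_of_germ_eq _ hx hxW hn.symm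
    obtain ⟨W₂, ⟨hW₂, -⟩, hW₂₁, hxW₂⟩ := exists_mem_basis (isBasis_smallAffines T) hxW₁
    refine ⟨W₂, hW₂₁.trans e₁, hxW₂, ?_⟩
    have h1 := congrArg (res (tensorCox Λ N) hW₂₁) he
    rw [res_res, res_res, res_tmulSum, res_tmulCox, coxRestrict_generator, ← tmulSum_single] at h1
    have h2 := DFunLike.congr_fun ((hN i W₂ ((hW₂₁.trans e₁).trans hV) hW₂).1 h1) k
    rwa [Finsupp.mapRange_apply, Finsupp.single_eq_of_ne hk] at h2
  · intro h
    have hb : b = Finsupp.single l (b l) := Finsupp.ext fun k => by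
      by_cases hk : k = l
      · rw [hk, Finsupp.single_eq_same]
      · rw [h k hk, Finsupp.single_eq_of_ne hk]
    rw [hb, tmulSum_single]
    exact subset_sheafSpan ⟨_, _, generator_mem_coxDegree i l hV, rfl⟩

lemma hasDecomposition_tensorDegree_of_mem {V : X.Opens} (hV : V ∈ smallAffines T) :
    HasDecomposition fun l => sheafSpan (tensorCox Λ N) (tensorDegree Λ N l) V := by
  classical
  obtain ⟨hVa, i, hVi⟩ := hV
  have hbij := hN i V hVi hVa
  constructor
  · intro m
    obtain ⟨b, rfl⟩ := hbij.2 m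
    refine ⟨Finsupp.onFinset b.support (fun l => tmulSum N T i hVi (Finsupp.single l (b l)))
      fun l hl => Finsupp.mem_support_iff.2 fun h => hl (by
        rw [h, Finsupp.single_zero, map_zero]), fun l => ?_, ?_⟩
    · exact (tmulSum_mem_sheafSpan_iff hN hVi l _).2 fun k hk => Finsupp.single_eq_of_ne hk
    · rw [Finsupp.onFinset_sum _ fun _ => rfl, ← map_sum]
      exact congrArg _ b.sum_single
  · intro f hf h0
    choose b hb using fun l => hbij.2 (f l)
    have hb' (l k : Λ) (hk : k ≠ l) : b l k = 0 :=
      (tmulSum_mem_sheafSpan_iff hN hVi l _).1 ((hb l).symm ▸ hf l) k hk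
    have hsum : ∑ l ∈ f.support, b l = 0 := hbij.1 (by
      rw [map_sum, map_zero, ← h0]
      exact Finset.sum_congr rfl fun l _ => hb l)
    refine Finsupp.ext fun l => ?_
    by_cases hl : l ∈ f.support
    · have h1 := DFunLike.congr_fun hsum l
      rw [Finsupp.finsetSum_apply, Finset.sum_eq_single_of_mem l hl fun k _ hk =>
        hb' k l hk.symm] at h1
      have h2 : b l = 0 := Finsupp.ext fun k => by
        by_cases hk : k = l
        · rw [hk]
          exact h1
        · exact hb' l k hk
      rw [← hb, h2, map_zero]
      rfl
    · exact Finsupp.notMem_support_iff.1 hl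

lemma hasDecomposition_tensorDegree [NoetherianSpace X] (U : X.Opens) :
    HasDecomposition fun l => sheafSpan (tensorCox Λ N) (tensorDegree Λ N l) U :=
  hasDecomposition_of_basis (isBasis_smallAffines T)
    (fun _ hV => hasDecomposition_tensorDegree_of_mem hN hV) (NoetherianSpace.isCompact _)

end

lemma isGraded_tensorCoxMap {M N : X.Modules} (φ : M ⟶ N) :
    IsGraded (tensorCoxMap Λ φ) (tensorDegree Λ M) (tensorDegree Λ N) :=
  isGraded_of_local fun l V _ ⟨n, s, hs, hm⟩ x hx => ⟨V, le_rfl, hx, by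
    rw [← hm, res_self, tensorCoxMap_tmul]
    exact subset_sheafSpan ⟨_, s, hs, rfl⟩⟩

end TensorGrading

/-! ### The grading of the direct image of the differentials -/

section DifferentialGrading

variable {X S' : Scheme.{0}} [IsIntegral X] {Λ : AddSubgroup (CartierDivisor X)}
  {T : LocalEquations Λ} {N : X.Modules} {q : charSpace Λ ⟶ S'} (D : LogDerivation T N)
  (φ : (Scheme.Modules.pushforward (charProj Λ)).obj (differentials q) ≅ tensorCox Λ N)
  (hφ : ∀ (i : T.Idx) (l : Λ) (V : X.Opens) (hV : V ≤ T.opens i) (hVa : IsAffineOpen V)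
    (t : CoxRing Λ V) (c : Γ(X, V)),
    φ.hom.app V (coxForm q hVa t (c • generator T i l V hV)) =
      tmulCox Λ N V (D.toFun i l hV c) (generator T i l V hV * t))

lemma generator_mul_mem_coxDegree {i : T.Idx} {V : X.Opens} (hV : V ≤ T.opens i) {k l : Λ}
    {t : CoxRing Λ V} (ht : t ∈ coxDegree Λ k V) :
    generator T i l V hV * t ∈ coxDegree Λ (l + k) V := by
  obtain ⟨b, rfl⟩ := (mem_coxDegree_iff T i hV).1 ht
  refine (mem_coxDegree_iff T i hV).2 ⟨b, ?_⟩
  rw [mul_smul_comm, generator_add]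

lemma exists_generator_mul_eq {i : T.Idx} {V : X.Opens} (hV : V ≤ T.opens i) {k : Λ} (l : Λ)
    {t : CoxRing Λ V} (ht : t ∈ coxDegree Λ k V) :
    ∃ t' ∈ coxDegree Λ (k - l) V, generator T i l V hV * t' = t := by
  obtain ⟨b, rfl⟩ := (mem_coxDegree_iff T i hV).1 ht
  refine ⟨b • generator T i (k - l) V hV, (mem_coxDegree_iff T i hV).2 ⟨b, rfl⟩, ?_⟩
  rw [mul_smul_comm, ← generator_add, show l + (k - l) = k from add_sub_cancel l k]

include hφ

/-- The form t · d(c (f_i^b)⁻¹) goes to a tensor with second factor (f_i^b)⁻¹ t, whose degree is the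
total degree of the form. -/
lemma isGraded_differentialDegree :
    IsGraded φ.hom (differentialDegree Λ q) (tensorDegree Λ N) := by
  refine isGraded_of_local ?_
  rintro l V _ ⟨hVa, a, b, rfl, t, ht, s, hs, rfl⟩ x hx
  obtain ⟨W, ⟨hWa, i, hWi⟩, hWV, hxW⟩ := exists_mem_basis (isBasis_smallAffines T) hx
  refine ⟨W, hWV, hxW, ?_⟩
  obtain ⟨c, hc⟩ := (mem_coxDegree_iff T i hWi).1 (coxRestrict_mem_coxDegree hWV hs)
  have h1 : res ((Scheme.Modules.pushforward (charProj Λ)).obj (differentials q)) hWV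
      (pushSection (charProj Λ) _ V (coxForm q hVa t s)) =
      pushSection (charProj Λ) _ W
        (coxForm q hWa (coxRestrict Λ hWV t) (c • generator T i b W hWi)) := by
    rw [res_pushSection, res_coxForm q hVa hWa, hc]
  refine Set.mem_of_eq_of_mem ((congrArg (φ.hom.app W) h1).trans (hφ i b W hWi hWa _ c)) ?_
  refine subset_sheafSpan ⟨_, _, ?_, rfl⟩
  rw [show a + b = b + a from add_comm a b]
  exact generator_mul_mem_coxDegree hWi (coxRestrict_mem_coxDegree hWV ht)

/-- N is generated by the values D_k(c). If s has degree l, then s = (f_i^k)⁻¹ t' with t' of degree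
l - k, and D_k(c) ⊗ s is the image of t' · d(c (f_i^k)⁻¹), a form of total degree l. -/
lemma isGraded_inv_differentialDegree :
    IsGraded φ.inv (tensorDegree Λ N) (differentialDegree Λ q) := by
  refine isGraded_of_local ?_
  rintro l V _ ⟨n, s, hs, rfl⟩ x hx
  obtain ⟨W, ⟨hWa, i, hWi⟩, hWV, hxW⟩ := exists_mem_basis (isBasis_smallAffines T) hx
  refine ⟨W, hWV, hxW, ?_⟩
  rw [res_tmulCox]
  have hs' := coxRestrict_mem_coxDegree hWV hs
  generalize coxRestrict Λ hWV s = s' at hs'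
  have hn : res N hWV n ∈ Submodule.span Γ(X, W) {n | ∃ l c, D.toFun i l hWi c = n} := by
    rw [D.span_eq_top i hWi hWa]
    exact Submodule.mem_top
  generalize res N hWV n = n' at hn
  induction hn using Submodule.span_induction generalizing s' with
  | zero =>
    rw [← zero_smul Γ(X, W) (0 : Γ(N, W)), smul_tmulCox, zero_smul, map_zero]
    exact AddSubgroup.zero_mem _
  | add a b _ _ ha hb =>
    rw [add_tmulCox, map_add]
    exact AddSubgroup.add_mem _ (ha s' hs') (hb s' hs')
  | smul r a _ ha =>
    rw [tmulCox_smul]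
    refine ha _ ?_
    obtain ⟨b, rfl⟩ := (mem_coxDegree_iff T i hWi).1 hs'
    exact (mem_coxDegree_iff T i hWi).2 ⟨r * b, smul_smul _ _ _⟩
  | mem a ha =>
    obtain ⟨k, c, rfl⟩ := ha
    obtain ⟨t', ht', rfl⟩ := exists_generator_mul_eq hWi k hs'
    have h1 : φ.inv.app W (φ.hom.app W (pushSection (charProj Λ) (differentials q) W
      (coxForm q hWa t' (c • generator T i k W hWi)))) =
        pushSection (charProj Λ) (differentials q) W
          (coxForm q hWa t' (c • generator T i k W hWi)) := congr(($(φ.hom_inv_id)).app W _)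
    refine Set.mem_of_eq_of_mem
      ((congrArg (φ.inv.app W) (hφ i k W hWi hWa t' c)).symm.trans h1) ?_
    exact subset_sheafSpan ⟨hWa, l - k, k, sub_add_cancel l k, t', ht', _,
      (mem_coxDegree_iff T i hWi).2 ⟨c, rfl⟩, rfl⟩

end DifferentialGrading

/-! ### The grading of the direct image of the inverse image -/

section PullbackGrading

variable {X S : Scheme.{0}} [IsIntegral X] {p : X ⟶ S} {Λ : AddSubgroup (CartierDivisor X)}
  {T : LocalEquations Λ}
  (α : (Scheme.Modules.pushforward (charProj Λ)).obj
      ((Scheme.Modules.pullback (charProj Λ)).obj (differentials p)) ≅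
        tensorCox Λ (differentials p))
  (hα : ∀ (i : T.Idx) (V : X.Opens) (_ : V ≤ T.opens i) (hVa : IsAffineOpen V)
    (z : CoxRing Λ V ⊗[Γ(X, V)] Γ(differentials p, V)),
    α.hom.app V (pushSection (charProj Λ) _ V (pullTensor (differentials p) hVa z)) =
      tmulCoxFlip (differentials p) V z)

include hα

lemma isGraded_pullbackDegree :
    IsGraded α.hom (pullbackDegree Λ (differentials p)) (tensorDegree Λ (differentials p)) := by
  refine isGraded_of_local ?_
  rintro l V _ ⟨hVa, m, t, ht, rfl⟩ x hx
  obtain ⟨W, ⟨hWa, i, hWi⟩, hWV, hxW⟩ := exists_mem_basis (isBasis_smallAffines T) hx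
  refine ⟨W, hWV, hxW, ?_⟩
  have h1 : res ((Scheme.Modules.pushforward (charProj Λ)).obj
      ((Scheme.Modules.pullback (charProj Λ)).obj (differentials p))) hWV
      (pushSection (charProj Λ) _ V (pullForm (differentials p) hVa t m)) =
      pushSection (charProj Λ) _ W
        (pullForm (differentials p) hWa (coxRestrict Λ hWV t) (res _ hWV m)) := by
    rw [res_pushSection, res_pullForm (differentials p) hVa hWa]
  refine Set.mem_of_eq_of_mem
    ((congrArg (α.hom.app W) h1).trans (hα i W hWi hWa (_ ⊗ₜ _))) ?_
  exact subset_sheafSpan ⟨_, _, coxRestrict_mem_coxDegree hWV ht, rfl⟩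

lemma isGraded_inv_pullbackDegree :
    IsGraded α.inv (tensorDegree Λ (differentials p)) (pullbackDegree Λ (differentials p)) := by
  refine isGraded_of_local ?_
  rintro l V _ ⟨n, s, hs, rfl⟩ x hx
  obtain ⟨W, ⟨hWa, i, hWi⟩, hWV, hxW⟩ := exists_mem_basis (isBasis_smallAffines T) hx
  refine ⟨W, hWV, hxW, ?_⟩
  rw [res_tmulCox]
  let z := coxRestrict Λ hWV s ⊗ₜ[Γ(X, W)] res (differentials p) hWV n
  let P := pushSection (charProj Λ) ((Scheme.Modules.pullback (charProj Λ)).obj (differentials p)) W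
  have h1 : α.inv.app W (α.hom.app W (P (pullTensor (differentials p) hWa z))) =
    P (pullTensor (differentials p) hWa z) := congr(($(α.hom_inv_id)).app W _)
  refine Set.mem_of_eq_of_mem
    ((congrArg (α.inv.app W) (hα i W hWi hWa z)).symm.trans h1) ?_
  exact subset_sheafSpan ⟨hWa, res (differentials p) hWV n, coxRestrict Λ hWV s,
    coxRestrict_mem_coxDegree hWV hs, rfl⟩

end PullbackGrading

end
end CoxEuler

/-! ### The main theorem -/

theorem mainTheorem5 (X : Scheme.{0}) [IsIntegral X]
    (p : X ⟶ Spec (.of ℂ)) [IsProper p]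
    (hnormal : ∀ x : X, IsIntegrallyClosed (X.presheaf.stalk x))
    (Λ : AddSubgroup (CartierDivisor X)) [Module.Free ℤ Λ] [Module.Finite ℤ Λ]
    (T : LocalEquations Λ) (hc : ChernInjective p T)
    (hample : ∃ D ∈ Λ, IsAmple D) (hfg : CoxRingFinitelyGenerated p Λ) :
    ∃ (w : cotangentRowFst p Λ ≫ cotangentRowSnd p Λ = 0)
      (w' : eulerRowFst p T ≫ eulerRowSnd p T = 0)
      (α : (Scheme.Modules.pushforward (charProj Λ)).obj
          ((Scheme.Modules.pullback (charProj Λ)).obj (differentials p)) ≅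
        tensorCox Λ (differentials p))
      (φ : (Scheme.Modules.pushforward (charProj Λ)).obj (differentials (charProj Λ ≫ p)) ≅
        tensorCox Λ (eulerSheaf p T))
      (γ : (Scheme.Modules.pushforward (charProj Λ)).obj (differentials (charProj Λ)) ≅
        tensorCox Λ (latticeSheaf Λ)),
      -- the map in the middle is induced by the derivation of the Cox sheaf
      IsInducedByDerivation p T φ.hom ∧
      -- the rows are exact
      (ShortComplex.mk (cotangentRowFst p Λ) (cotangentRowSnd p Λ) w).ShortExact ∧
      (ShortComplex.mk (eulerRowFst p T) (eulerRowSnd p T) w').ShortExact ∧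
      -- the diagram commutes
      cotangentRowFst p Λ ≫ φ.hom = α.hom ≫ eulerRowFst p T ∧
      cotangentRowSnd p Λ ≫ γ.hom = φ.hom ≫ eulerRowSnd p T ∧
      -- the six sheaves are graded
      IsGrading _ (pullbackDegree Λ (differentials p)) ∧
      IsGrading _ (differentialDegree Λ (charProj Λ ≫ p)) ∧
      IsGrading _ (differentialDegree Λ (charProj Λ)) ∧
      IsGrading _ (tensorDegree Λ (differentials p)) ∧
      IsGrading _ (tensorDegree Λ (eulerSheaf p T)) ∧
      IsGrading _ (tensorDegree Λ (latticeSheaf Λ)) ∧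
      -- the maps preserve the degree
      IsGraded (cotangentRowFst p Λ) (pullbackDegree Λ (differentials p))
        (differentialDegree Λ (charProj Λ ≫ p)) ∧
      IsGraded (cotangentRowSnd p Λ) (differentialDegree Λ (charProj Λ ≫ p))
        (differentialDegree Λ (charProj Λ)) ∧
      IsGraded (eulerRowFst p T) (tensorDegree Λ (differentials p))
        (tensorDegree Λ (eulerSheaf p T)) ∧
      IsGraded (eulerRowSnd p T) (tensorDegree Λ (eulerSheaf p T))
        (tensorDegree Λ (latticeSheaf Λ)) ∧
      IsGraded α.hom (pullbackDegree Λ (differentials p)) (tensorDegree Λ (differentials p)) ∧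
      IsGraded φ.hom (differentialDegree Λ (charProj Λ ≫ p)) (tensorDegree Λ (eulerSheaf p T)) ∧
      IsGraded γ.hom (differentialDegree Λ (charProj Λ)) (tensorDegree Λ (latticeSheaf Λ)) := by
  -- All open subsets of X are then compact, so the decompositions into homogeneous components glue
  -- over each of them.
  have : IsNoetherian X := by
    have : IsLocallyNoetherian X := LocallyOfFiniteType.isLocallyNoetherian p
    have : CompactSpace X := QuasiCompact.compactSpace_of_compactSpace p
    exact {}
  have : Module.Flat ℤ Λ := Module.Flat.of_free
  obtain ⟨φ, hφ⟩ := exists_pushforward_differentials_iso_euler p T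
  obtain ⟨γ, hγ⟩ := exists_pushforward_differentials_iso_lattice T
  obtain ⟨α, hα⟩ := exists_pushforward_pullback_iso p T φ hφ
  have h₁ := isGraded_pullbackDegree α hα
  have h₁' := isGraded_inv_pullbackDegree α hα
  have h₂ := isGraded_differentialDegree (eulerLogDerivation p T) φ hφ
  have h₂' := isGraded_inv_differentialDegree (eulerLogDerivation p T) φ hφ
  have h₃ := isGraded_differentialDegree (latticeLogDerivation T) γ hγ
  have h₃' := isGraded_inv_differentialDegree (latticeLogDerivation T) γ hγ
  have h₄ : IsGraded (eulerRowFst p T) _ _ := isGraded_tensorCoxMap (eulerFst p T)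
  have h₅ : IsGraded (eulerRowSnd p T) _ _ := isGraded_tensorCoxMap (eulerSnd p T)
  have k₁ := hasDecomposition_tensorDegree (N := differentials p)
    fun i V hV hVa => tmulSum_bijective_differentials p T hV hVa
  have k₂ := hasDecomposition_tensorDegree (N := eulerSheaf p T)
    fun i V hV hVa => tmulSum_bijective_euler p T hV hVa
  have k₃ := hasDecomposition_tensorDegree (N := latticeSheaf Λ)
    fun i V hV hVa => tmulSum_bijective_lattice T hV hVa
  have e₁ := cotangentRowFst_comp p T φ hφ α hα
  have e₂ := cotangentRowSnd_comp p T φ hφ γ hγ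
  have w := cotangentRow_comp p T φ hφ γ hγ α hα
  refine ⟨w, eulerRow_comp p T, α, φ, γ, isInducedByDerivation p T φ hφ,
    cotangentRow_shortExact p T φ hφ γ hγ α hα w, eulerRow_shortExact p T, e₁, e₂,
    isGrading_of_iso α h₁ h₁' k₁, isGrading_of_iso φ h₂ h₂' k₂, isGrading_of_iso γ h₃ h₃' k₃,
    isGrading_of_hasDecomposition k₁, isGrading_of_hasDecomposition k₂,
    isGrading_of_hasDecomposition k₃, ?_, ?_, h₄, h₅, h₁, h₂, h₃⟩
  -- The maps of the upper row are composites of graded maps: down along a vertical isomorphism,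
  -- along the lower row, and back up.
  · rw [← (Iso.comp_inv_eq φ).2 e₁.symm]
    exact (h₁.comp h₄).comp h₂'
  · rw [← (Iso.comp_inv_eq γ).2 e₂.symm]
    exact (h₂.comp h₅).comp h₃'
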